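/- \textbf{Setting.} Let $R=\mathbb{Z}[\beta]$ with the discrete topology. For a set $S$, the linearly compact (LC) $R$-module with pseudobasis $S$ is the product $\prod_{s\in S}R s$ with the product topology; the completed tensor product of the modules with pseudobases $S$ and $S'$ is the one with pseudobasis $\{s\otimes s'\}$. A morphism of LC-Hopf algebras is a continuous $R$-linear map commuting with products, coproducts, units and counits. A \emph{labeled poset} $(P,\gamma)$ is a finite poset $P$ with an injective map $\gamma:P\to\mathbb{Z}$. An isomorphism $(P,\gamma)\cong(Q,\delta)$ is a poset isomorphism $\phi:P\to Q$ such that, for every cover $s\lessdot t$ in $P$, $\gamma(s)>\gamma(t)$ if and only if $\delta(\phi(s))>\delta(\phi(t))$. Let $\mathfrak{m}\mathsf{LPoset}$ be the LC $R$-module whose pseudobasis is the set of isomorphism classes $[(P,\gamma)]$, with the LC-Hopf structure $\nabla([(P,\gamma)]\otimes[(Q,\delta)])=[(P,\gamma)\sqcup(Q,\delta)]$ (disjoint union of posets, each keeping the relative order of its labels), $\Delta([(P,\gamma)])=\sum\beta^{|S\cap T|}[(S,\gamma|_S)]\otimes[(T,\gamma|_T)]$, summed over pairs of a lower set $S$ and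 an upper set $T$ of $P$ with $S\cup T=P$ and $S\cap T$ an antichain, unit $1\mapsto[\varnothing]$, and counit $[(P,\gamma)]\mapsto 1$ if $P=\varnothing$ and $0$ otherwise. A \emph{valley} of $(P,\gamma)$ is $v\in P$ with $\gamma(x)>\gamma(v)$ whenever $x\lessdot v$ and $\gamma(v)<\gamma(y)$ whenever $v\lessdot y$. Let $\mathfrak{m}\mathsf{LPoset}^+\supset\mathfrak{m}\mathsf{LPoset}$ be the LC $R$-module whose pseudobasis is the set of isomorphism classes $[(P,\gamma,V)]$ with $V$ a set of valleys of $(P,\gamma)$, where $[(P,\gamma)]$ is identified with $[(P,\gamma,\varnothing)]$. Let $\mathfrak{m}\mathsf{QSym}$ be the $R$-module of quasisymmetric power series in $R[[x_1,x_2,\dots]]$, of possibly unbounded degree, with the topology of coefficientwise convergence. Let $\mathbb{M}=\{1'<1<2'<2<\cdots\}$ and $|i'|=|i|=i$. For nonempty finite sets $S,T$ of positive integers or of elements of $\mathbb{M}$, write $S\preceq T$ if $\max S\le\min T$, write $S\prec T$ if $\max S<\min T$, and put $x^S=\prod_{i\in S}x_{|i|}$. For a map or tuple $\sigma$ with such values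 put $|\sigma|=\sum_s|\sigma(s)|$ and $x^\sigma=\prod_s x^{\sigma(s)}$. Define $\Gamma^{(\beta)}(P,\gamma)=\sum_\sigma\beta^{|\sigma|-|P|}x^\sigma$, summed over the maps $\sigma$ from $P$ to nonempty finite subsets of $\mathbb{Z}_{>0}$ such that for every $s\lessdot t$ one has $\sigma(s)\preceq\sigma(t)$, with $\sigma(s)\prec\sigma(t)$ if $\gamma(s)>\gamma(t)$. Define $\Omega^{(\beta)}(P,\gamma,V)=\sum_\sigma\beta^{|\sigma|-|P|}x^\sigma$, summed over the maps $\sigma$ from $P$ to nonempty finite subsets of $\mathbb{M}$ such that for every $s\lessdot t$ one has $\sigma(s)\preceq\sigma(t)$, the set $\sigma(s)\cap\sigma(t)$ has only unprimed elements if $\gamma(s)<\gamma(t)$ and only primed elements if $\gamma(s)>\gamma(t)$, and such that $\sigma(v)\subset\mathbb{Z}_{>0}$ for all $v\in V$. Put $\Omega^{(\beta)}(P,\gamma)=\Omega^{(\beta)}(P,\gamma,\varnothing)$. Let $\Phi_<:\mathfrak{m}\mathsf{LPoset}\to\mathfrak{m}\mathsf{QSym}$ and $\Phi_{>|<}:\mathfrak{m}\mathsf{LPoset}^+\to\mathfrak{m}\mathsf{QSym}$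 be the continuous linear maps with $\Phi_<([(P,\gamma)])=\Gamma^{(\beta)}(P,\gamma)$ and $\Phi_{>|<}([(P,\gamma,V)])=\Omega^{(\beta)}(P,\gamma,V)$. For a composition $\alpha=(\alpha_1,\dots,\alpha_k)$ of $N$ put $I(\alpha)=\{\alpha_1,\alpha_1+\alpha_2,\dots,\alpha_1+\cdots+\alpha_{k-1}\}$, and let $\Lambda(\alpha)$ be the composition of $N$ with $I(\Lambda(\alpha))=\{i\in I(\alpha): i>1,\ i-1\notin I(\alpha)\}$. Let $L^{(\beta)}_\alpha=\sum_S\beta^{|S|-N}x^S$, summed over the tuples $S_1\preceq\cdots\preceq S_N$ of nonempty finite subsets of $\mathbb{Z}_{>0}$ with $S_i\prec S_{i+1}$ for $i\in I(\alpha)$. Let $K^{(\beta)}_\alpha=\sum_S\beta^{|S|-N}x^S$, summed over the tuples $S_1\preceq\cdots\preceq S_N$ of nonempty finite subsets of $\mathbb{M}$ such that, for $1\le i<N$, $S_i\cap S_{i+1}$ has only primed elements if $i\in I(\alpha)$ and only unprimed elements if $i\notin I(\alpha)$. A labeled poset $(P,\gamma)$ is \emph{positive} if $\gamma$ takes only positive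 values. For $P=I\cup J$ let $\mathfrak{M}_{IJ}(P,\gamma)=(Q,\delta)$, where $Q=I\cup(-J)$ consists of a copy $s$ of each $s\in I$ and a formal negative $-s$ of each $s\in J$, with $|\pm s|=s$, with $s<t$ in $Q$ if and only if $|s|<|t|$ in $P$, and with $\delta(s)=\mathrm{sign}(s)\,\gamma(|s|)$. Let $\Psi^{(\beta)}:\mathfrak{m}\mathsf{LPoset}\to\mathfrak{m}\mathsf{LPoset}$ be the continuous linear map with $\Psi^{(\beta)}([(P,\gamma)])=\sum_{I\cup J=P}\beta^{|I\cap J|}[\mathfrak{M}_{IJ}(P,\gamma)]$ for every positive $(P,\gamma)$, the sum being over ordered pairs $(I,J)$ of subsets of $P$ with $I\cup J=P$. \textbf{Theorem.} (1) $\Psi^{(\beta)}$ is a morphism of LC-Hopf algebras $\mathfrak{m}\mathsf{LPoset}\to\mathfrak{m}\mathsf{LPoset}$. (2) $\Phi_<\circ\Psi^{(\beta)}=\Phi_{>|<}|_{\mathfrak{m}\mathsf{LPoset}}$. (3) There is a unique continuous $R$-linear map $\Theta^{(\beta)}:\mathfrak{m}\mathsf{QSym}\to\mathfrak{m}\mathsf{QSym}$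 with $\Theta^{(\beta)}(L^{(\beta)}_\alpha)=K^{(\beta)}_{\Lambda(\alpha)}$ for all compositions $\alpha$, and $\Theta^{(\beta)}\circ\Phi_<=\Phi_{>|<}|_{\mathfrak{m}\mathsf{LPoset}}$. (4) Consequently, for every positive labeled poset $(P,\gamma)$, \[\Omega^{(\beta)}(P,\gamma)=\sum_{I\cup J=P}\beta^{|I\cap J|}\,\Gamma^{(\beta)}(\mathfrak{M}_{IJ}(P,\gamma)).\] -/

import Mathlib

open scoped Polynomial MvPowerSeries.WithPiTopology

/-! Linearly compact modules over `ℤ[β]` -/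

/-- The ring of scalars `ℤ[β]`. -/
abbrev Scal : Type := ℤ[X]

/-- The indeterminate `β`. -/
noncomputable abbrev beta : Scal := Polynomial.X

/-- The scalars `ℤ[β]` carry the discrete topology. -/
instance Scal.topology : TopologicalSpace Scal := ⊥

instance Scal.discrete : DiscreteTopology Scal := ⟨rfl⟩

/-- The linearly compact `ℤ[β]`-module with pseudobasis `S`: arbitrary (infinite) linear
combinations of elements of `S`, i.e. the product of copies of `ℤ[β]` indexed by `S`,
with the product topology. -/
abbrev LC (S : Type*) := S → Scal

namespace LC

open Classical in
/-- The pseudobasis element attached to `s`. -/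
noncomputable def basis {S : Type*} (s : S) : LC S := fun t => if t = s then 1 else 0

theorem basis_self {S : Type*} (s : S) : basis s s = 1 := if_pos rfl

theorem basis_ne {S : Type*} {s t : S} (h : t ≠ s) : basis s t = 0 := if_neg h

theorem eq_of_basis_ne_zero {S : Type*} {s t : S} (h : basis s t ≠ 0) : t = s := by
  by_contra hne
  exact h (basis_ne hne)

theorem continuous_finsum_coord {S : Type*} (c : S → Scal) (h : {s | c s ≠ 0}.Finite) :
    Continuous fun x : LC S => ∑ᶠ s, x s * c s := by
  have : (fun x : LC S => ∑ᶠ s, x s * c s) = fun x => ∑ s ∈ h.toFinset, x s * c s := by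
    funext x
    apply finsum_eq_sum_of_support_subset
    intro s hs
    simp only [Function.mem_support] at hs
    simpa using right_ne_zero_of_mul hs
  rw [this]
  exact continuous_finsetSum _ fun s _ => (continuous_apply s).mul continuous_const

theorem finite_mul_support {S : Type*} (x c : S → Scal) (h : {s | c s ≠ 0}.Finite) :
    (Function.support fun s => x s * c s).Finite :=
  h.subset fun _ hs => right_ne_zero_of_mul hs

/-- The continuous linear map `LC S → LC T` with `basis s ↦ f s`.  It exists when every pseudobasis
element of the target occurs in only finitely many of the `f s`. -/
noncomputable def extend {S T : Type*} (f : S → LC T) (hf : ∀ t, {s | f s t ≠ 0}.Finite) :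
    LC S →L[Scal] LC T where
  toFun x t := ∑ᶠ s, x s * f s t
  map_add' x y := by
    funext t
    simp only [Pi.add_apply, add_mul]
    exact finsum_add_distrib (finite_mul_support x _ (hf t)) (finite_mul_support y _ (hf t))
  map_smul' r x := by
    funext t
    simp only [Pi.smul_apply, smul_eq_mul, RingHom.id_apply, mul_assoc]
    exact (mul_finsum _ _).symm
  cont := continuous_pi fun t => continuous_finsum_coord _ (hf t)

theorem finsum_basis_mul {S : Type*} (s : S) (c : S → Scal) :
    ∑ᶠ u, basis s u * c u = c s := by
  rw [finsum_eq_single _ s]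
  · rw [basis_self, one_mul]
  · intro u hu
    rw [basis_ne hu, zero_mul]

theorem extend_basis {S T : Type*} (f : S → LC T) (hf : ∀ t, {s | f s t ≠ 0}.Finite) (s : S) :
    extend f hf (basis s) = f s :=
  funext fun _ => finsum_basis_mul s _

/-- Each coordinate of a continuous linear map depends on finitely many coordinates. -/
theorem finite_coord {S T : Type*} (F : LC S →L[Scal] LC T) (t : T) :
    {s | F (basis s) t ≠ 0}.Finite := by
  have hc : Continuous fun x : LC S => F x t := (continuous_apply t).comp F.continuous
  have ho : IsOpen ((fun x : LC S => F x t) ⁻¹' {0}) := (isOpen_discrete _).preimage hc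
  obtain ⟨I, u, hu, hsub⟩ := isOpen_pi_iff.1 ho 0 (by simp)
  refine I.finite_toSet.subset fun s hs => ?_
  by_contra hI
  refine hs (hsub (a := basis s) fun i hi => ?_)
  have hne : i ≠ s := fun h => hI (h ▸ hi)
  rw [basis_ne hne]
  exact (hu i hi).2

/-- The completed tensor product of two continuous linear maps; the completed tensor product
`LC S ⊗̂ LC T` is `LC (S × T)`, where `basis (s, t)` is the tensor `basis s ⊗ basis t`. -/
noncomputable def tensorMap {S S' T T' : Type*} (F : LC S →L[Scal] LC T)
    (G : LC S' →L[Scal] LC T') : LC (S × S') →L[Scal] LC (T × T') :=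
  extend (fun s t => F (basis s.1) t.1 * G (basis s.2) t.2) fun t =>
    ((finite_coord F t.1).prod (finite_coord G t.2)).subset fun _ hs =>
      ⟨left_ne_zero_of_mul hs, right_ne_zero_of_mul hs⟩

end LC

/-- The structure maps of an LC-Hopf algebra on the linearly compact module `LC S`. -/
structure LCHopfMaps (S : Type*) where
  /-- the product `∇` -/
  mul : LC (S × S) →L[Scal] LC S
  /-- the coproduct `Δ` -/
  comul : LC S →L[Scal] LC (S × S)
  /-- the unit `ι` -/
  unit : Scal →L[Scal] LC S
  /-- the counit `ε` -/
  counit : LC S →L[Scal] Scal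

/-- A continuous linear map is a morphism of LC-Hopf algebras if it commutes with products,
coproducts, units and counits. -/
structure IsLCHopfMorphism {S T : Type*} (A : LCHopfMaps S) (B : LCHopfMaps T)
    (F : LC S →L[Scal] LC T) : Prop where
  map_mul : F ∘L A.mul = B.mul ∘L LC.tensorMap F F
  map_comul : B.comul ∘L F = LC.tensorMap F F ∘L A.comul
  map_unit : F ∘L A.unit = B.unit
  map_counit : B.counit ∘L F = A.counit

/-! Labeled posets -/

/-- A labeled poset: a finite poset with an injective integer labeling. -/
structure LabeledPoset where
  V : Type
  [order : PartialOrder V]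
  [finite : Finite V]
  label : V → ℤ
  label_inj : Function.Injective label

attribute [instance] LabeledPoset.order LabeledPoset.finite

namespace LabeledPoset

noncomputable instance instFintypeV (P : LabeledPoset) : Fintype P.V := Fintype.ofFinite P.V

noncomputable instance instDecidableEqV (P : LabeledPoset) : DecidableEq P.V :=
  Classical.decEq P.V

/-- Number of vertices. -/
noncomputable def size (P : LabeledPoset) : ℕ := Nat.card P.V

/-- `e` is an isomorphism of labeled posets: a poset isomorphism under which the two labelings
are equivalent, i.e. compare the ends of every covering relation in the same way. -/
def IsIso {P Q : LabeledPoset} (e : P.V ≃o Q.V) : Prop :=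
  ∀ s t : P.V, s ⋖ t → (P.label s > P.label t ↔ Q.label (e s) > Q.label (e t))

theorem IsIso.refl (P : LabeledPoset) : IsIso (OrderIso.refl P.V) := fun _ _ _ => Iff.rfl

theorem IsIso.symm {P Q : LabeledPoset} {e : P.V ≃o Q.V} (h : IsIso e) : IsIso e.symm := by
  intro s t hst
  have := h (e.symm s) (e.symm t) ((apply_covBy_apply_iff e.symm).2 hst)
  simpa using this.symm

theorem IsIso.trans {P Q R : LabeledPoset} {e : P.V ≃o Q.V} {f : Q.V ≃o R.V} (h : IsIso e)
    (h' : IsIso f) : IsIso (e.trans f) := fun s t hst =>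
  (h s t hst).trans (h' _ _ ((apply_covBy_apply_iff e).2 hst))

theorem IsIso.lt_iff {P Q : LabeledPoset} {e : P.V ≃o Q.V} (h : IsIso e) {s t : P.V}
    (hst : s ⋖ t) : P.label s < P.label t ↔ Q.label (e s) < Q.label (e t) := by
  have h1 : P.label s ≠ P.label t := fun h => hst.lt.ne (P.label_inj h)
  have h2 : Q.label (e s) ≠ Q.label (e t) := fun h =>
    hst.lt.ne (e.injective (Q.label_inj h))
  have := h s t hst
  constructor <;> intro h3 <;> by_contra h4 <;> grind

/-- A valley: every edge of the oriented Hasse diagram at `v` points into `v`. -/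
def IsValley (P : LabeledPoset) (v : P.V) : Prop :=
  (∀ x, x ⋖ v → P.label x > P.label v) ∧ ∀ y, v ⋖ y → P.label v < P.label y

/-- Isomorphism of labeled posets. -/
instance setoid : Setoid LabeledPoset where
  r P Q := ∃ e : P.V ≃o Q.V, IsIso e
  iseqv := ⟨fun P => ⟨_, IsIso.refl P⟩, fun ⟨_, h⟩ => ⟨_, h.symm⟩,
    fun ⟨_, h⟩ ⟨_, h'⟩ => ⟨_, h.trans h'⟩⟩

end LabeledPoset

/-- A labeled poset `(P, γ)` with a set of marked valleys. -/
structure MarkedPoset extends LabeledPoset where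
  marked : Set V
  isValley : ∀ v ∈ marked, toLabeledPoset.IsValley v

namespace MarkedPoset

/-- Isomorphism of triples `(P, γ, V)`. -/
instance setoid : Setoid MarkedPoset where
  r P Q := ∃ e : P.V ≃o Q.V, LabeledPoset.IsIso (P := P.toLabeledPoset) (Q := Q.toLabeledPoset) e ∧
    e '' P.marked = Q.marked
  iseqv := by
    refine ⟨fun P => ⟨OrderIso.refl P.V, LabeledPoset.IsIso.refl _, by simp⟩, ?_, ?_⟩
    · rintro P Q ⟨e, h, h'⟩
      refine ⟨e.symm, h.symm, ?_⟩
      rw [← h', Set.image_image]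
      simp
    · rintro P Q R ⟨e, h, h'⟩ ⟨f, k, k'⟩
      refine ⟨e.trans f, h.trans k, ?_⟩
      rw [← k', ← h', Set.image_image]
      rfl

end MarkedPoset

/-- Isomorphism classes `[(P, γ)]` of labeled posets. -/
abbrev PosetClass : Type 1 := Quotient LabeledPoset.setoid

/-- Isomorphism classes `[(P, γ, V)]` with `V ⊆ Val(P, γ)`. -/
abbrev MarkedClass : Type 1 := Quotient MarkedPoset.setoid

/-- The linearly compact module `𝔪LPoset`. -/
abbrev MLPoset : Type 1 := LC PosetClass

/-- The linearly compact module `𝔪LPoset⁺`. -/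
abbrev MLPosetPlus : Type 1 := LC MarkedClass

namespace MarkedPoset

/-- The triple `(P, γ, ∅)`. -/
def ofLabeledPoset (P : LabeledPoset) : MarkedPoset where
  toLabeledPoset := P
  marked := ∅
  isValley _ hv := hv.elim

end MarkedPoset

/-- `[(P, γ)] ↦ [(P, γ, ∅)]` -/
def PosetClass.toMarked : PosetClass → MarkedClass :=
  Quotient.map MarkedPoset.ofLabeledPoset fun _ _ ⟨e, h⟩ => ⟨e, h, by
    simp [MarkedPoset.ofLabeledPoset]⟩

theorem PosetClass.toMarked_injective : Function.Injective PosetClass.toMarked := by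
  rintro ⟨P⟩ ⟨Q⟩ h
  obtain ⟨e, he, -⟩ := Quotient.exact h
  exact Quotient.sound ⟨e, he⟩

/-- Number of vertices of an isomorphism class. -/
noncomputable def MarkedClass.size : MarkedClass → ℕ :=
  Quotient.lift (fun P => P.toLabeledPoset.size) fun _ _ ⟨e, _⟩ => Nat.card_congr e.toEquiv

/-- Number of vertices of an isomorphism class. -/
noncomputable def PosetClass.size : PosetClass → ℕ :=
  Quotient.lift LabeledPoset.size fun _ _ ⟨e, _⟩ => Nat.card_congr e.toEquiv

theorem MarkedClass.finite_size_eq (n : ℕ) : {c : MarkedClass | c.size = n}.Finite := by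
  have key : ∀ c : {c : MarkedClass | c.size = n},
      ∃ (P : MarkedPoset) (_ : P.V ≃ Fin n), ⟦P⟧ = c.1 := by
    rintro ⟨⟨P⟩, hP⟩
    exact ⟨P, Finite.equivFinOfCardEq hP, rfl⟩
  choose P e hP using key
  let code : {c : MarkedClass | c.size = n} →
      Set (Fin n × Fin n) × Set (Fin n × Fin n) × Set (Fin n) := fun c =>
    ({p | (e c).symm p.1 ≤ (e c).symm p.2},
     {p | (P c).label ((e c).symm p.1) > (P c).label ((e c).symm p.2)},
     {p | (e c).symm p ∈ (P c).marked})
  have hinj : Function.Injective code := by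
    intro c d h
    obtain ⟨h1, h2, h3⟩ : _ ∧ _ ∧ _ := by
      simpa only [code, Prod.mk.injEq, Set.ext_iff, Set.mem_ofPred_eq, Prod.forall] using h
    apply Subtype.ext
    rw [← hP c, ← hP d]
    refine Quotient.sound ⟨⟨(e c).trans (e d).symm, ?_⟩, ?_, ?_⟩
    · intro a b
      have := h1 (e c a) (e c b)
      simpa using this.symm
    · intro s t _
      have := h2 (e c s) (e c t)
      simpa using this
    · ext x
      have := h3 (e d x)
      simp only [Equiv.symm_apply_apply] at this
      rw [← this]
      constructor
      · rintro ⟨y, hy, rfl⟩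
        simpa using hy
      · intro hx
        exact ⟨_, hx, by simp⟩
  have := Finite.of_injective code hinj
  exact Set.toFinite {c : MarkedClass | c.size = n}

theorem MarkedClass.finite_size_le (n : ℕ) : {c : MarkedClass | c.size ≤ n}.Finite := by
  refine ((Set.finite_Iic n).biUnion fun k _ => MarkedClass.finite_size_eq k).subset ?_
  intro c hc
  simpa using hc

theorem PosetClass.finite_size_le (n : ℕ) : {c : PosetClass | c.size ≤ n}.Finite := by
  refine ((MarkedClass.finite_size_le n).preimage
    PosetClass.toMarked_injective.injOn).subset ?_
  rintro ⟨P⟩ hP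
  exact hP

namespace LabeledPoset

/-- The empty labeled poset. -/
def empty : LabeledPoset where
  V := Empty
  label := Empty.elim
  label_inj := fun x => x.elim

/-- The labeled poset `(S, γ|_S)` on a subset `S`. -/
def restrict (P : LabeledPoset) (S : Finset P.V) : LabeledPoset where
  V := {s : P.V // s ∈ S}
  label s := P.label s
  label_inj := P.label_inj.comp Subtype.val_injective

/-- The labeling of the disjoint union. -/
noncomputable def unionLabel (P Q : LabeledPoset) : P.V ⊕ Q.V → ℤ
  | Sum.inl s => P.label s - Finset.univ.sup' ⟨s, Finset.mem_univ s⟩ P.label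
  | Sum.inr s => Q.label s - Finset.univ.inf' ⟨s, Finset.mem_univ s⟩ Q.label + 1

theorem unionLabel_lt (P Q : LabeledPoset) (s : P.V) (t : Q.V) :
    unionLabel P Q (Sum.inl s) < unionLabel P Q (Sum.inr t) := by
  have h1 := Finset.le_sup' P.label (Finset.mem_univ s)
  have h2 := Finset.inf'_le Q.label (Finset.mem_univ t)
  simp only [unionLabel]
  linarith

theorem unionLabel_injective (P Q : LabeledPoset) :
    Function.Injective (unionLabel P Q) := by
  rintro (s | s) (t | t) h
  · simp only [unionLabel, sub_left_inj] at h
    rw [P.label_inj h]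
  · exact ((unionLabel_lt P Q s t).ne h).elim
  · exact ((unionLabel_lt P Q t s).ne' h).elim
  · simp only [unionLabel, sub_left_inj, add_left_inj] at h
    rw [Q.label_inj h]

/-- The disjoint union of labeled posets; `P.V ⊕ Q.V` carries the disjoint union order. -/
noncomputable def union (P Q : LabeledPoset) : LabeledPoset where
  V := P.V ⊕ Q.V
  label := unionLabel P Q
  label_inj := unionLabel_injective P Q

theorem covBy_of_inl {α β : Type} [PartialOrder α] [PartialOrder β] {s t : α}
    (h : (Sum.inl s : α ⊕ β) ⋖ Sum.inl t) : s ⋖ t :=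
  ⟨Sum.inl_lt_inl_iff.1 h.1, fun _ h1 h2 =>
    h.2 (Sum.inl_lt_inl_iff.2 h1) (Sum.inl_lt_inl_iff.2 h2)⟩

theorem covBy_of_inr {α β : Type} [PartialOrder α] [PartialOrder β] {s t : β}
    (h : (Sum.inr s : α ⊕ β) ⋖ Sum.inr t) : s ⋖ t :=
  ⟨Sum.inr_lt_inr_iff.1 h.1, fun _ h1 h2 =>
    h.2 (Sum.inr_lt_inr_iff.2 h1) (Sum.inr_lt_inr_iff.2 h2)⟩

theorem union_congr {P P' Q Q' : LabeledPoset} (hP : P ≈ P') (hQ : Q ≈ Q') :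
    union P Q ≈ union P' Q' := by
  obtain ⟨e, he⟩ := hP
  obtain ⟨f, hf⟩ := hQ
  refine ⟨OrderIso.sumCongr e f, ?_⟩
  rintro (s | s) (t | t) hst
  · have := he s t (covBy_of_inl hst)
    change unionLabel P Q (Sum.inl s) > unionLabel P Q (Sum.inl t) ↔
      unionLabel P' Q' (Sum.inl (e s)) > unionLabel P' Q' (Sum.inl (e t))
    simpa only [unionLabel, gt_iff_lt, sub_lt_sub_iff_right] using this
  · exact (Sum.not_inl_lt_inr hst.1).elim
  · exact (Sum.not_inr_lt_inl hst.1).elim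
  · have := hf s t (covBy_of_inr hst)
    change unionLabel P Q (Sum.inr s) > unionLabel P Q (Sum.inr t) ↔
      unionLabel P' Q' (Sum.inr (f s)) > unionLabel P' Q' (Sum.inr (f t))
    simpa only [unionLabel, gt_iff_lt, sub_lt_sub_iff_right, add_lt_add_iff_right] using this

theorem size_union (P Q : LabeledPoset) : (union P Q).size = P.size + Q.size := by
  unfold size union
  exact Nat.card_sum

open Classical in
/-- The pairs `(S, T)` with `P = S ∪ T`, `S` a lower set, `T` an upper set and `S ∩ T` an
antichain. -/
noncomputable def cuts (P : LabeledPoset) : Finset (Finset P.V × Finset P.V) :=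
  Finset.univ.filter fun p => p.1 ∪ p.2 = Finset.univ ∧ IsLowerSet (p.1 : Set P.V) ∧
    IsUpperSet (p.2 : Set P.V) ∧ IsAntichain (· ≤ ·) ((p.1 ∩ p.2 : Finset P.V) : Set P.V)

/-- `∑ β^|S ∩ T| [(S, γ)] ⊗ [(T, γ)]` -/
noncomputable def coproduct (P : LabeledPoset) : LC (PosetClass × PosetClass) :=
  ∑ p ∈ P.cuts, beta ^ (p.1 ∩ p.2).card • LC.basis (⟦P.restrict p.1⟧, ⟦P.restrict p.2⟧)

theorem restrict_congr {P Q : LabeledPoset} {e : P.V ≃o Q.V} (he : IsIso e) (S : Finset P.V)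
    (hS : (S : Set P.V).OrdConnected) :
    P.restrict S ≈ Q.restrict (S.map e.toEquiv.toEmbedding) := by
  refine ⟨⟨⟨fun s => ⟨e s.1, Finset.mem_map_of_mem _ s.2⟩, fun s => ⟨e.symm s.1, ?_⟩,
    fun s => Subtype.ext (e.symm_apply_apply _),
    fun s => Subtype.ext (e.apply_symm_apply _)⟩, ?_⟩, ?_⟩
  · obtain ⟨s, hs⟩ := s
    obtain ⟨t, ht, rfl⟩ := Finset.mem_map.1 hs
    simpa using ht
  · intro a b
    exact e.le_iff_le
  · intro s t hst
    refine he s.1 t.1 ⟨hst.1, fun u h1 h2 => ?_⟩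
    exact hst.2 (c := ⟨u, hS.out s.2 t.2 ⟨h1.le, h2.le⟩⟩) h1 h2

theorem mem_cuts_map {P Q : LabeledPoset} (e : P.V ≃o Q.V) (p : Finset P.V × Finset P.V)
    (hp : p ∈ P.cuts) :
    (p.1.map e.toEquiv.toEmbedding, p.2.map e.toEquiv.toEmbedding) ∈ Q.cuts := by
  obtain ⟨h1, h2, h3, h4⟩ := by simpa [cuts] using hp
  have mem : ∀ (S : Finset P.V) (x : Q.V), x ∈ S.map e.toEquiv.toEmbedding ↔ e.symm x ∈ S := by
    intro S x
    rw [Finset.mem_map_equiv]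
    rfl
  simp only [cuts, Finset.mem_filter, Finset.mem_univ, true_and]
  refine ⟨?_, ?_, ?_, ?_⟩
  · ext x
    have : e.symm x ∈ p.1 ∪ p.2 := by rw [h1]; exact Finset.mem_univ _
    simpa only [Finset.mem_union, mem, Finset.mem_univ, iff_true] using this
  · intro a b hab ha
    simp only [Finset.mem_coe, mem] at ha ⊢
    exact h2 (e.symm.monotone hab) ha
  · intro a b hab ha
    simp only [Finset.mem_coe, mem] at ha ⊢
    exact h3 (e.symm.monotone hab) ha
  · intro a ha b hb hab hle
    simp only [Finset.coe_inter, Set.mem_inter_iff, Finset.mem_coe, mem] at ha hb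
    exact h4 (by simpa using ha) (by simpa using hb) (fun h => hab (e.symm.injective h))
      (e.symm.monotone hle)

theorem coproduct_congr {P Q : LabeledPoset} (h : P ≈ Q) : P.coproduct = Q.coproduct := by
  obtain ⟨e, he⟩ := h
  unfold coproduct
  refine Finset.sum_bij'
    (fun p _ => (p.1.map e.toEquiv.toEmbedding, p.2.map e.toEquiv.toEmbedding))
    (fun p _ => (p.1.map e.symm.toEquiv.toEmbedding, p.2.map e.symm.toEquiv.toEmbedding))
    (fun p hp => mem_cuts_map e p hp) (fun p hp => mem_cuts_map e.symm p hp) ?_ ?_ ?_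
  · rintro ⟨S, T⟩ -
    ext <;> simp
  · rintro ⟨S, T⟩ -
    ext <;> simp
  · rintro ⟨S, T⟩ hp
    obtain ⟨-, h2, h3, -⟩ := by simpa [cuts] using hp
    have hS : (⟦P.restrict S⟧ : PosetClass) = ⟦Q.restrict (S.map e.toEquiv.toEmbedding)⟧ :=
      Quotient.sound (restrict_congr he S h2.ordConnected)
    have hT : (⟦P.restrict T⟧ : PosetClass) = ⟦Q.restrict (T.map e.toEquiv.toEmbedding)⟧ :=
      Quotient.sound (restrict_congr he T h3.ordConnected)
    rw [← Finset.map_inter, Finset.card_map, ← hS, ← hT]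

theorem size_restrict (P : LabeledPoset) (S : Finset P.V) : (P.restrict S).size = S.card := by
  simp [size, restrict]

end LabeledPoset

/-- The class of the disjoint union. -/
noncomputable def PosetClass.union : PosetClass → PosetClass → PosetClass :=
  Quotient.map₂ LabeledPoset.union fun _ _ h _ _ h' => LabeledPoset.union_congr h h'

theorem PosetClass.size_union (c d : PosetClass) : (c.union d).size = c.size + d.size := by
  induction c using Quotient.inductionOn
  induction d using Quotient.inductionOn
  exact LabeledPoset.size_union _ _

/-- The coproduct of an isomorphism class. -/
noncomputable def PosetClass.coproduct : PosetClass → LC (PosetClass × PosetClass) :=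
  Quotient.lift LabeledPoset.coproduct fun _ _ h => LabeledPoset.coproduct_congr h

theorem PosetClass.size_le_of_coproduct {c : PosetClass} {d : PosetClass × PosetClass}
    (h : c.coproduct d ≠ 0) : c.size ≤ d.1.size + d.2.size := by
  induction c using Quotient.inductionOn with
  | h P =>
    change P.coproduct d ≠ 0 at h
    rw [LabeledPoset.coproduct, Finset.sum_apply] at h
    obtain ⟨p, hp, hne⟩ := Finset.exists_ne_zero_of_sum_ne_zero h
    rw [Pi.smul_apply] at hne
    have hd := LC.eq_of_basis_ne_zero (right_ne_zero_of_smul hne)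
    obtain ⟨h1, -⟩ := by simpa [LabeledPoset.cuts] using hp
    subst hd
    change P.size ≤ (P.restrict p.1).size + (P.restrict p.2).size
    rw [LabeledPoset.size_restrict, LabeledPoset.size_restrict, LabeledPoset.size,
      Nat.card_eq_fintype_card, ← Finset.card_univ, ← h1]
    exact Finset.card_union_le _ _

namespace MLPoset

/-- `∇ ([(P, γ)] ⊗ [(Q, δ)]) = [(P, γ) ⊔ (Q, δ)]` -/
noncomputable def mul : LC (PosetClass × PosetClass) →L[Scal] MLPoset :=
  LC.extend (fun p => LC.basis (p.1.union p.2)) fun c =>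
    ((PosetClass.finite_size_le c.size).prod (PosetClass.finite_size_le c.size)).subset
      fun p hp => by
        have h := LC.eq_of_basis_ne_zero hp
        rw [h, PosetClass.size_union]
        exact ⟨Nat.le_add_right _ _, Nat.le_add_left _ _⟩

/-- `Δ [(P, γ)] = ∑ β^|S ∩ T| [(S, γ)] ⊗ [(T, γ)]`, over the lower sets `S` and upper sets `T` with
`S ∪ T = P` and `S ∩ T` an antichain. -/
noncomputable def comul : MLPoset →L[Scal] LC (PosetClass × PosetClass) :=
  LC.extend PosetClass.coproduct fun d =>
    (PosetClass.finite_size_le (d.1.size + d.2.size)).subset fun _ hc =>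
      PosetClass.size_le_of_coproduct hc

/-- `ι 1 = [∅]` -/
noncomputable def unit : Scal →L[Scal] MLPoset :=
  ContinuousLinearMap.toSpanSingleton Scal (LC.basis (⟦LabeledPoset.empty⟧ : PosetClass))

/-- `ε` is `1` on the class of the empty labeled poset and `0` on all other classes. -/
noncomputable def counit : MLPoset →L[Scal] Scal :=
  ContinuousLinearMap.proj (⟦LabeledPoset.empty⟧ : PosetClass)

/-- The LC-Hopf structure of `𝔪LPoset`. -/
noncomputable def hopf : LCHopfMaps PosetClass := ⟨mul, comul, unit, counit⟩

/-- The inclusion `𝔪LPoset → 𝔪LPoset⁺`, `[(P, γ)] ↦ [(P, γ, ∅)]`. -/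
noncomputable def toPlus : MLPoset →L[Scal] MLPosetPlus :=
  LC.extend (fun c => LC.basis c.toMarked) fun d =>
    ((Set.finite_singleton d).preimage PosetClass.toMarked_injective.injOn).subset
      fun _ hc => (LC.eq_of_basis_ne_zero hc).symm

end MLPoset

/-! The mirroring operators -/

namespace LabeledPoset

/-- All labels are positive. -/
def Positive (P : LabeledPoset) : Prop := ∀ s, 0 < P.label s

/-- A vertex of `I ∪ (-J)`: a vertex `abs` of `P` with a sign, which is `+` only if `abs ∈ I` and
`-` only if `abs ∈ J`. -/
@[ext]
structure MirrorVertex (P : LabeledPoset) (I J : Finset P.V) where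
  abs : P.V
  sign : ℤˣ
  mem_of_pos : sign = 1 → abs ∈ I
  mem_of_neg : sign = -1 → abs ∈ J

namespace MirrorVertex

variable {P : LabeledPoset} {I J : Finset P.V}

instance instFinite : Finite (MirrorVertex P I J) :=
  Finite.of_injective (fun v => (v.abs, v.sign)) fun _ _ h =>
    MirrorVertex.ext (Prod.ext_iff.1 h).1 (Prod.ext_iff.1 h).2

/-- `s ≺ t` if and only if `|s| ≺ |t|`. -/
instance instPartialOrder : PartialOrder (MirrorVertex P I J) where
  le s t := s = t ∨ s.abs < t.abs
  lt s t := s.abs < t.abs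
  le_refl _ := Or.inl rfl
  le_trans s t u := by
    rintro (rfl | h) (rfl | h')
    · exact Or.inl rfl
    · exact Or.inr h'
    · exact Or.inr h
    · exact Or.inr (h.trans h')
  lt_iff_le_not_ge s t := by
    constructor
    · intro h
      refine ⟨Or.inr h, ?_⟩
      rintro (rfl | h')
      · exact lt_irrefl _ h
      · exact lt_asymm h h'
    · rintro ⟨rfl | h, h'⟩
      · exact (h' (Or.inl rfl)).elim
      · exact h
  le_antisymm s t := by
    rintro (rfl | h) (h' | h')
    · rfl
    · rfl
    · exact h'.symm
    · exact (lt_asymm h h').elim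

theorem lt_def {s t : MirrorVertex P I J} : s < t ↔ s.abs < t.abs := Iff.rfl

theorem le_def {s t : MirrorVertex P I J} : s ≤ t ↔ s = t ∨ s.abs < t.abs := Iff.rfl

end MirrorVertex

/-- The labeled poset `𝔐_{IJ}(P, γ)`: its vertex set is `I ∪ (-J)`, ordered by `s ≺ t` iff
`|s| ≺ |t|`, and the label of `s` is `sign(s) γ(|s|)`. -/
def mirror (P : LabeledPoset) (hP : P.Positive) (I J : Finset P.V) : LabeledPoset where
  V := MirrorVertex P I J
  label s := (s.sign : ℤ) * P.label s.abs
  label_inj := by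
    intro s t h
    have hs := hP s.abs
    have ht := hP t.abs
    dsimp only at h
    rcases Int.units_eq_one_or s.sign with h1 | h1 <;>
      rcases Int.units_eq_one_or t.sign with h2 | h2 <;>
      simp only [h1, h2, Units.val_one, Units.val_neg, one_mul, neg_mul] at h
    · exact MirrorVertex.ext (P.label_inj h) (h1.trans h2.symm)
    · omega
    · omega
    · exact MirrorVertex.ext (P.label_inj (neg_injective h)) (h1.trans h2.symm)

open Classical in
/-- The ordered pairs `(I, J)` with `I ∪ J = P`. -/
noncomputable def covers (P : LabeledPoset) : Finset (Finset P.V × Finset P.V) :=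
  Finset.univ.filter fun p => p.1 ∪ p.2 = Finset.univ

/-- `∑ β^|I ∩ J| [𝔐_{IJ}(P, γ)]`, over the pairs with `I ∪ J = P`. -/
noncomputable def mirrorSum (P : LabeledPoset) (hP : P.Positive) : MLPoset :=
  ∑ p ∈ P.covers, beta ^ (p.1 ∩ p.2).card •
    LC.basis (⟦P.mirror hP p.1 p.2⟧ : PosetClass)

theorem mirror_covBy {P : LabeledPoset} {I J : Finset P.V} (h : I ∪ J = Finset.univ)
    {s t : MirrorVertex P I J} (hst : s ⋖ t) : s.abs ⋖ t.abs := by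
  refine ⟨hst.1, fun u h1 h2 => ?_⟩
  have hu : u ∈ I ∪ J := by rw [h]; exact Finset.mem_univ _
  rcases Finset.mem_union.1 hu with hu | hu
  · exact hst.2 (c := ⟨u, 1, fun _ => hu, fun h => absurd h (by decide)⟩) h1 h2
  · exact hst.2 (c := ⟨u, -1, fun h => absurd h (by decide), fun _ => hu⟩) h1 h2

theorem mirror_congr {P Q : LabeledPoset} (hP : P.Positive) (hQ : Q.Positive)
    {e : P.V ≃o Q.V} (he : IsIso e) {I J : Finset P.V} (h : I ∪ J = Finset.univ) :
    P.mirror hP I J ≈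
      Q.mirror hQ (I.map e.toEquiv.toEmbedding) (J.map e.toEquiv.toEmbedding) := by
  have mem : ∀ (S : Finset P.V) (x : Q.V), x ∈ S.map e.toEquiv.toEmbedding ↔ e.symm x ∈ S := by
    intro S x
    rw [Finset.mem_map_equiv]
    rfl
  refine ⟨⟨⟨fun s => ⟨e s.abs, s.sign, fun h => Finset.mem_map_of_mem _ (s.mem_of_pos h),
      fun h => Finset.mem_map_of_mem _ (s.mem_of_neg h)⟩,
    fun s => ⟨e.symm s.abs, s.sign, fun h => (mem _ _).1 (s.mem_of_pos h),
      fun h => (mem _ _).1 (s.mem_of_neg h)⟩,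
    fun s => MirrorVertex.ext (e.symm_apply_apply _) rfl,
    fun s => MirrorVertex.ext (e.apply_symm_apply _) rfl⟩, ?_⟩, ?_⟩
  · intro a b
    change (_ ∨ e a.abs < e b.abs) ↔ (a = b ∨ a.abs < b.abs)
    rw [e.lt_iff_lt]
    refine or_congr ?_ Iff.rfl
    constructor
    · intro h
      obtain ⟨h1, h2⟩ := MirrorVertex.ext_iff.1 h
      exact MirrorVertex.ext (e.injective h1) h2
    · rintro rfl
      rfl
  · intro s t hst
    have hc := mirror_covBy h hst
    have h1 := he _ _ hc
    have h2 := he.lt_iff hc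
    have p1 := hP s.abs
    have p2 := hP t.abs
    have q1 := hQ (e s.abs)
    have q2 := hQ (e t.abs)
    change (s.sign : ℤ) * P.label s.abs > (t.sign : ℤ) * P.label t.abs ↔
      (s.sign : ℤ) * Q.label (e s.abs) > (t.sign : ℤ) * Q.label (e t.abs)
    rcases Int.units_eq_one_or s.sign with h3 | h3 <;>
      rcases Int.units_eq_one_or t.sign with h4 | h4 <;>
      simp only [h3, h4, Units.val_one, Units.val_neg, one_mul, neg_mul] <;> omega

theorem mem_covers_map {P Q : LabeledPoset} (e : P.V ≃o Q.V) (p : Finset P.V × Finset P.V)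
    (hp : p ∈ P.covers) :
    (p.1.map e.toEquiv.toEmbedding, p.2.map e.toEquiv.toEmbedding) ∈ Q.covers := by
  have h1 : p.1 ∪ p.2 = Finset.univ := by simpa [covers] using hp
  have mem : ∀ (S : Finset P.V) (x : Q.V), x ∈ S.map e.toEquiv.toEmbedding ↔ e.symm x ∈ S := by
    intro S x
    rw [Finset.mem_map_equiv]
    rfl
  simp only [covers, Finset.mem_filter, Finset.mem_univ, true_and]
  ext x
  have : e.symm x ∈ p.1 ∪ p.2 := by rw [h1]; exact Finset.mem_univ _
  simpa only [Finset.mem_union, mem, Finset.mem_univ, iff_true] using this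

theorem mirrorSum_congr {P Q : LabeledPoset} (hP : P.Positive) (hQ : Q.Positive) (h : P ≈ Q) :
    P.mirrorSum hP = Q.mirrorSum hQ := by
  obtain ⟨e, he⟩ := h
  unfold mirrorSum
  refine Finset.sum_bij'
    (fun p _ => (p.1.map e.toEquiv.toEmbedding, p.2.map e.toEquiv.toEmbedding))
    (fun p _ => (p.1.map e.symm.toEquiv.toEmbedding, p.2.map e.symm.toEquiv.toEmbedding))
    (fun p hp => mem_covers_map e p hp) (fun p hp => mem_covers_map e.symm p hp) ?_ ?_ ?_
  · rintro ⟨S, T⟩ -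
    ext <;> simp
  · rintro ⟨S, T⟩ -
    ext <;> simp
  · rintro ⟨S, T⟩ hp
    have h1 : S ∪ T = Finset.univ := by simpa [covers] using hp
    have hS : (⟦P.mirror hP S T⟧ : PosetClass) = ⟦Q.mirror hQ (S.map e.toEquiv.toEmbedding)
        (T.map e.toEquiv.toEmbedding)⟧ :=
      Quotient.sound (mirror_congr hP hQ he h1)
    rw [← Finset.map_inter, Finset.card_map, ← hS]

/-- An isomorphic labeled poset with positive labels, obtained by shifting the labels. -/
noncomputable def shift (P : LabeledPoset) : LabeledPoset where
  V := P.V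
  label s := P.label s - Finset.univ.inf' ⟨s, Finset.mem_univ s⟩ P.label + 1
  label_inj s t h := by
    simp only [add_left_inj, sub_left_inj] at h
    exact P.label_inj h

theorem shift_positive (P : LabeledPoset) : P.shift.Positive := by
  intro (s : P.V)
  have h := Finset.inf'_le P.label (Finset.mem_univ s)
  change 0 < P.label s - Finset.univ.inf' ⟨s, Finset.mem_univ s⟩ P.label + 1
  linarith

theorem shift_equiv (P : LabeledPoset) : P.shift ≈ P := by
  refine ⟨OrderIso.refl P.V, fun (s t : P.V) _ => ?_⟩
  change P.label s - Finset.univ.inf' ⟨s, Finset.mem_univ s⟩ P.label + 1 >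
    P.label t - Finset.univ.inf' ⟨t, Finset.mem_univ t⟩ P.label + 1 ↔ P.label s > P.label t
  simp

theorem size_le_mirror (P : LabeledPoset) (hP : P.Positive) {I J : Finset P.V}
    (h : I ∪ J = Finset.univ) : P.size ≤ (P.mirror hP I J).size := by
  refine Nat.card_le_card_of_surjective (MirrorVertex.abs : MirrorVertex P I J → P.V) fun u => ?_
  have hu : u ∈ I ∪ J := by rw [h]; exact Finset.mem_univ _
  rcases Finset.mem_union.1 hu with hu | hu
  · exact ⟨⟨u, 1, fun _ => hu, fun h => absurd h (by decide)⟩, rfl⟩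
  · exact ⟨⟨u, -1, fun h => absurd h (by decide), fun _ => hu⟩, rfl⟩

theorem size_le_of_mirrorSum (P : LabeledPoset) (hP : P.Positive) {d : PosetClass}
    (h : P.mirrorSum hP d ≠ 0) : P.size ≤ d.size := by
  rw [mirrorSum, Finset.sum_apply] at h
  obtain ⟨p, hp, hne⟩ := Finset.exists_ne_zero_of_sum_ne_zero h
  rw [Pi.smul_apply] at hne
  have hd := LC.eq_of_basis_ne_zero (right_ne_zero_of_smul hne)
  subst hd
  exact P.size_le_mirror hP (by simpa [covers] using hp)

end LabeledPoset

/-- The value of `Ψ^(β)` at an isomorphism class, computed from a positive representative. -/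
noncomputable def PosetClass.mirrorSum : PosetClass → MLPoset :=
  Quotient.lift (fun P => P.shift.mirrorSum P.shift_positive) fun P Q h =>
    LabeledPoset.mirrorSum_congr _ _
      (Setoid.trans P.shift_equiv (Setoid.trans h (Setoid.symm Q.shift_equiv)))

/-- The mirroring map `Ψ^(β)`: the continuous linear map with
`[(P, γ)] ↦ ∑ β^|I ∩ J| [𝔐_{IJ}(P, γ)]` for all positive `(P, γ)`. -/
noncomputable def Psi : MLPoset →L[Scal] MLPoset :=
  LC.extend PosetClass.mirrorSum fun d =>
    (PosetClass.finite_size_le d.size).subset fun c hc => by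
      induction c using Quotient.inductionOn with
      | h P =>
        refine le_trans (le_of_eq ?_) (P.shift.size_le_of_mirrorSum P.shift_positive hc)
        rfl

/-- The value of `Ψ^(β)` does not depend on the positive representative. -/
theorem Psi_basis (P : LabeledPoset) (hP : P.Positive) :
    Psi (LC.basis ⟦P⟧) = P.mirrorSum hP := by
  rw [Psi, LC.extend_basis]
  exact LabeledPoset.mirrorSum_congr _ _ P.shift_equiv

/-! Quasisymmetric functions -/

/-- A power series in `x₁, x₂, …` is quasisymmetric if the coefficients of
`x_{i₁}^{a₁} ⋯ x_{i_k}^{a_k}` and `x_{j₁}^{a₁} ⋯ x_{j_k}^{a_k}` agree for all positive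
exponents and all `i₁ < ⋯ < i_k` and `j₁ < ⋯ < j_k`. -/
def IsQuasisymmetric (f : MvPowerSeries ℕ+ Scal) : Prop :=
  ∀ (k : ℕ) (a i j : Fin k → ℕ+), StrictMono i → StrictMono j →
    MvPowerSeries.coeff (∑ r, Finsupp.single (i r) (a r : ℕ)) f =
      MvPowerSeries.coeff (∑ r, Finsupp.single (j r) (a r : ℕ)) f

/-- `𝔪QSym`, with the subspace topology from the power series ring. -/
noncomputable def MQSym : Submodule Scal (MvPowerSeries ℕ+ Scal) where
  carrier := {f | IsQuasisymmetric f}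
  add_mem' {f g} hf hg k a i j hi hj := by
    rw [map_add, map_add, hf k a i j hi hj, hg k a i j hi hj]
  zero_mem' k a i j _ _ := by rw [map_zero, map_zero]
  smul_mem' c f hf k a i j hi hj := by
    rw [map_smul, map_smul, hf k a i j hi hj]

/-- The continuous linear map `LC S → 𝔪QSym` with `basis s ↦ f s`.  It exists when every monomial
occurs in only finitely many of the `f s`. -/
noncomputable def MQSym.extend {S : Type*} (f : S → MQSym)
    (hf : ∀ m, {s | MvPowerSeries.coeff m (f s : MvPowerSeries ℕ+ Scal) ≠ 0}.Finite) :
    LC S →L[Scal] MQSym :=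
  ContinuousLinearMap.codRestrict
    (LC.extend (fun s => (f s : MvPowerSeries ℕ+ Scal)) hf : LC S →L[Scal] MvPowerSeries ℕ+ Scal)
    MQSym fun x k a i j hi hj => finsum_congr fun s => congrArg (x s * ·) ((f s).2 k a i j hi hj)

theorem MQSym.extend_basis {S : Type*} (f : S → MQSym)
    (hf : ∀ m, {s | MvPowerSeries.coeff m (f s : MvPowerSeries ℕ+ Scal) ≠ 0}.Finite) (s : S) :
    MQSym.extend f hf (LC.basis s) = f s :=
  Subtype.ext (LC.extend_basis _ hf s)

/-! Generating functions of set-valued maps -/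

section Letters

variable {L A B : Type} [Fintype A] [Fintype B]

/-- The exponent vector of `x^S = ∏_{l ∈ S} x_{|l|}`. -/
noncomputable def setWeight (abs : L → ℕ+) (S : Finset L) : ℕ+ →₀ ℕ :=
  ∑ l ∈ S, Finsupp.single (abs l) 1

/-- The exponent vector of `x^σ = ∏_s x^{σ(s)}`. -/
noncomputable def mapWeight (abs : L → ℕ+) (σ : A → Finset L) : ℕ+ →₀ ℕ :=
  ∑ s, setWeight abs (σ s)

/-- `|σ| = ∑_s |σ(s)|` -/
def mapLength (σ : A → Finset L) : ℕ := ∑ s, (σ s).card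

/-- The power series `∑_{σ ∈ 𝒜} β^(|σ| - |A|) x^σ`, for a set `𝒜` of maps `σ` from `A` to
nonempty finite sets of letters; there are only finitely many `σ` with a given `x^σ` if only
finitely many letters have a given absolute value. -/
noncomputable def genFun (abs : L → ℕ+) (𝒜 : Set (A → Finset L)) : MvPowerSeries ℕ+ Scal :=
  fun m => ∑ᶠ σ ∈ {σ | σ ∈ 𝒜 ∧ mapWeight abs σ = m}, beta ^ (mapLength σ - Fintype.card A)

theorem genFun_congr (abs : L → ℕ+) (e : A ≃ B) (𝒜 : Set (A → Finset L))
    (ℬ : Set (B → Finset L)) (h : ∀ σ : B → Finset L, σ ∈ ℬ ↔ σ ∘ e ∈ 𝒜) :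
    genFun abs 𝒜 = genFun abs ℬ := by
  funext m
  have hw : ∀ σ : B → Finset L, mapWeight abs (σ ∘ e) = mapWeight abs σ := fun σ =>
    e.sum_comp fun b => setWeight abs (σ b)
  have hl : ∀ σ : B → Finset L, mapLength (σ ∘ e) = mapLength σ := fun σ =>
    e.sum_comp fun b => (σ b).card
  refine (finsum_mem_eq_of_bijOn (fun σ : B → Finset L => σ ∘ e) ⟨?_, ?_, ?_⟩ ?_).symm
  · rintro σ ⟨h1, h2⟩
    exact ⟨(h σ).1 h1, (hw σ).trans h2⟩
  · intro σ _ τ _ hst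
    exact e.surjective.injective_comp_right hst
  · rintro σ ⟨h1, h2⟩
    have hσ : (σ ∘ e.symm) ∘ e = σ := by
      funext a
      simp
    refine ⟨σ ∘ e.symm, ⟨(h _).2 (hσ.symm ▸ h1), ?_⟩, hσ⟩
    rw [← hw, hσ, h2]
  · intro σ _
    rw [hl, Fintype.card_congr e]

theorem exists_strictMono_extension {k : ℕ} (i : Fin k → ℕ+) (hi : StrictMono i) :
    ∃ φ : ℕ+ → ℕ+, StrictMono φ ∧ ∀ r : Fin k, φ (Nat.succPNat r) = i r := by
  obtain ⟨M, hM⟩ := (Set.finite_range i).bddAbove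
  refine ⟨fun n => if h : n.natPred < k then i ⟨n.natPred, h⟩ else M + n, ?_, ?_⟩
  · intro a b hab
    have hp : a.natPred < b.natPred := PNat.natPred_lt_natPred.2 hab
    dsimp only
    split_ifs with h1 h2 h2
    · exact hi hp
    · exact (hM ⟨_, rfl⟩).trans_lt (PNat.lt_add_right M b)
    · omega
    · exact add_lt_add_right hab M
  · intro r
    simp

theorem mapWeight_image [DecidableEq L] (abs : L → ℕ+) (φ : ℕ+ → ℕ+) (Φ : L → L)
    (hΦ : Function.Injective Φ) (h : ∀ l, abs (Φ l) = φ (abs l)) (σ : A → Finset L) :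
    mapWeight abs (fun s => (σ s).image Φ) = (mapWeight abs σ).mapDomain φ := by
  simp only [mapWeight, setWeight, Finsupp.mapDomain_finsetSum, Finsupp.mapDomain_single]
  refine Finset.sum_congr rfl fun s _ => ?_
  rw [Finset.sum_image fun a _ b _ hab => hΦ hab]
  exact Finset.sum_congr rfl fun l _ => by rw [h]

theorem abs_mem_support (abs : L → ℕ+) (σ : A → Finset L) (s : A) {l : L} (hl : l ∈ σ s) :
    abs l ∈ (mapWeight abs σ).support := by
  rw [Finsupp.mem_support_iff, mapWeight, Finsupp.finsetSum_apply]
  intro h0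
  have h1 := (Finset.sum_eq_zero_iff.1 h0) s (Finset.mem_univ s)
  rw [setWeight, Finsupp.finsetSum_apply] at h1
  have h2 := (Finset.sum_eq_zero_iff.1 h1) l hl
  simp at h2

/-- Generating functions of families that are stable under increasing relabelings of the
alphabet are quasisymmetric. -/
theorem genFun_isQuasisymmetric [DecidableEq L] (abs : L → ℕ+) (relabel : (ℕ+ → ℕ+) → L → L)
    (𝒜 : Set (A → Finset L)) (hinj : ∀ φ, StrictMono φ → Function.Injective (relabel φ))
    (habs : ∀ φ l, abs (relabel φ l) = φ (abs l))
    (hrange : ∀ φ l n, abs l = φ n → ∃ l', relabel φ l' = l)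
    (h𝒜 : ∀ φ, StrictMono φ → ∀ σ, σ ∈ 𝒜 ↔ (fun s => (σ s).image (relabel φ)) ∈ 𝒜) :
    IsQuasisymmetric (genFun abs 𝒜) := by
  have key : ∀ φ, StrictMono φ → ∀ m, genFun abs 𝒜 m = genFun abs 𝒜 (m.mapDomain φ) := by
    intro φ hφ m
    refine finsum_mem_eq_of_bijOn (fun σ s => (σ s).image (relabel φ)) ⟨?_, ?_, ?_⟩ ?_
    · rintro σ ⟨h1, h2⟩
      refine ⟨(h𝒜 φ hφ σ).1 h1, ?_⟩
      rw [mapWeight_image abs φ _ (hinj φ hφ) (habs φ), h2]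
    · intro σ _ τ _ hst
      funext s
      exact Finset.image_injective (hinj φ hφ) (congrFun hst s)
    · rintro σ ⟨h1, h2⟩
      have hl : ∀ s, ∃ S : Finset L, S.image (relabel φ) = σ s := by
        classical
        intro s
        refine ⟨(σ s).preimage (relabel φ) (hinj φ hφ).injOn, ?_⟩
        rw [Finset.image_preimage, Finset.filter_true_of_mem]
        intro l hl
        have := abs_mem_support abs σ s hl
        rw [h2] at this
        obtain ⟨n, -, hn⟩ := Finset.mem_image.1 (Finsupp.mapDomain_support this)
        exact hrange φ l n hn.symm
      choose τ hτ using hl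
      have hτ' : (fun s => (τ s).image (relabel φ)) = σ := funext hτ
      refine ⟨τ, ⟨(h𝒜 φ hφ τ).2 (hτ'.symm ▸ h1), ?_⟩, hτ'⟩
      apply Finsupp.mapDomain_injective hφ.injective
      rw [← mapWeight_image abs φ _ (hinj φ hφ) (habs φ), hτ', h2]
    · intro σ _
      have : mapLength (fun s => (σ s).image (relabel φ)) = mapLength σ :=
        Finset.sum_congr rfl fun s _ => Finset.card_image_of_injective _ (hinj φ hφ)
      rw [this]
  have std : ∀ (k : ℕ) (a i : Fin k → ℕ+), StrictMono i →
      genFun abs 𝒜 (∑ r, Finsupp.single (i r) (a r : ℕ)) =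
        genFun abs 𝒜 (∑ r : Fin k, Finsupp.single (Nat.succPNat r) (a r : ℕ)) := by
    intro k a i hi
    obtain ⟨φ, hφ, h⟩ := exists_strictMono_extension i hi
    rw [key φ hφ (∑ r : Fin k, Finsupp.single (Nat.succPNat r) (a r : ℕ)),
      Finsupp.mapDomain_finsetSum]
    simp only [Finsupp.mapDomain_single, h]
  intro k a i j hi hj
  exact (std k a i hi).trans (std k a j hj).symm

theorem card_le_degree (abs : L → ℕ+) (𝒜 : Set (A → Finset L))
    (hne : ∀ σ ∈ 𝒜, ∀ s, (σ s).Nonempty) {m : ℕ+ →₀ ℕ} (h : genFun abs 𝒜 m ≠ 0) :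
    Fintype.card A ≤ m.degree := by
  obtain ⟨σ, ⟨h1, rfl⟩, -⟩ := exists_ne_zero_of_finsum_mem_ne_zero h
  have h2 : (mapWeight abs σ).degree = mapLength σ := by
    simp [mapWeight, mapLength, setWeight, map_sum]
  rw [h2, mapLength, Fintype.card_eq_sum_ones]
  exact Finset.sum_le_sum fun s _ => (hne σ h1 s).card_pos

end Letters

/-- `S ≼ T`, i.e. `max S ≤ min T`. -/
def SetLE {L : Type} [LE L] (S T : Finset L) : Prop := ∀ a ∈ S, ∀ b ∈ T, a ≤ b

/-- `S ≺ T`, i.e. `max S < min T`. -/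
def SetLT {L : Type} [LT L] (S T : Finset L) : Prop := ∀ a ∈ S, ∀ b ∈ T, a < b

/-- The marked alphabet `1' < 1 < 2' < 2 < ⋯`: the letter `i'` is `(i, false)` and `i` is
`(i, true)`, in lexicographic order. -/
abbrev Marked : Type := ℕ+ ×ₗ Bool

namespace Marked

/-- `|i'| = |i| = i` -/
def abs (l : Marked) : ℕ+ := (ofLex l).1

/-- The letter is one of `1', 2', 3', …`. -/
def IsPrimed (l : Marked) : Prop := (ofLex l).2 = false

/-- Apply `φ` to the absolute value. -/
def relabel (φ : ℕ+ → ℕ+) (l : Marked) : Marked := toLex (φ (ofLex l).1, (ofLex l).2)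

theorem relabel_strictMono {φ : ℕ+ → ℕ+} (hφ : StrictMono φ) : StrictMono (relabel φ) := by
  intro a b hab
  rw [Prod.Lex.lt_iff] at hab ⊢
  rcases hab with h | ⟨h1, h2⟩
  · exact Or.inl (hφ h)
  · exact Or.inr ⟨congrArg φ h1, h2⟩

end Marked

theorem setLE_image {L : Type} [LinearOrder L] {f : L → L} (hf : StrictMono f) (S T : Finset L) :
    SetLE (S.image f) (T.image f) ↔ SetLE S T := by
  simp [SetLE, hf.le_iff_le]

theorem setLT_image {L : Type} [LinearOrder L] {f : L → L} (hf : StrictMono f) (S T : Finset L) :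
    SetLT (S.image f) (T.image f) ↔ SetLT S T := by
  simp [SetLT, hf.lt_iff_lt]

theorem forall_inter_image {L : Type} [DecidableEq L] {f : L → L} (hf : Function.Injective f)
    {p : L → Prop} (hp : ∀ l, p (f l) ↔ p l) (S T : Finset L) :
    (∀ l ∈ S.image f ∩ T.image f, p l) ↔ ∀ l ∈ S ∩ T, p l := by
  rw [← Finset.image_inter _ _ hf, Finset.forall_mem_image]
  simp only [hp]

theorem forall_image {L : Type} [DecidableEq L] {f : L → L}
    {p : L → Prop} (hp : ∀ l, p (f l) ↔ p l) (S : Finset L) :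
    (∀ l ∈ S.image f, p l) ↔ ∀ l ∈ S, p l := by
  rw [Finset.forall_mem_image]
  simp only [hp]

/-- A family of maps to finite sets of positive integers that is stable under increasing
relabelings has a quasisymmetric generating function. -/
theorem genFun_id_mem {A : Type} [Fintype A] (𝒜 : Set (A → Finset ℕ+))
    (h : ∀ φ : ℕ+ → ℕ+, StrictMono φ → ∀ σ, σ ∈ 𝒜 ↔ (fun s => (σ s).image φ) ∈ 𝒜) :
    genFun id 𝒜 ∈ MQSym :=
  genFun_isQuasisymmetric id (fun φ => φ) 𝒜 (fun _ hφ => hφ.injective) (fun _ _ => rfl)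
    (fun _ _ n hn => ⟨n, hn.symm⟩) h

/-- The same for families of maps to finite sets of letters of the marked alphabet. -/
theorem genFun_marked_mem {A : Type} [Fintype A] (𝒜 : Set (A → Finset Marked))
    (h : ∀ φ : ℕ+ → ℕ+, StrictMono φ → ∀ σ,
      σ ∈ 𝒜 ↔ (fun s => (σ s).image (Marked.relabel φ)) ∈ 𝒜) :
    genFun Marked.abs 𝒜 ∈ MQSym :=
  genFun_isQuasisymmetric Marked.abs Marked.relabel 𝒜
    (fun _ hφ => (Marked.relabel_strictMono hφ).injective) (fun _ _ => rfl)
    (fun _ l n hn => ⟨toLex (n, (ofLex l).2), by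
      change toLex (_, _) = l
      rw [show l = toLex ((ofLex l).1, (ofLex l).2) from rfl]
      exact congrArg toLex (Prod.ext hn.symm rfl)⟩) h

/-- The set `𝒜(P, γ)` of set-valued `(P, γ)`-partitions. -/
def LabeledPoset.setValued (P : LabeledPoset) : Set (P.V → Finset ℕ+) :=
  {σ | (∀ s, (σ s).Nonempty) ∧ ∀ s t, s ⋖ t →
    SetLE (σ s) (σ t) ∧ (P.label s > P.label t → SetLT (σ s) (σ t))}

/-- The set `ℰ(P, γ, V)` of enriched set-valued `(P, γ)`-partitions with unprimed values on `V`. -/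
def MarkedPoset.enriched (P : MarkedPoset) : Set (P.V → Finset Marked) :=
  {σ | (∀ s, (σ s).Nonempty) ∧
    (∀ s t, s ⋖ t → SetLE (σ s) (σ t) ∧
      (P.label s < P.label t → ∀ l ∈ σ s ∩ σ t, ¬ Marked.IsPrimed l) ∧
      (P.label s > P.label t → ∀ l ∈ σ s ∩ σ t, Marked.IsPrimed l)) ∧
    ∀ v ∈ P.marked, ∀ l ∈ σ v, ¬ Marked.IsPrimed l}

/-- The set-valued weight enumerator `Γ^(β)(P, γ) = ∑_{σ ∈ 𝒜(P, γ)} β^(|σ| - |P|) x^σ`. -/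
noncomputable def Gam (P : LabeledPoset) : MQSym :=
  ⟨genFun id P.setValued, genFun_id_mem _ fun φ hφ σ => by
    simp only [LabeledPoset.setValued, Set.mem_ofPred_eq, Finset.image_nonempty,
      setLE_image hφ, setLT_image hφ]⟩

/-- The enriched set-valued weight enumerator
`Ω^(β)(P, γ, V) = ∑_{σ ∈ ℰ(P, γ, V)} β^(|σ| - |P|) x^σ`. -/
noncomputable def OmegaMarked (P : MarkedPoset) : MQSym :=
  ⟨genFun Marked.abs P.enriched, genFun_marked_mem _ fun φ hφ σ => by
    have h1 := Marked.relabel_strictMono hφ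
    simp only [MarkedPoset.enriched, Set.mem_ofPred_eq, Finset.image_nonempty, setLE_image h1,
      forall_inter_image h1.injective (p := fun l => ¬ Marked.IsPrimed l) (fun _ => Iff.rfl),
      forall_inter_image h1.injective (p := Marked.IsPrimed) (fun _ => Iff.rfl),
      forall_image (f := Marked.relabel φ) (p := fun l => ¬ Marked.IsPrimed l) (fun _ => Iff.rfl)]⟩

/-- `Ω^(β)(P, γ) = Ω^(β)(P, γ, ∅)` -/
noncomputable def Omega (P : LabeledPoset) : MQSym := OmegaMarked (MarkedPoset.ofLabeledPoset P)

theorem Gam_congr {P Q : LabeledPoset} (h : P ≈ Q) : Gam P = Gam Q := by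
  obtain ⟨e, he⟩ := h
  refine Subtype.ext (genFun_congr id e.toEquiv _ _ fun σ => ?_)
  constructor
  · rintro ⟨h1, h2⟩
    refine ⟨fun s => h1 _, fun s t hst => ?_⟩
    obtain ⟨h3, h4⟩ := h2 (e s) (e t) ((apply_covBy_apply_iff e).2 hst)
    exact ⟨h3, fun h => h4 ((he s t hst).1 h)⟩
  · rintro ⟨h1, h2⟩
    refine ⟨fun s => by simpa using h1 (e.symm s), fun s t hst => ?_⟩
    have hc := (apply_covBy_apply_iff e.symm).2 hst
    obtain ⟨h3, h4⟩ := h2 _ _ hc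
    have h5 := he _ _ hc
    simp only [Function.comp_apply, OrderIso.coe_toEquiv,
      OrderIso.apply_symm_apply, gt_iff_lt] at h3 h4 h5
    exact ⟨h3, fun h => h4 (h5.2 h)⟩

theorem OmegaMarked_congr {P Q : MarkedPoset} (h : P ≈ Q) : OmegaMarked P = OmegaMarked Q := by
  obtain ⟨e, he, hm⟩ := h
  refine Subtype.ext (genFun_congr Marked.abs e.toEquiv _ _ fun σ => ?_)
  constructor
  · rintro ⟨h1, h2, h6⟩
    refine ⟨fun s => h1 _, fun s t hst => ?_, fun v hv => h6 (e v) (hm ▸ ⟨v, hv, rfl⟩)⟩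
    obtain ⟨h3, h4, h5⟩ := h2 (e s) (e t) ((apply_covBy_apply_iff e).2 hst)
    exact ⟨h3, fun h => h4 ((he.lt_iff hst).1 h), fun h => h5 ((he s t hst).1 h)⟩
  · rintro ⟨h1, h2, h6⟩
    refine ⟨fun s => by simpa using h1 (e.symm s), fun s t hst => ?_, fun v hv => ?_⟩
    · have hc := (apply_covBy_apply_iff e.symm).2 hst
      obtain ⟨h3, h4, h5⟩ := h2 _ _ hc
      have h7 := he.lt_iff hc
      have h8 := he _ _ hc
      simp only [Function.comp_apply, OrderIso.apply_symm_apply, gt_iff_lt,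
        RelIso.coe_fn_toEquiv] at h3 h4 h5 h7 h8
      exact ⟨h3, fun h => h4 (h7.2 h), fun h => h5 (h8.2 h)⟩
    · rw [← hm] at hv
      obtain ⟨w, hw, rfl⟩ := hv
      exact h6 w hw

/-- `Γ^(β)` of an isomorphism class. -/
noncomputable def PosetClass.gam : PosetClass → MQSym :=
  Quotient.lift Gam fun _ _ h => Gam_congr h

/-- `Ω^(β)` of an isomorphism class of triples. -/
noncomputable def MarkedClass.omega : MarkedClass → MQSym :=
  Quotient.lift OmegaMarked fun _ _ h => OmegaMarked_congr h

/-- `Φ_<`: the continuous linear map with `[(P, γ)] ↦ Γ^(β)(P, γ)`. -/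
noncomputable def PhiLt : MLPoset →L[Scal] MQSym :=
  MQSym.extend PosetClass.gam fun m =>
    (PosetClass.finite_size_le m.degree).subset fun c hc => by
      induction c using Quotient.inductionOn with
      | h P =>
        have := card_le_degree id P.setValued (fun σ hσ => hσ.1) hc
        rwa [← Nat.card_eq_fintype_card] at this

/-- `Φ_{>|<}`: the continuous linear map with `[(P, γ, V)] ↦ Ω^(β)(P, γ, V)`. -/
noncomputable def PhiEnriched : MLPosetPlus →L[Scal] MQSym :=
  MQSym.extend MarkedClass.omega fun m =>
    (MarkedClass.finite_size_le m.degree).subset fun c hc => by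
      induction c using Quotient.inductionOn with
      | h P =>
        have := card_le_degree Marked.abs P.enriched (fun σ hσ => hσ.1) hc
        rwa [← Nat.card_eq_fintype_card] at this

/-! Multifundamental and multipeak quasisymmetric functions -/

/-- `I(α) = {α₁, α₁ + α₂, …, α₁ + ⋯ + α_{k-1}}` -/
def Composition.innerSums {N : ℕ} (α : Composition N) : Set ℕ :=
  {i | ∃ j, 0 < j ∧ j < α.length ∧ i = α.sizeUpTo j}

/-- `L^(β)_α = ∑ β^(|S| - N) x^S`, over the tuples `S₁ ≼ S₂ ≼ ⋯ ≼ S_N` of nonempty finite sets of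
positive integers with `S_i ≺ S_{i+1}` if `i ∈ I(α)`.  (Tuples are indexed from `0` here, so that
the entries with indices `p` and `q = p + 1` are `S_q` and `S_{q+1}`.) -/
noncomputable def multiFundamental {N : ℕ} (α : Composition N) : MQSym :=
  ⟨genFun id {S : Fin N → Finset ℕ+ | (∀ p, (S p).Nonempty) ∧ ∀ p q : Fin N, (q : ℕ) = p + 1 →
      SetLE (S p) (S q) ∧ ((q : ℕ) ∈ α.innerSums → SetLT (S p) (S q))},
    genFun_id_mem _ fun φ hφ σ => by
      simp only [Set.mem_ofPred_eq, Finset.image_nonempty, setLE_image hφ, setLT_image hφ]⟩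

/-- `K^(β)_α = ∑ β^(|S| - N) x^S`, over the tuples `S₁ ≼ S₂ ≼ ⋯ ≼ S_N` of nonempty finite sets of
letters of the marked alphabet such that the letters in `S_i ∩ S_{i+1}` are all primed if
`i ∈ I(α)` and all unprimed if `i ∉ I(α)`. -/
noncomputable def multiPeak {N : ℕ} (α : Composition N) : MQSym :=
  ⟨genFun Marked.abs {S : Fin N → Finset Marked | (∀ p, (S p).Nonempty) ∧
      ∀ p q : Fin N, (q : ℕ) = p + 1 → SetLE (S p) (S q) ∧
        ((q : ℕ) ∈ α.innerSums → ∀ l ∈ S p ∩ S q, Marked.IsPrimed l) ∧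
        ((q : ℕ) ∉ α.innerSums → ∀ l ∈ S p ∩ S q, ¬ Marked.IsPrimed l)},
    genFun_marked_mem _ fun φ hφ σ => by
      have h1 := Marked.relabel_strictMono hφ
      simp only [Set.mem_ofPred_eq, Finset.image_nonempty, setLE_image h1,
        forall_inter_image h1.injective (p := fun l => ¬ Marked.IsPrimed l) (fun _ => Iff.rfl),
        forall_inter_image h1.injective (p := Marked.IsPrimed) (fun _ => Iff.rfl)]⟩

open Classical in
/-- The peak composition `Λ(α)`, given by its boundary points. -/
noncomputable def Composition.peak {N : ℕ} (α : Composition N) : Composition N :=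
  CompositionAsSet.toComposition
    { boundaries := Finset.univ.filter fun b => b = 0 ∨ b = Fin.last N ∨
        ((b : ℕ) ∈ α.innerSums ∧ 1 < (b : ℕ) ∧ (b : ℕ) - 1 ∉ α.innerSums)
      zero_mem := by simp
      getLast_mem := by simp }

theorem Composition.mem_innerSums_iff {N : ℕ} (α : Composition N) (i : ℕ) :
    i ∈ α.innerSums ↔ ∃ b ∈ α.boundaries, (b : ℕ) = i ∧ 0 < i ∧ i < N := by
  constructor
  · rintro ⟨j, h1, h2, rfl⟩
    refine ⟨α.boundary ⟨j, by omega⟩, by simp [Composition.boundaries], rfl, ?_, ?_⟩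
    · have := α.sizeUpTo_strict_mono (i := 0) (by omega)
      have h3 := α.monotone_sizeUpTo (show 0 + 1 ≤ j by omega)
      omega
    · have := α.sizeUpTo_strict_mono h2
      have h3 := α.sizeUpTo_le (j + 1)
      omega
  · rintro ⟨b, hb, rfl, h1, h2⟩
    obtain ⟨j, rfl⟩ := by simpa [Composition.boundaries] using hb
    refine ⟨j, ?_, ?_, rfl⟩
    · rcases Nat.eq_zero_or_pos (j : ℕ) with h | h
      · have : j = 0 := Fin.ext h
        subst this
        simp at h1
      · exact h
    · rcases Nat.lt_or_ge (j : ℕ) α.length with h | h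
      · exact h
      · have : j = Fin.last _ := Fin.ext (by simp; omega)
        subst this
        simp at h2

/-- The characterization of `Λ(α)`: `I(Λ(α)) = {i ∈ I(α) : i > 1, i - 1 ∉ I(α)}`. -/
theorem Composition.innerSums_peak {N : ℕ} (α : Composition N) :
    α.peak.innerSums = {i | i ∈ α.innerSums ∧ 1 < i ∧ i - 1 ∉ α.innerSums} := by
  ext i
  rw [Composition.mem_innerSums_iff, Composition.peak, CompositionAsSet.toComposition_boundaries]
  constructor
  · rintro ⟨b, hb, rfl, h1, h2⟩
    simp only [Finset.mem_filter, Finset.mem_univ, true_and] at hb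
    rcases hb with h | h | h
    · subst h
      simp at h1
    · subst h
      simp at h2
    · exact h
  · intro h
    obtain ⟨b, -, rfl, h1, h2⟩ := (α.mem_innerSums_iff i).1 h.1
    refine ⟨b, ?_, rfl, h1, h2⟩
    simp only [Finset.mem_filter, Finset.mem_univ, true_and]
    exact Or.inr (Or.inr h)

/-- `Θ` takes the defining values of `Θ^(β)`: `L^(β)_α ↦ K^(β)_{Λ(α)}` for all compositions `α`. -/
def IsTheta (Θ : MQSym →L[Scal] MQSym) : Prop :=
  ∀ (N : ℕ) (α : Composition N), Θ (multiFundamental α) = multiPeak α.peak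

/-! All maps are continuous and linear, so every identity between them need only be checked on
pseudobasis elements, hence on positive labeled posets.

Coproduct. Both `Δ(Ψ[P])` and `(Ψ ⊗ Ψ)(Δ[P])` expand over quadruples `(A, B, C, D)` of subsets of
`P` for which `(A ∪ B, C ∪ D)` is a cut, the term being `[𝔐_{AB}] ⊗ [𝔐_{CD}]` with exponent `|A| +
|B| + |C| + |D| - |P|`. One side groups the quadruples by `(A ∪ C, B ∪ D)`, the other by `(A ∪ B, C
∪ D)` (`comul_mirrorSum`, `tensor_mirrorSum`). The product is easier: subsets of a disjoint union
are pairs of subsets.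

Expansion of `Ω`. An enriched map `σ` on `P` splits at each vertex into its unprimed and its primed
letters. Let `I` and `J` be the sets of vertices where these parts are nonempty. The parts form a
map on `I ∪ (-J)`, and the enriched condition on `σ` is the ordinary condition for the signed labels
(`letter_condition_iff`, `Omega_eq_sum`). Applied to the pseudobasis, this is also the identity `Φ_<
∘ Ψ = Φ_{>|<}`.

Theta. Three facts are needed. (a) The `L_α` form a pseudobasis: their coefficients at the monomials
`x₁^{δ₁} x₂^{δ₂} ⋯` form a unitriangular array, inverted by a Neumann series
(`exists_fundamentalMap_inverse`). This gives existence and uniqueness of `Θ`. (b) `K_α` depends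
only on the peaks of `α`. A descent that is not a peak is removed by a weight-preserving involution
on two adjacent sets of the tuple (`genFun_peakTuples_flip`, `multiPeak_peak`). (c) Over any
alphabet with primed and unprimed letters, the weight enumerator of `P` is the sum over words `w` in
the vertices of `β^{|w| - |P|}` times the enumerator of a chain with the descents of `w`
(`genFun_enrichedMaps`). Here the letters placed at vertices are linearly ordered, and the sorted
list is cut into runs at a constant vertex. The coefficients do not depend on the alphabet, so
`Γ(P)` and `Ω(P)` have the same expansion, in the `L_α` and in the `K_α`. By (b), `Θ` carries one to
the other. -/

/-! ### Continuous maps and tensors on linearly compact modules. -/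

namespace LC

/-- Every element of `LC S` is the sum of its coordinates times the pseudobasis. -/
theorem hasSum_basis {S : Type*} (x : LC S) : HasSum (fun s => x s • basis s) x := by
  rw [Pi.hasSum]
  intro t
  have h := hasSum_single (f := fun s => (x s • basis s : LC S) t) t fun s hs => by
    rw [Pi.smul_apply, basis_ne hs.symm, smul_zero]
  rwa [Pi.smul_apply, basis_self, smul_eq_mul, mul_one] at h

/-- A continuous linear map is determined by its values on the pseudobasis. -/
theorem ext_basis {S M : Type*} [AddCommMonoid M] [Module Scal M] [TopologicalSpace M]
    [T2Space M] {F G : LC S →L[Scal] M} (h : ∀ s, F (basis s) = G (basis s)) : F = G := by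
  ext x
  have h1 := (hasSum_basis x).mapL F
  have h2 := (hasSum_basis x).mapL G
  simp only [map_smul, h] at h1 h2
  exact h1.unique h2

/-- The tensor `x ⊗ y`. -/
noncomputable def tensor {S T : Type*} (x : LC S) (y : LC T) : LC (S × T) := fun t => x t.1 * y t.2

theorem tensor_basis {S T : Type*} (s : S) (t : T) :
    tensor (basis s) (basis t) = basis (s, t) := by
  classical
  funext u
  obtain ⟨u, v⟩ := u
  by_cases hu : u = s <;> by_cases hv : v = t <;>
    simp [tensor, basis, hu, hv]

theorem tensorMap_basis {S S' T T' : Type*} (F : LC S →L[Scal] LC T)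
    (G : LC S' →L[Scal] LC T') (s : S) (t : S') :
    tensorMap F G (basis (s, t)) = tensor (F (basis s)) (G (basis t)) :=
  extend_basis _ _ _

theorem sum_tensor_sum {S T A B : Type*} (U : Finset A) (V : Finset B) (c : A → Scal)
    (d : B → Scal) (x : A → S) (y : B → T) :
    tensor (∑ a ∈ U, c a • basis (x a)) (∑ b ∈ V, d b • basis (y b)) =
      ∑ a ∈ U, ∑ b ∈ V, (c a * d b) • basis (x a, y b) := by
  funext t
  simp only [tensor, Finset.sum_apply, Pi.smul_apply, Finset.sum_mul_sum, ← tensor_basis,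
    smul_eq_mul]
  refine Finset.sum_congr rfl fun a _ => Finset.sum_congr rfl fun b _ => ?_
  ring

end LC

/-! ### Signed parts of subsets of a mirrored poset. -/

namespace LabeledPoset

theorem equiv_of_label_eq {P Q : LabeledPoset} (e : P.V ≃o Q.V)
    (h : ∀ s, Q.label (e s) = P.label s) : P ≈ Q :=
  ⟨e, fun s t _ => by rw [h, h]⟩

/-- Only strict inequalities appear, because in a mirrored poset it is `<`, and not `≤`, that
depends on absolute values alone: `v` and `-v` are incomparable. -/
theorem mem_cuts {P : LabeledPoset} {S T : Finset P.V} :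
    (S, T) ∈ P.cuts ↔ (∀ v, v ∈ S ∨ v ∈ T) ∧ (∀ v w, v < w → w ∈ S → v ∈ S) ∧
      (∀ v w, v < w → v ∈ T → w ∈ T) ∧
        ∀ v w, v < w → v ∈ S → v ∈ T → w ∈ S → w ∈ T → False := by
  simp only [cuts, Finset.mem_filter, Finset.mem_univ, true_and, Finset.ext_iff, Finset.mem_union,
    iff_true]
  refine and_congr_right fun _ => and_congr ?_ (and_congr ?_ ?_)
  · refine ⟨fun h v w hvw hw => h hvw.le hw, fun h w v hvw hw => ?_⟩
    rcases hvw.eq_or_lt with rfl | hvw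
    · exact hw
    · exact h v w hvw hw
  · refine ⟨fun h v w hvw hw => h hvw.le hw, fun h v w hvw hw => ?_⟩
    rcases hvw.eq_or_lt with rfl | hvw
    · exact hw
    · exact h v w hvw hw
  · refine ⟨fun h v w hvw h1 h2 h3 h4 => ?_, fun h v hv w hw hne hle => ?_⟩
    · exact h (by simp [h1, h2]) (by simp [h3, h4]) hvw.ne hvw.le
    · simp only [Finset.coe_inter, Set.mem_inter_iff, Finset.mem_coe] at hv hw
      exact h v w (lt_of_le_of_ne hle hne) hv.1 hv.2 hw.1 hw.2

theorem mem_covers {P : LabeledPoset} {I J : Finset P.V} :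
    (I, J) ∈ P.covers ↔ ∀ v, v ∈ I ∨ v ∈ J := by
  simp [covers, Finset.ext_iff]

section Mirror

noncomputable instance MirrorVertex.instFintype (P : LabeledPoset) (I J : Finset P.V) :
    Fintype (MirrorVertex P I J) := Fintype.ofFinite _

variable {P : LabeledPoset} {I J : Finset P.V}

open Classical in
/-- The vertices `v` with `+v` in `S`. -/
noncomputable def posPart (S : Finset (MirrorVertex P I J)) : Finset P.V :=
  Finset.univ.filter fun v => ∃ h, (⟨v, 1, fun _ => h, fun h => absurd h (by decide)⟩ :
    MirrorVertex P I J) ∈ S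

open Classical in
/-- The vertices `v` with `-v` in `S`. -/
noncomputable def negPart (S : Finset (MirrorVertex P I J)) : Finset P.V :=
  Finset.univ.filter fun v => ∃ h, (⟨v, -1, fun h => absurd h (by decide), fun _ => h⟩ :
    MirrorVertex P I J) ∈ S

variable (I J) in
open Classical in
/-- The vertices `+v` with `v ∈ A` and `-v` with `v ∈ B`. -/
noncomputable def signedSet (A B : Finset P.V) : Finset (MirrorVertex P I J) :=
  Finset.univ.filter fun v => (v.sign = 1 → v.abs ∈ A) ∧ (v.sign = -1 → v.abs ∈ B)

theorem mem_posPart {S : Finset (MirrorVertex P I J)} (v : MirrorVertex P I J) (hv : v.sign = 1) :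
    v.abs ∈ posPart S ↔ v ∈ S := by
  obtain ⟨a, s, h1, h2⟩ := v
  subst hv
  simp only [posPart, Finset.mem_filter, Finset.mem_univ, true_and]
  exact ⟨fun ⟨_, h⟩ => h, fun h => ⟨h1 rfl, h⟩⟩

theorem mem_negPart {S : Finset (MirrorVertex P I J)} (v : MirrorVertex P I J)
    (hv : v.sign = -1) : v.abs ∈ negPart S ↔ v ∈ S := by
  obtain ⟨a, s, h1, h2⟩ := v
  subst hv
  simp only [negPart, Finset.mem_filter, Finset.mem_univ, true_and]
  exact ⟨fun ⟨_, h⟩ => h, fun h => ⟨h2 rfl, h⟩⟩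

theorem posPart_subset (S : Finset (MirrorVertex P I J)) : posPart S ⊆ I := fun v hv => by
  simp only [posPart, Finset.mem_filter, Finset.mem_univ, true_and] at hv
  exact hv.1

theorem negPart_subset (S : Finset (MirrorVertex P I J)) : negPart S ⊆ J := fun v hv => by
  simp only [negPart, Finset.mem_filter, Finset.mem_univ, true_and] at hv
  exact hv.1

theorem mem_signedSet {A B : Finset P.V} {v : MirrorVertex P I J} :
    v ∈ signedSet I J A B ↔ (v.sign = 1 → v.abs ∈ A) ∧ (v.sign = -1 → v.abs ∈ B) :=
  Finset.mem_filter_univ _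

theorem signedSet_parts (S : Finset (MirrorVertex P I J)) :
    signedSet I J (posPart S) (negPart S) = S := by
  ext v
  rw [mem_signedSet]
  rcases Int.units_eq_one_or v.sign with h | h
  · rw [← mem_posPart v h]
    simp [h]
  · rw [← mem_negPart v h]
    simp [h]

theorem posPart_signedSet {A B : Finset P.V} (hA : A ⊆ I) :
    posPart (signedSet I J A B) = A := by
  ext v
  constructor
  · intro h
    have := (mem_posPart ⟨v, 1, fun _ => posPart_subset _ h, by simp⟩ rfl).1 h
    exact (mem_signedSet.1 this).1 rfl
  · intro h
    refine (mem_posPart ⟨v, 1, fun _ => hA h, by simp⟩ rfl).2 (mem_signedSet.2 ?_)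
    simp [h]

theorem negPart_signedSet {A B : Finset P.V} (hB : B ⊆ J) :
    negPart (signedSet I J A B) = B := by
  ext v
  constructor
  · intro h
    have := (mem_negPart ⟨v, -1, by simp, fun _ => negPart_subset _ h⟩ rfl).1 h
    exact (mem_signedSet.1 this).2 rfl
  · intro h
    refine (mem_negPart ⟨v, -1, by simp, fun _ => hB h⟩ rfl).2 (mem_signedSet.2 ?_)
    simp [h]

theorem card_parts (S : Finset (MirrorVertex P I J)) :
    S.card = (posPart S).card + (negPart S).card := by
  classical
  rw [← Finset.card_filter_add_card_filter_not (s := S) fun v => v.sign = 1]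
  congr 1
  · refine Finset.card_bij (fun v _ => MirrorVertex.abs v) ?_ ?_ ?_
    · intro v hv
      rw [Finset.mem_filter] at hv
      exact (mem_posPart v hv.2).2 hv.1
    · intro v hv w hw h
      rw [Finset.mem_filter] at hv hw
      exact MirrorVertex.ext h (hv.2.trans hw.2.symm)
    · intro v hv
      exact ⟨⟨v, 1, fun _ => posPart_subset _ hv, by simp⟩,
        Finset.mem_filter.2 ⟨(mem_posPart _ rfl).1 hv, rfl⟩, rfl⟩
  · refine Finset.card_bij (fun v _ => MirrorVertex.abs v) ?_ ?_ ?_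
    · intro v hv
      rw [Finset.mem_filter] at hv
      exact (mem_negPart v ((Int.units_eq_one_or v.sign).resolve_left hv.2)).2 hv.1
    · intro v hv w hw h
      rw [Finset.mem_filter] at hv hw
      exact MirrorVertex.ext h (((Int.units_eq_one_or v.sign).resolve_left hv.2).trans
        ((Int.units_eq_one_or w.sign).resolve_left hw.2).symm)
    · intro v hv
      have h1 : (-1 : ℤˣ) ≠ 1 := by decide
      exact ⟨⟨v, -1, by simp, fun _ => negPart_subset _ hv⟩,
        Finset.mem_filter.2 ⟨(mem_negPart _ rfl).1 hv, h1⟩, rfl⟩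

/-- Restricting a mirrored poset gives a mirrored poset. -/
theorem restrict_mirror_equiv (hP : P.Positive) (S : Finset (MirrorVertex P I J)) :
    (P.mirror hP I J).restrict S ≈ P.mirror hP (posPart S) (negPart S) := by
  let f : MirrorVertex P (posPart S) (negPart S) → MirrorVertex P I J := fun v =>
    ⟨v.abs, v.sign, fun h => posPart_subset _ (v.mem_of_pos h),
      fun h => negPart_subset _ (v.mem_of_neg h)⟩
  have hf : ∀ v, f v ∈ S := by
    intro v
    rcases Int.units_eq_one_or v.sign with h | h
    · exact (mem_posPart (f v) h).1 (v.mem_of_pos h)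
    · exact (mem_negPart (f v) h).1 (v.mem_of_neg h)
  let g : {v // v ∈ S} → MirrorVertex P (posPart S) (negPart S) := fun v =>
    ⟨v.1.abs, v.1.sign, fun h => (mem_posPart v.1 h).2 v.2, fun h => (mem_negPart v.1 h).2 v.2⟩
  let e : {v // v ∈ S} ≃ MirrorVertex P (posPart S) (negPart S) :=
    { toFun := g
      invFun := fun v => ⟨f v, hf v⟩
      left_inv := fun v => Subtype.ext (MirrorVertex.ext rfl rfl)
      right_inv := fun v => MirrorVertex.ext rfl rfl }
  refine equiv_of_label_eq (P := (P.mirror hP I J).restrict S)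
    (Q := P.mirror hP (posPart S) (negPart S)) ⟨e, ?_⟩ fun _ => rfl
  intro (v : {v // v ∈ S}) (w : {v // v ∈ S})
  change (e v = e w ∨ v.1.abs < w.1.abs) ↔ (v.1 = w.1 ∨ v.1.abs < w.1.abs)
  rw [e.injective.eq_iff, Subtype.ext_iff]

end Mirror

theorem Positive.restrict {P : LabeledPoset} (hP : P.Positive) (S : Finset P.V) :
    (P.restrict S).Positive := fun v => hP v.1

/-- The inclusion of a restriction. -/
def restrictEmbedding (P : LabeledPoset) (S : Finset P.V) : (P.restrict S).V ↪ P.V :=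
  ⟨fun v => v.1, Subtype.val_injective⟩

theorem mem_map_restrictEmbedding {P : LabeledPoset} {S : Finset P.V}
    {K : Finset (P.restrict S).V} {v : P.V} :
    v ∈ K.map (P.restrictEmbedding S) ↔ ∃ h : v ∈ S, (⟨v, h⟩ : {v // v ∈ S}) ∈ K := by
  rw [Finset.mem_map]
  exact ⟨fun ⟨a, ha, h⟩ => h ▸ ⟨a.2, ha⟩, fun ⟨h, ha⟩ => ⟨_, ha, rfl⟩⟩

/-- Mirroring a restriction. -/
theorem mirror_restrict_equiv {P : LabeledPoset} (hP : P.Positive) (S : Finset P.V)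
    (I J : Finset (P.restrict S).V) :
    (P.restrict S).mirror (hP.restrict S) I J ≈
      P.mirror hP (I.map (P.restrictEmbedding S)) (J.map (P.restrictEmbedding S)) := by
  have hS : ∀ v : MirrorVertex P (I.map (P.restrictEmbedding S))
      (J.map (P.restrictEmbedding S)), v.abs ∈ S := by
    intro v
    rcases Int.units_eq_one_or v.sign with h | h
    · exact (mem_map_restrictEmbedding.1 (v.mem_of_pos h)).1
    · exact (mem_map_restrictEmbedding.1 (v.mem_of_neg h)).1
  let e : MirrorVertex (P.restrict S) I J ≃ MirrorVertex P (I.map (P.restrictEmbedding S))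
      (J.map (P.restrictEmbedding S)) :=
    ⟨fun v => ⟨v.abs.1, v.sign, fun h => mem_map_restrictEmbedding.2 ⟨_, v.mem_of_pos h⟩,
        fun h => mem_map_restrictEmbedding.2 ⟨_, v.mem_of_neg h⟩⟩,
      fun v => ⟨⟨v.abs, hS v⟩, v.sign,
        fun h => (mem_map_restrictEmbedding.1 (v.mem_of_pos h)).2,
        fun h => (mem_map_restrictEmbedding.1 (v.mem_of_neg h)).2⟩, fun _ => rfl, fun _ => rfl⟩
  refine equiv_of_label_eq (P := (P.restrict S).mirror (hP.restrict S) I J)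
    (Q := P.mirror hP (I.map (P.restrictEmbedding S)) (J.map (P.restrictEmbedding S)))
    ⟨e, ?_⟩ fun _ => rfl
  intro (v : MirrorVertex (P.restrict S) I J) (w : MirrorVertex (P.restrict S) I J)
  change (e v = e w ∨ v.abs < w.abs) ↔ (v = w ∨ v.abs < w.abs)
  rw [e.injective.eq_iff]

end LabeledPoset

/-! ### Mirroring and the coproduct. -/

namespace LabeledPoset

section Quads

variable (P : LabeledPoset)

open Classical in
/-- The quadruples `((A, B), (C, D))` such that `(A ∪ B, C ∪ D)` is a cut. -/
noncomputable def quads : Finset ((Finset P.V × Finset P.V) × (Finset P.V × Finset P.V)) :=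
  Finset.univ.filter fun q => (q.1.1 ∪ q.1.2, q.2.1 ∪ q.2.2) ∈ P.cuts

/-- The common value of `Δ (Ψ [P])` and `(Ψ ⊗ Ψ) (Δ [P])`. -/
noncomputable def quadSum (hP : P.Positive) : LC (PosetClass × PosetClass) :=
  -- The four sets cover `P`, so the subtraction does not truncate.
  ∑ q ∈ P.quads, beta ^ (q.1.1.card + q.1.2.card + q.2.1.card + q.2.2.card - Fintype.card P.V) •
    LC.basis ((⟦P.mirror hP q.1.1 q.1.2⟧, ⟦P.mirror hP q.2.1 q.2.2⟧) : PosetClass × PosetClass)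

variable {P}

/-- The order sees only absolute values, so a cut of the mirrored poset should be a cut of `P`. The
delicate case is a vertex with `+a` in one half and `-a` in the other, which puts `a` in both halves
of `P`; the antichain condition and the two closure conditions then have to be traded against each
other. -/
theorem mem_cuts_mirror {I J : Finset P.V} (hP : P.Positive) (hIJ : (I, J) ∈ P.covers)
    (S T : Finset (MirrorVertex P I J)) (hST : ∀ v, v ∈ S ∨ v ∈ T) :
    ((S, T) : Finset (P.mirror hP I J).V × _) ∈ (P.mirror hP I J).cuts ↔
      (posPart S ∪ negPart S, posPart T ∪ negPart T) ∈ P.cuts := by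
  have key : ∀ (S : Finset (MirrorVertex P I J)) (a : P.V),
      a ∈ posPart S ∪ negPart S ↔ ∃ v ∈ S, v.abs = a := by
    intro S a
    rw [Finset.mem_union]
    constructor
    · rintro (h | h)
      · exact ⟨_, (mem_posPart ⟨a, 1, fun _ => posPart_subset _ h, by simp⟩ rfl).1 h, rfl⟩
      · exact ⟨_, (mem_negPart ⟨a, -1, by simp, fun _ => negPart_subset _ h⟩ rfl).1 h, rfl⟩
    · rintro ⟨v, hv, rfl⟩
      rcases Int.units_eq_one_or v.sign with h | h
      · exact Or.inl ((mem_posPart v h).2 hv)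
      · exact Or.inr ((mem_negPart v h).2 hv)
  have lift : ∀ a, ∃ v : MirrorVertex P I J, v.abs = a := by
    intro a
    rcases mem_covers.1 hIJ a with h | h
    · exact ⟨⟨a, 1, fun _ => h, by simp⟩, rfl⟩
    · exact ⟨⟨a, -1, by simp, fun _ => h⟩, rfl⟩
  refine (mem_cuts (P := P.mirror hP I J)).trans ?_
  rw [mem_cuts]
  simp only [key]
  constructor
  · rintro ⟨-, h2, h3, h4⟩
    have h2 : ∀ v w : MirrorVertex P I J, v.abs < w.abs → w ∈ S → v ∈ S := h2
    have h3 : ∀ v w : MirrorVertex P I J, v.abs < w.abs → v ∈ T → w ∈ T := h3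
    have h4 : ∀ v w : MirrorVertex P I J, v.abs < w.abs → v ∈ S → v ∈ T → w ∈ S → w ∈ T →
      False := h4
    refine ⟨fun a => ?_, fun a b hab => ?_, fun a b hab => ?_, fun a b hab => ?_⟩
    · obtain ⟨v, rfl⟩ := lift a
      exact (hST v).imp (fun h => ⟨v, h, rfl⟩) (fun h => ⟨v, h, rfl⟩)
    · obtain ⟨v, rfl⟩ := lift a
      rintro ⟨w, hw, rfl⟩
      exact ⟨v, h2 v w hab hw, rfl⟩
    · obtain ⟨w, rfl⟩ := lift b
      rintro ⟨v, hv, rfl⟩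
      exact ⟨w, h3 v w hab hv, rfl⟩
    · rintro ⟨v, hv, rfl⟩ ⟨v', hv', hvv⟩ ⟨w, hw, rfl⟩ ⟨w', hw', hww⟩
      -- `v'` is known to lie in `T` and `w` in `S`. As `v' < w`, the lower set `S` also contains
      -- `v'` and the upper set `T` also contains `w`.
      exact h4 v' w (hvv ▸ hab) (h2 v' w (hvv ▸ hab) hw) hv' hw (h3 v' w (hvv ▸ hab) hv')
  · rintro ⟨-, h2, h3, h4⟩
    refine ⟨hST, ?_, ?_, ?_⟩
    · intro (v : MirrorVertex P I J) (w : MirrorVertex P I J) (hvw : v.abs < w.abs) hw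
      -- If `v` were in `T` below `w` in `S`, closure in `P` would put `|v|` and `|w|` in both
      -- halves, against the antichain condition.
      refine (hST v).resolve_right fun hv => ?_
      obtain ⟨v', h5⟩ := h2 _ _ hvw ⟨w, hw, rfl⟩
      obtain ⟨w', h6⟩ := h3 _ _ hvw ⟨v, hv, rfl⟩
      exact h4 _ _ hvw ⟨v', h5⟩ ⟨v, hv, rfl⟩ ⟨w, hw, rfl⟩ ⟨w', h6⟩
    · intro (v : MirrorVertex P I J) (w : MirrorVertex P I J) (hvw : v.abs < w.abs) hv
      refine (hST w).resolve_left fun hw => ?_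
      obtain ⟨v', h5⟩ := h2 _ _ hvw ⟨w, hw, rfl⟩
      obtain ⟨w', h6⟩ := h3 _ _ hvw ⟨v, hv, rfl⟩
      exact h4 _ _ hvw ⟨v', h5⟩ ⟨v, hv, rfl⟩ ⟨w, hw, rfl⟩ ⟨w', h6⟩
    · intro v w (hvw : MirrorVertex.abs v < MirrorVertex.abs w) h5 h6 h7 h8
      exact h4 _ _ hvw ⟨v, h5, rfl⟩ ⟨v, h6, rfl⟩ ⟨w, h7, rfl⟩ ⟨w, h8, rfl⟩

theorem card_inter_of_cover {A : Type*} [Fintype A] [DecidableEq A] {S T : Finset A}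
    (h : ∀ v, v ∈ S ∨ v ∈ T) : (S ∩ T).card + Fintype.card A = S.card + T.card := by
  have h1 : S ∪ T = Finset.univ := by
    ext v
    simp [h v]
  have h2 := Finset.card_union_add_card_inter S T
  rw [h1, Finset.card_univ] at h2
  omega

/-- Inclusion-exclusion in the mirrored poset, which has `|I| + |J|` vertices. -/
theorem card_inter_parts {I J : Finset P.V} [DecidableEq (MirrorVertex P I J)]
    (S T : Finset (MirrorVertex P I J)) (h : ∀ v, v ∈ S ∨ v ∈ T) :
    (S ∩ T).card + (I.card + J.card) =
      (posPart S).card + (negPart S).card + ((posPart T).card + (negPart T).card) := by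
  have h2 := Finset.card_union_add_card_inter S T
  have h3 : S ∪ T = signedSet I J I J := Finset.ext fun v =>
    Finset.mem_union.trans (iff_of_true (h v) (mem_signedSet.2 ⟨v.mem_of_pos, v.mem_of_neg⟩))
  have h4 := card_parts (signedSet I J I J)
  rw [posPart_signedSet Finset.Subset.rfl, negPart_signedSet Finset.Subset.rfl, ← h3] at h4
  have h5 := card_parts S
  have h6 := card_parts T
  omega

/-- Group the quadruples by `(A ∪ C, B ∪ D) = (I, J)`. Inside a group, a cut `(S, T)` of `𝔐_{IJ}`
corresponds to the positive and negative parts of `S` and of `T`. The exponents add up because `|I ∩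
J| = |I| + |J| - |P|` and `|S ∩ T| = |S| + |T| - |I| - |J|`. -/
theorem comul_mirrorSum (hP : P.Positive) :
    MLPoset.comul (P.mirrorSum hP) = P.quadSum hP := by
  classical
  have hmaps : ∀ q ∈ P.quads, (q.1.1 ∪ q.2.1, q.1.2 ∪ q.2.2) ∈ P.covers := by
    rintro ⟨⟨A, B⟩, ⟨C, D⟩⟩ hq
    simp only [quads, Finset.mem_filter, Finset.mem_univ, true_and] at hq
    rw [mem_covers]
    intro v
    have := (mem_cuts.1 hq).1 v
    simp only [Finset.mem_union] at this ⊢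
    tauto
  rw [quadSum, ← Finset.sum_fiberwise_of_maps_to hmaps, mirrorSum, map_sum]
  refine Finset.sum_congr rfl ?_
  rintro ⟨I, J⟩ hIJ
  rw [map_smul, MLPoset.comul, LC.extend_basis]
  change _ • (P.mirror hP I J).coproduct = _
  rw [coproduct, Finset.smul_sum]
  refine Finset.sum_bij'
    (fun (p : Finset (MirrorVertex P I J) × Finset (MirrorVertex P I J)) _ =>
      ((posPart p.1, negPart p.1), (posPart p.2, negPart p.2)))
    (fun q _ => (signedSet I J q.1.1 q.1.2, signedSet I J q.2.1 q.2.2)) ?_ ?_ ?_ ?_ ?_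
  · rintro ⟨S, T⟩ hST
    have hc : ∀ v : MirrorVertex P I J, v ∈ S ∨ v ∈ T := (mem_cuts.1 hST).1
    simp only [quads, Finset.mem_filter, Finset.mem_univ, true_and]
    refine ⟨by convert (mem_cuts_mirror hP hIJ S T hc).1 hST, ?_⟩
    rw [Prod.mk.injEq]
    constructor
    · refine Finset.Subset.antisymm (Finset.union_subset (posPart_subset _) (posPart_subset _)) ?_
      intro v hv
      let x : MirrorVertex P I J := ⟨v, 1, fun _ => hv, by simp⟩
      exact Finset.mem_union.2 ((hc x).imp (mem_posPart x rfl).2 (mem_posPart x rfl).2)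
    · refine Finset.Subset.antisymm (Finset.union_subset (negPart_subset _) (negPart_subset _)) ?_
      intro v hv
      let x : MirrorVertex P I J := ⟨v, -1, by simp, fun _ => hv⟩
      exact Finset.mem_union.2 ((hc x).imp (mem_negPart x rfl).2 (mem_negPart x rfl).2)
  · rintro ⟨⟨A, B⟩, ⟨C, D⟩⟩ hq
    simp only [quads, Finset.mem_filter, Finset.mem_univ, true_and, Prod.mk.injEq] at hq
    obtain ⟨hq, rfl, rfl⟩ := hq
    refine (mem_cuts_mirror hP hIJ _ _ fun v => ?_).2 ?_
    · rw [mem_signedSet, mem_signedSet]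
      rcases Int.units_eq_one_or v.sign with h | h
      · simpa [h] using v.mem_of_pos h
      · simpa [h] using v.mem_of_neg h
    · rw [posPart_signedSet Finset.subset_union_left, posPart_signedSet Finset.subset_union_right,
        negPart_signedSet Finset.subset_union_left, negPart_signedSet Finset.subset_union_right]
      convert hq
  · rintro ⟨S, T⟩ -
    exact Prod.ext (signedSet_parts S) (signedSet_parts T)
  · rintro ⟨⟨A, B⟩, ⟨C, D⟩⟩ hq
    simp only [quads, Finset.mem_filter, Finset.mem_univ, true_and, Prod.mk.injEq] at hq
    obtain ⟨hq, rfl, rfl⟩ := hq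
    dsimp only
    rw [posPart_signedSet Finset.subset_union_left, posPart_signedSet Finset.subset_union_right,
      negPart_signedSet Finset.subset_union_left, negPart_signedSet Finset.subset_union_right]
  · rintro ⟨S, T⟩ hST
    have hc : ∀ v : MirrorVertex P I J, v ∈ S ∨ v ∈ T := (mem_cuts.1 hST).1
    have hS : (⟦(P.mirror hP I J).restrict S⟧ : PosetClass) = ⟦P.mirror hP (posPart S) (negPart S)⟧ :=
      Quotient.sound (restrict_mirror_equiv hP S)
    have hT : (⟦(P.mirror hP I J).restrict T⟧ : PosetClass) = ⟦P.mirror hP (posPart T) (negPart T)⟧ :=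
      Quotient.sound (restrict_mirror_equiv hP T)
    dsimp only
    rw [smul_smul, ← pow_add]
    congr 2
    · have h1 := card_inter_of_cover (mem_covers.1 hIJ)
      have h2 : (S ∩ T).card + (I.card + J.card) =
          (posPart S).card + (negPart S).card + ((posPart T).card + (negPart T).card) :=
        @card_inter_parts P I J (P.mirror hP I J).instDecidableEqV S T hc
      omega
    · rw [hS, hT]

/-- Group the quadruples by `(A ∪ B, C ∪ D) = (S, T)`. Inside a group, `(A, B)` and `(C, D)` are
independent coverings of `S` and of `T`. Three inclusion-exclusions, in `S`, `T` and `P`, match the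
exponents. -/
theorem tensor_mirrorSum (hP : P.Positive) :
    LC.tensorMap Psi Psi P.coproduct = P.quadSum hP := by
  classical
  have hmaps : ∀ q ∈ P.quads, (q.1.1 ∪ q.1.2, q.2.1 ∪ q.2.2) ∈ P.cuts := by
    intro q hq
    simp only [quads, Finset.mem_filter, Finset.mem_univ, true_and] at hq
    convert hq
  rw [quadSum, ← Finset.sum_fiberwise_of_maps_to hmaps, coproduct, map_sum]
  refine Finset.sum_congr rfl ?_
  rintro ⟨S, T⟩ hST
  rw [map_smul, LC.tensorMap_basis, Psi_basis _ (hP.restrict S), Psi_basis _ (hP.restrict T),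
    mirrorSum, mirrorSum, LC.sum_tensor_sum, ← Finset.sum_product', Finset.smul_sum]
  have hunion : ∀ {S : Finset P.V} {p : Finset (P.restrict S).V × Finset (P.restrict S).V},
      p ∈ (P.restrict S).covers →
        p.1.map (P.restrictEmbedding S) ∪ p.2.map (P.restrictEmbedding S) = S := by
    intro S p hp
    ext v
    rw [Finset.mem_union, mem_map_restrictEmbedding, mem_map_restrictEmbedding]
    refine ⟨fun h => h.elim (fun h => h.1) (fun h => h.1), fun h => ?_⟩
    exact (mem_covers.1 hp ⟨v, h⟩).imp (fun h' => ⟨h, h'⟩) (fun h' => ⟨h, h'⟩)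
  have hpre : ∀ {S A : Finset P.V}, A ⊆ S →
      (A.preimage (P.restrictEmbedding S) (P.restrictEmbedding S).injective.injOn).map
        (P.restrictEmbedding S) = A := by
    intro S A hA
    ext v
    rw [mem_map_restrictEmbedding]
    exact ⟨fun h => Finset.mem_preimage.1 h.2, fun h => ⟨hA h, Finset.mem_preimage.2 h⟩⟩
  have hcov : ∀ {S A B : Finset P.V}, A ∪ B = S →
      (A.preimage (P.restrictEmbedding S) (P.restrictEmbedding S).injective.injOn,
        B.preimage (P.restrictEmbedding S) (P.restrictEmbedding S).injective.injOn) ∈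
          (P.restrict S).covers := by
    rintro S A B rfl
    rw [mem_covers]
    intro v
    rw [Finset.mem_preimage, Finset.mem_preimage]
    exact Finset.mem_union.1 v.2
  refine Finset.sum_bij'
    (fun p _ => ((p.1.1.map (P.restrictEmbedding S), p.1.2.map (P.restrictEmbedding S)),
      (p.2.1.map (P.restrictEmbedding T), p.2.2.map (P.restrictEmbedding T))))
    (fun q _ => ((q.1.1.preimage _ (P.restrictEmbedding S).injective.injOn,
        q.1.2.preimage _ (P.restrictEmbedding S).injective.injOn),
      (q.2.1.preimage _ (P.restrictEmbedding T).injective.injOn,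
        q.2.2.preimage _ (P.restrictEmbedding T).injective.injOn))) ?_ ?_ ?_ ?_ ?_
  · rintro p hp
    rw [Finset.mem_product] at hp
    have h1 := hunion hp.1
    have h2 := hunion hp.2
    simp only [quads, Finset.mem_filter, Finset.mem_univ, true_and]
    refine ⟨?_, by rw [h1, h2]⟩
    convert hST
  · rintro ⟨⟨A, B⟩, ⟨C, D⟩⟩ hq
    simp only [quads, Finset.mem_filter, Finset.mem_univ, true_and, Prod.mk.injEq] at hq
    exact Finset.mem_product.2 ⟨hcov hq.2.1, hcov hq.2.2⟩
  · rintro ⟨⟨A, B⟩, ⟨C, D⟩⟩ -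
    simp [Finset.preimage_map]
  · rintro ⟨⟨A, B⟩, ⟨C, D⟩⟩ hq
    simp only [quads, Finset.mem_filter, Finset.mem_univ, true_and, Prod.mk.injEq] at hq
    obtain ⟨-, rfl, rfl⟩ := hq
    dsimp only
    rw [hpre Finset.subset_union_left, hpre Finset.subset_union_right,
      hpre Finset.subset_union_left, hpre Finset.subset_union_right]
  · rintro ⟨⟨A, B⟩, ⟨C, D⟩⟩ hp
    rw [Finset.mem_product] at hp
    dsimp only
    rw [smul_smul, ← pow_add, ← pow_add]
    have hS : (⟦(P.restrict S).mirror (hP.restrict S) A B⟧ : PosetClass) = ⟦P.mirror hP _ _⟧ :=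
      Quotient.sound (mirror_restrict_equiv hP S A B)
    have hT : (⟦(P.restrict T).mirror (hP.restrict T) C D⟧ : PosetClass) = ⟦P.mirror hP _ _⟧ :=
      Quotient.sound (mirror_restrict_equiv hP T C D)
    congr 2
    · have h1 := card_inter_of_cover (mem_covers.1 hp.1)
      have h2 := card_inter_of_cover (mem_covers.1 hp.2)
      have h3 := card_inter_of_cover (mem_cuts.1 hST).1
      have h4 : ∀ S : Finset P.V, Fintype.card (P.restrict S).V = S.card := fun S => by
        rw [← Nat.card_eq_fintype_card]
        exact P.size_restrict S
      rw [h4] at h1 h2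
      simp only [Finset.card_map]
      omega
    · rw [hS, hT]

end Quads

end LabeledPoset

/-! ### Mirroring and the product. -/

namespace LabeledPoset

section Union

variable {P Q : LabeledPoset}

theorem shift_label_lt {P : LabeledPoset} (s t : P.V) :
    P.shift.label s < P.shift.label t ↔ P.label s < P.label t := by
  change P.label s - Finset.univ.inf' ⟨s, Finset.mem_univ s⟩ P.label + 1 <
    P.label t - Finset.univ.inf' ⟨t, Finset.mem_univ t⟩ P.label + 1 ↔ _
  simp

theorem unionLabel_inl_lt (s t : P.V) :
    unionLabel P Q (Sum.inl s) < unionLabel P Q (Sum.inl t) ↔ P.label s < P.label t := by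
  simp [unionLabel]

theorem unionLabel_inr_lt (s t : Q.V) :
    unionLabel P Q (Sum.inr s) < unionLabel P Q (Sum.inr t) ↔ Q.label s < Q.label t := by
  simp [unionLabel]

/-- For mixed signs positivity alone decides the comparison, and for equal signs only the relative
order of the labels matters. So signed labels compare alike under any two positive labelings with
the same relative order. -/
theorem sign_mul_lt_sign_mul {a b c d : ℤ} (e f : ℤˣ) (ha : 0 < a) (hb : 0 < b) (hc : 0 < c)
    (hd : 0 < d) (h : a < b ↔ c < d) (h' : b < a ↔ d < c) :
    (e : ℤ) * a < f * b ↔ (e : ℤ) * c < f * d := by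
  rcases Int.units_eq_one_or e with rfl | rfl <;> rcases Int.units_eq_one_or f with rfl | rfl <;>
    simp only [Units.val_one, Units.val_neg, one_mul, neg_mul] <;> omega

/-- The vertices of the disjoint union of mirrored posets. -/
def mirrorUnionMap (I J : Finset (P.V ⊕ Q.V)) :
    MirrorVertex P I.toLeft J.toLeft ⊕ MirrorVertex Q I.toRight J.toRight →
      MirrorVertex (union P Q).shift I J
  | Sum.inl v => ⟨Sum.inl v.abs, v.sign, fun h => Finset.mem_toLeft.1 (v.mem_of_pos h),
      fun h => Finset.mem_toLeft.1 (v.mem_of_neg h)⟩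
  | Sum.inr v => ⟨Sum.inr v.abs, v.sign, fun h => Finset.mem_toRight.1 (v.mem_of_pos h),
      fun h => Finset.mem_toRight.1 (v.mem_of_neg h)⟩

theorem mirrorUnionMap_bijective (I J : Finset (P.V ⊕ Q.V)) :
    Function.Bijective (mirrorUnionMap I J) := by
  constructor
  · rintro (v | v) (w | w) h
    · obtain ⟨h1, h2⟩ := MirrorVertex.ext_iff.1 h
      exact congrArg Sum.inl (MirrorVertex.ext (Sum.inl_injective h1) h2)
    · obtain ⟨h1, h2⟩ := MirrorVertex.ext_iff.1 h
      exact (Sum.inl_ne_inr h1).elim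
    · obtain ⟨h1, h2⟩ := MirrorVertex.ext_iff.1 h
      exact (Sum.inr_ne_inl h1).elim
    · obtain ⟨h1, h2⟩ := MirrorVertex.ext_iff.1 h
      exact congrArg Sum.inr (MirrorVertex.ext (Sum.inr_injective h1) h2)
  · rintro ⟨a | a, s, h1, h2⟩
    · exact ⟨Sum.inl ⟨a, s, fun h => Finset.mem_toLeft.2 (h1 h),
        fun h => Finset.mem_toLeft.2 (h2 h)⟩, rfl⟩
    · exact ⟨Sum.inr ⟨a, s, fun h => Finset.mem_toRight.2 (h1 h),
        fun h => Finset.mem_toRight.2 (h2 h)⟩, rfl⟩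

/-- Mirroring commutes with disjoint unions. -/
theorem union_mirror_equiv (hP : P.Positive) (hQ : Q.Positive) (I J : Finset (P.V ⊕ Q.V)) :
    union (P.mirror hP I.toLeft J.toLeft) (Q.mirror hQ I.toRight J.toRight) ≈
      (union P Q).shift.mirror (union P Q).shift_positive I J := by
  have hlt : ∀ v w, (mirrorUnionMap I J v).abs < (mirrorUnionMap I J w).abs ↔ v < w := by
    rintro (v | v) (w | w)
    · rw [Sum.inl_lt_inl_iff]
      exact Sum.inl_lt_inl_iff
    · exact iff_of_false (fun h => Sum.not_inl_lt_inr h) Sum.not_inl_lt_inr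
    · exact iff_of_false (fun h => Sum.not_inr_lt_inl h) Sum.not_inr_lt_inl
    · rw [Sum.inr_lt_inr_iff]
      exact Sum.inr_lt_inr_iff
  let e := Equiv.ofBijective _ (mirrorUnionMap_bijective (P := P) (Q := Q) I J)
  refine ⟨⟨e, ?_⟩, ?_⟩
  · intro (v : MirrorVertex P _ _ ⊕ MirrorVertex Q _ _) (w : MirrorVertex P _ _ ⊕ MirrorVertex Q _ _)
    change (e v = e w ∨ (mirrorUnionMap I J v).abs < (mirrorUnionMap I J w).abs) ↔ v ≤ w
    rw [le_iff_eq_or_lt, hlt, e.injective.eq_iff]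
  · intro v w hvw
    rcases v with v | v <;> rcases w with w | w
    · refine (unionLabel_inl_lt (Q := Q.mirror hQ I.toRight J.toRight) _ _).trans (sign_mul_lt_sign_mul _ _ (hP _) (hP _)
        (shift_positive _ _) (shift_positive _ _) ?_ ?_)
      · exact ((shift_label_lt _ _).trans (unionLabel_inl_lt (Q := Q) _ _)).symm
      · exact ((shift_label_lt _ _).trans (unionLabel_inl_lt (Q := Q) _ _)).symm
    · exact (Sum.not_inl_lt_inr hvw.1).elim
    · exact (Sum.not_inr_lt_inl hvw.1).elim
    · refine (unionLabel_inr_lt (P := P.mirror hP I.toLeft J.toLeft) _ _).trans (sign_mul_lt_sign_mul _ _ (hQ _) (hQ _)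
        (shift_positive _ _) (shift_positive _ _) ?_ ?_)
      · exact ((shift_label_lt _ _).trans (unionLabel_inr_lt (P := P) _ _)).symm
      · exact ((shift_label_lt _ _).trans (unionLabel_inr_lt (P := P) _ _)).symm

/-- A covering of the disjoint union is a pair of coverings of the summands, and `|I ∩ J|` is
additive over the summands. -/
theorem mirrorSum_union (hP : P.Positive) (hQ : Q.Positive) :
    (union P Q).shift.mirrorSum (union P Q).shift_positive =
      MLPoset.mul (LC.tensor (P.mirrorSum hP) (Q.mirrorSum hQ)) := by
  classical
  rw [mirrorSum, mirrorSum, mirrorSum, LC.sum_tensor_sum, ← Finset.sum_product', map_sum]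
  refine Finset.sum_bij'
    (fun (p : Finset (P.V ⊕ Q.V) × Finset (P.V ⊕ Q.V)) _ =>
      ((p.1.toLeft, p.2.toLeft), (p.1.toRight, p.2.toRight)))
    (fun p _ => (p.1.1.disjSum p.2.1, p.1.2.disjSum p.2.2)) ?_ ?_ ?_ ?_ ?_
  · rintro ⟨I, J⟩ h
    have h : ∀ v : P.V ⊕ Q.V, v ∈ I ∨ v ∈ J := mem_covers.1 h
    rw [Finset.mem_product, mem_covers, mem_covers]
    exact ⟨fun v => (h (Sum.inl v)).imp Finset.mem_toLeft.2 Finset.mem_toLeft.2,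
      fun v => (h (Sum.inr v)).imp Finset.mem_toRight.2 Finset.mem_toRight.2⟩
  · rintro ⟨⟨A, B⟩, ⟨C, D⟩⟩ h
    rw [Finset.mem_product, mem_covers, mem_covers] at h
    refine (mem_covers (P := (union P Q).shift)).2 ?_
    rintro (v | v)
    · exact (h.1 v).imp Finset.inl_mem_disjSum.2 Finset.inl_mem_disjSum.2
    · exact (h.2 v).imp Finset.inr_mem_disjSum.2 Finset.inr_mem_disjSum.2
  · rintro ⟨I, J⟩ -
    exact Prod.ext (Finset.toLeft_disjSum_toRight) (Finset.toLeft_disjSum_toRight)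
  · rintro ⟨⟨A, B⟩, ⟨C, D⟩⟩ -
    simp
  · rintro ⟨I, J⟩ hIJ
    have h0 : ∀ v : P.V ⊕ Q.V, v ∈ I ∨ v ∈ J := mem_covers.1 hIJ
    have h1 : ∀ v, v ∈ Finset.toLeft I ∨ v ∈ Finset.toLeft J := fun v =>
      (h0 (Sum.inl v)).imp Finset.mem_toLeft.2 Finset.mem_toLeft.2
    have h2 : ∀ v, v ∈ Finset.toRight I ∨ v ∈ Finset.toRight J := fun v =>
      (h0 (Sum.inr v)).imp Finset.mem_toRight.2 Finset.mem_toRight.2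
    rw [map_smul, MLPoset.mul, LC.extend_basis]
    have h3 : PosetClass.union ⟦P.mirror hP (Finset.toLeft I) (Finset.toLeft J)⟧
        ⟦Q.mirror hQ (Finset.toRight I) (Finset.toRight J)⟧ =
          ⟦(union P Q).shift.mirror (union P Q).shift_positive I J⟧ :=
      Quotient.sound (union_mirror_equiv hP hQ I J)
    dsimp only
    rw [h3, ← pow_add]
    congr 2
    have h4 := card_inter_of_cover (mem_covers.1 hIJ)
    have h5 := card_inter_of_cover h1
    have h6 := card_inter_of_cover h2
    have h7 : I.card = I.toLeft.card + I.toRight.card :=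
      (Finset.card_toLeft_add_card_toRight (u := I)).symm
    have h8 : J.card = J.toLeft.card + J.toRight.card :=
      (Finset.card_toLeft_add_card_toRight (u := J)).symm
    have h9 : Fintype.card (union P Q).shift.V = Fintype.card P.V + Fintype.card Q.V := by
      rw [← Nat.card_eq_fintype_card, ← Nat.card_eq_fintype_card, ← Nat.card_eq_fintype_card]
      exact size_union P Q
    have h10 : ∀ i j : DecidableEq (union P Q).shift.V,
        (@Inter.inter _ (@Finset.instInter _ i) I J).card =
          (@Inter.inter _ (@Finset.instInter _ j) I J).card := by
      intro i j
      congr!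
    rw [h10 _ (union P Q).shift.instDecidableEqV]
    omega

end Union

theorem mirror_empty_equiv {P : LabeledPoset} (hP : P.Positive) [IsEmpty P.V]
    (I J : Finset P.V) : P.mirror hP I J ≈ empty := by
  have : IsEmpty (P.mirror hP I J).V := ⟨fun v : MirrorVertex P I J => isEmptyElim v.abs⟩
  have : IsEmpty empty.V := inferInstanceAs (IsEmpty Empty)
  exact ⟨⟨Equiv.equivOfIsEmpty _ _, fun {v} => isEmptyElim v⟩, fun v => isEmptyElim v⟩

end LabeledPoset

/-! ### The morphism property of the mirroring map. -/

/-- `Ψ` maps the class of the empty labeled poset to itself. -/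
theorem Psi_empty : Psi (LC.basis ⟦LabeledPoset.empty⟧) = LC.basis ⟦LabeledPoset.empty⟧ := by
  have : IsEmpty LabeledPoset.empty.V := inferInstanceAs (IsEmpty Empty)
  have h0 : LabeledPoset.empty.Positive := fun v => isEmptyElim v
  rw [Psi_basis _ h0, LabeledPoset.mirrorSum]
  have h : LabeledPoset.empty.covers = {(∅, ∅)} := by
    ext ⟨I, J⟩
    rw [LabeledPoset.mem_covers, Finset.mem_singleton]
    exact iff_of_true (fun v => isEmptyElim v)
      (Prod.ext (Finset.eq_empty_of_isEmpty I) (Finset.eq_empty_of_isEmpty J))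
  have h1 : (⟦LabeledPoset.empty.mirror h0 ∅ ∅⟧ : PosetClass) =
      ⟦LabeledPoset.empty⟧ := Quotient.sound (LabeledPoset.mirror_empty_equiv _ _ _)
  rw [h, Finset.sum_singleton, h1]
  simp

theorem Psi_isLCHopfMorphism : IsLCHopfMorphism MLPoset.hopf MLPoset.hopf Psi where
  map_mul := by
    refine LC.ext_basis ?_
    rintro ⟨c, d⟩
    induction c using Quotient.inductionOn with
    | h P =>
    induction d using Quotient.inductionOn with
    | h Q =>
    have hP : (⟦P⟧ : PosetClass) = ⟦P.shift⟧ := (Quotient.sound P.shift_equiv).symm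
    have hQ : (⟦Q⟧ : PosetClass) = ⟦Q.shift⟧ := (Quotient.sound Q.shift_equiv).symm
    have hPQ : (⟦(LabeledPoset.union P.shift Q.shift).shift⟧ : PosetClass) =
      ⟦LabeledPoset.union P.shift Q.shift⟧ := Quotient.sound (LabeledPoset.shift_equiv _)
    rw [hP, hQ]
    change Psi (MLPoset.mul _) = MLPoset.mul (LC.tensorMap Psi Psi _)
    rw [LC.tensorMap_basis, Psi_basis _ P.shift_positive, Psi_basis _ Q.shift_positive,
      ← LabeledPoset.mirrorSum_union, ← Psi_basis, MLPoset.mul, LC.extend_basis, hPQ]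
    rfl
  map_comul := by
    refine LC.ext_basis fun c => ?_
    induction c using Quotient.inductionOn with
    | h P =>
    have hP : (⟦P⟧ : PosetClass) = ⟦P.shift⟧ := (Quotient.sound P.shift_equiv).symm
    rw [hP]
    change MLPoset.comul (Psi _) = LC.tensorMap Psi Psi (MLPoset.comul _)
    rw [Psi_basis _ P.shift_positive, LabeledPoset.comul_mirrorSum, MLPoset.comul,
      LC.extend_basis]
    exact (LabeledPoset.tensor_mirrorSum _).symm
  map_unit := by
    ext1
    change Psi ((1 : Scal) • LC.basis _) = (1 : Scal) • LC.basis _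
    simp only [one_smul, Psi_empty]
  map_counit := by
    refine LC.ext_basis fun c => ?_
    change Psi (LC.basis c) ⟦LabeledPoset.empty⟧ = LC.basis c ⟦LabeledPoset.empty⟧
    by_cases h : c = ⟦LabeledPoset.empty⟧
    · rw [h, Psi_empty]
    · rw [LC.basis_ne (Ne.symm h)]
      by_contra hne
      induction c using Quotient.inductionOn with
      | h P =>
      have hP : (⟦P⟧ : PosetClass) = ⟦P.shift⟧ := (Quotient.sound P.shift_equiv).symm
      rw [hP, Psi_basis _ P.shift_positive] at hne
      -- Mirroring never lowers the number of vertices, so `[∅]` can occur only in the image of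
      -- `[∅]`.
      have h1 := P.shift.size_le_of_mirrorSum P.shift_positive hne
      change Nat.card P.V ≤ Nat.card Empty at h1
      have : IsEmpty P.V := by
        rw [← Finite.card_eq_zero_iff]
        simpa using h1
      have : IsEmpty LabeledPoset.empty.V := inferInstanceAs (IsEmpty Empty)
      exact h (Quotient.sound ⟨⟨Equiv.equivOfIsEmpty _ _, fun {v} => isEmptyElim v⟩,
        fun v => isEmptyElim v⟩)

/-! ### Generating functions and disjoint decompositions. -/

/-- The index type may be infinite, as for the words below. Choosing a point in each nonempty piece
embeds the indices that matter into the finite union. -/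
theorem finsum_mem_iUnion_of_finite {α ι M : Type*} [AddCommMonoid M] {t : ι → Set α} (f : α → M)
    (h : Pairwise (Function.onFun Disjoint t)) (hfin : (⋃ i, t i).Finite) :
    ∑ᶠ a ∈ ⋃ i, t i, f a = ∑ᶠ i, ∑ᶠ a ∈ t i, f a := by
  let I : Set ι := {i | (t i).Nonempty}
  have hI : I.Finite := by
    choose g hg using fun i : I => i.2
    have := hfin.to_subtype
    refine Set.finite_coe_iff.1 (Finite.of_injective
      (fun i : I => (⟨g i, Set.mem_iUnion.2 ⟨i, hg i⟩⟩ : (⋃ i, t i : Set α))) ?_)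
    intro i j hij
    by_contra hne
    have hij : g i = g j := Subtype.ext_iff.1 hij
    exact Set.disjoint_left.1 (h (Subtype.coe_injective.ne hne)) (hg i) (by rw [hij]; exact hg j)
  have hU : ⋃ i, t i = ⋃ i ∈ I, t i := by
    ext a
    simp only [Set.mem_iUnion]
    exact ⟨fun ⟨i, hi⟩ => ⟨i, ⟨a, hi⟩, hi⟩, fun ⟨i, _, hi⟩ => ⟨i, hi⟩⟩
  rw [hU, finsum_mem_biUnion (fun i _ j _ hij => h hij) hI
    fun i _ => hfin.subset (Set.subset_iUnion t i)]
  refine finsum_congr fun i => ?_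
  by_cases hi : i ∈ I
  · simp [hi]
  · rw [Set.not_nonempty_iff_eq_empty.1 hi]
    simp

section GenFun

variable {A B L L' : Type} [Fintype A] [Fintype B]

/-- Every letter used has its absolute value in the support of `m`, which leaves finitely many
letters. -/
theorem finite_mapWeight_eq (abs : L → ℕ+) (habs : ∀ n, {l | abs l = n}.Finite) (m : ℕ+ →₀ ℕ) :
    {σ : A → Finset L | mapWeight abs σ = m}.Finite := by
  classical
  have hU : {l | abs l ∈ m.support}.Finite := by
    refine (m.support.finite_toSet.biUnion fun n _ => habs n).subset fun l hl => ?_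
    exact Set.mem_biUnion (Finset.mem_coe.2 hl) rfl
  refine (Set.Finite.pi' (t := fun _ : A => {S | S ∈ hU.toFinset.powerset})
    fun _ => Finset.finite_toSet _).subset ?_
  rintro σ rfl s
  simp only [Set.mem_ofPred_eq, Finset.mem_powerset]
  intro l hl
  simpa using abs_mem_support abs σ s hl

/-- A generating function is the sum of the generating functions of the parts of a partition. -/
theorem genFun_iUnion {ι : Type*} {A' : ι → Type} [∀ i, Fintype (A' i)] (abs : L → ℕ+)
    (abs' : L' → ℕ+) (habs : ∀ n, {l | abs l = n}.Finite) {𝒜 : Set (A → Finset L)}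
    {ℬ : ∀ i, Set (A' i → Finset L')} (F : ∀ i, (A' i → Finset L') → A → Finset L) (c : ι → ℕ)
    (hmem : ∀ σ, σ ∈ 𝒜 ↔ ∃ i, ∃ τ ∈ ℬ i, F i τ = σ) (hinj : ∀ i, Set.InjOn (F i) (ℬ i))
    (hdisj : ∀ i j, ∀ τ ∈ ℬ i, ∀ τ' ∈ ℬ j, F i τ = F j τ' → i = j)
    (hw : ∀ i, ∀ τ ∈ ℬ i, mapWeight abs (F i τ) = mapWeight abs' τ)
    (hl : ∀ i, ∀ τ ∈ ℬ i, mapLength (F i τ) - Fintype.card A =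
      c i + (mapLength τ - Fintype.card (A' i))) (m : ℕ+ →₀ ℕ) :
    genFun abs 𝒜 m = ∑ᶠ i, beta ^ c i * genFun abs' (ℬ i) m := by
  have hU : {σ | σ ∈ 𝒜 ∧ mapWeight abs σ = m} =
      ⋃ i, F i '' {τ | τ ∈ ℬ i ∧ mapWeight abs' τ = m} := by
    ext σ
    simp only [Set.mem_ofPred_eq, Set.mem_iUnion, Set.mem_image, hmem]
    constructor
    · rintro ⟨⟨i, τ, hτ, rfl⟩, h⟩
      exact ⟨i, τ, ⟨hτ, (hw i τ hτ).symm.trans h⟩, rfl⟩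
    · rintro ⟨i, τ, ⟨hτ, h⟩, rfl⟩
      exact ⟨⟨i, τ, hτ, rfl⟩, (hw i τ hτ).trans h⟩
  have hfin : {σ | σ ∈ 𝒜 ∧ mapWeight abs σ = m}.Finite :=
    (finite_mapWeight_eq abs habs m).subset fun σ hσ => hσ.2
  rw [hU] at hfin
  rw [genFun, hU, finsum_mem_iUnion_of_finite _ ?_ hfin]
  · refine finsum_congr fun i => ?_
    have hi : Set.InjOn (F i) {τ | τ ∈ ℬ i ∧ mapWeight abs' τ = m} :=
      (hinj i).mono fun _ h => h.1
    rw [finsum_mem_image hi, genFun, mul_finsum_mem]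
    exact finsum_mem_congr rfl fun τ hτ => by rw [hl i τ hτ.1, pow_add]
  · intro i j hij
    rw [Function.onFun, Set.disjoint_left]
    rintro _ ⟨τ, hτ, rfl⟩ ⟨τ', hτ', h⟩
    exact hij (hdisj i j τ hτ.1 τ' hτ'.1 h.symm)

open Classical in
/-- The map `a ↦ ⋃ e_b(τ(b))`, over the `b` with `π(b) = a`. -/
noncomputable def pushforward (π : B → A) (e : B → L' → L) (τ : B → Finset L') (a : A) :
    Finset L :=
  (Finset.univ.filter fun b => π b = a).biUnion fun b => (τ b).image (e b)

omit [Fintype A] in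
theorem mem_pushforward {π : B → A} {e : B → L' → L} {τ : B → Finset L'} {a : A} {l : L} :
    l ∈ pushforward π e τ a ↔ ∃ b, π b = a ∧ ∃ i ∈ τ b, e b i = l := by
  simp [pushforward]

variable {π : B → A} {e : B → L' → L} {τ : B → Finset L'}

/-- Letters merged at the same place stay distinct, so no term is lost in the union. The cases of
interest are `g l = single (abs l) 1` for weights and `g = 1` for lengths. -/
theorem sum_pushforward {M : Type*} [AddCommMonoid M] (g : L → M)
    (hinj : ∀ b, Function.Injective (e b))
    (hdisj : ∀ b b', b ≠ b' → π b = π b' → ∀ i ∈ τ b, ∀ j ∈ τ b', e b i ≠ e b' j) :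
    ∑ a, ∑ l ∈ pushforward π e τ a, g l = ∑ b, ∑ i ∈ τ b, g (e b i) := by
  classical
  rw [← Finset.sum_fiberwise Finset.univ π]
  refine Finset.sum_congr rfl fun a _ => ?_
  rw [pushforward, Finset.sum_biUnion]
  · refine Finset.sum_congr (by congr) fun b _ => ?_
    rw [Finset.sum_image (hinj b).injOn]
  · intro b hb b' hb' hne
    rw [Function.onFun, Finset.disjoint_left]
    intro l hl hl'
    obtain ⟨i, hi, rfl⟩ := Finset.mem_image.1 hl
    obtain ⟨j, hj, h⟩ := Finset.mem_image.1 hl'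
    simp only [Finset.coe_filter, Finset.mem_univ, true_and, Set.mem_ofPred_eq] at hb hb'
    exact hdisj b b' hne (hb.trans hb'.symm) i hi j hj h.symm

theorem mapWeight_pushforward (abs : L → ℕ+) (abs' : L' → ℕ+) (he : ∀ b i, abs (e b i) = abs' i)
    (hinj : ∀ b, Function.Injective (e b))
    (hdisj : ∀ b b', b ≠ b' → π b = π b' → ∀ i ∈ τ b, ∀ j ∈ τ b', e b i ≠ e b' j) :
    mapWeight abs (pushforward π e τ) = mapWeight abs' τ := by
  simp only [mapWeight, setWeight]
  rw [sum_pushforward _ hinj hdisj]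
  simp only [he]

theorem mapLength_pushforward (hinj : ∀ b, Function.Injective (e b))
    (hdisj : ∀ b b', b ≠ b' → π b = π b' → ∀ i ∈ τ b, ∀ j ∈ τ b', e b i ≠ e b' j) :
    mapLength (pushforward π e τ) = mapLength τ := by
  simp only [mapLength, Finset.card_eq_sum_ones]
  rw [sum_pushforward (fun _ => 1) hinj hdisj]

theorem card_le_mapLength {σ : A → Finset L} (h : ∀ s, (σ s).Nonempty) :
    Fintype.card A ≤ mapLength σ := by
  rw [mapLength, Fintype.card_eq_sum_ones]
  exact Finset.sum_le_sum fun s _ => (h s).card_pos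

end GenFun

/-- The relation between the letters at the ends of a covering relation with increasing
(`asc`) or decreasing (`desc`) labels. -/
theorem setLE_and_iff {L : Type} [LinearOrder L] {S T : Finset L} {asc desc : Prop}
    {primed : L → Prop} :
    (SetLE S T ∧ (asc → ∀ l ∈ S ∩ T, ¬ primed l) ∧ (desc → ∀ l ∈ S ∩ T, primed l)) ↔
      ∀ a ∈ S, ∀ b ∈ T, a ≤ b ∧ (a = b → (asc → ¬ primed a) ∧ (desc → primed a)) := by
  simp only [SetLE, Finset.mem_inter]
  constructor
  · rintro ⟨h1, h2, h3⟩ a ha b hb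
    refine ⟨h1 a ha b hb, ?_⟩
    rintro rfl
    exact ⟨fun h => h2 h a ⟨ha, hb⟩, fun h => h3 h a ⟨ha, hb⟩⟩
  · intro h
    exact ⟨fun a ha b hb => (h a ha b hb).1, fun h' l hl => ((h l hl.1 l hl.2).2 rfl).1 h',
      fun h' l hl => ((h l hl.1 l hl.2).2 rfl).2 h'⟩

theorem setLE_setLT_iff {L : Type} [LinearOrder L] {S T : Finset L} {desc : Prop} :
    (SetLE S T ∧ (desc → SetLT S T)) ↔ ∀ a ∈ S, ∀ b ∈ T, a ≤ b ∧ (desc → a < b) :=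
  ⟨fun h a ha b hb => ⟨h.1 a ha b hb, fun h' => h.2 h' a ha b hb⟩,
    fun h => ⟨fun a ha b hb => (h a ha b hb).1, fun h' a ha b hb => (h a ha b hb).2 h'⟩⟩

theorem Marked.finite_abs_eq (n : ℕ+) : {l | Marked.abs l = n}.Finite := by
  refine (Set.finite_range fun b : Bool => (toLex (n, b) : Marked)).subset ?_
  rintro l rfl
  exact ⟨(ofLex l).2, rfl⟩

/-! ### Expansion of the enriched enumerator over mirrored posets. -/

namespace LabeledPoset

section Expansion

variable {P : LabeledPoset}

/-- The letter `i` or `i'`, according to the sign of the vertex. -/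
def MirrorVertex.letter {I J : Finset P.V} (v : MirrorVertex P I J) (i : ℕ+) : Marked :=
  toLex (i, decide (v.sign = 1))

theorem MirrorVertex.letter_injective {I J : Finset P.V} (v : MirrorVertex P I J) :
    Function.Injective v.letter := fun _ _ h => (Prod.ext_iff.1 (toLex.injective h)).1

theorem MirrorVertex.eq_of_letter_eq {I J : Finset P.V} {v w : MirrorVertex P I J} {i j : ℕ+}
    (h : v.letter i = w.letter j) (habs : v.abs = w.abs) : v = w := by
  have h1 := (Prod.ext_iff.1 (toLex.injective h)).2
  refine MirrorVertex.ext habs ?_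
  rcases Int.units_eq_one_or v.sign with h2 | h2 <;>
    rcases Int.units_eq_one_or w.sign with h3 | h3 <;> simp [h2, h3] at h1 ⊢

/-- The local reason for the expansion. If `i ≠ j`, both sides say `i < j`. If `i = j`, compare by
signs: equal unprimed letters need an ascent of labels; equal primed letters need a descent, which
is an ascent after negation; `i` before `i'` is never allowed, and correspondingly a positive label
exceeds a negative one; `i'` before `i` is always allowed. -/
theorem letter_condition_iff {I J : Finset P.V} (hP : P.Positive) (v w : MirrorVertex P I J)
    (hvw : v.abs ≠ w.abs) (i j : ℕ+) :
    (v.letter i ≤ w.letter j ∧ (v.letter i = w.letter j →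
      (P.label v.abs < P.label w.abs → ¬ (v.letter i).IsPrimed) ∧
        (P.label v.abs > P.label w.abs → (v.letter i).IsPrimed))) ↔
      (i ≤ j ∧ ((v.sign : ℤ) * P.label v.abs > w.sign * P.label w.abs → i < j)) := by
  have h1 := hP v.abs
  have h2 := hP w.abs
  have h3 : P.label v.abs ≠ P.label w.abs := fun h => hvw (P.label_inj h)
  have h4 : ∀ x y : ℤ, 0 < x → 0 < y → ¬ (x < - y) := fun x y _ _ => by omega
  have h5 : ∀ x y : ℤ, 0 < x → 0 < y → - x < y := fun x y _ _ => by omega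
  simp only [MirrorVertex.letter, Marked.IsPrimed, Prod.Lex.toLex_le_toLex, ofLex_toLex,
    EmbeddingLike.apply_eq_iff_eq, Prod.mk.injEq]
  rcases Int.units_eq_one_or v.sign with hv | hv <;>
    rcases Int.units_eq_one_or w.sign with hw | hw <;>
    simp only [hv, hw, Units.val_one, Units.val_neg, one_mul, neg_mul, gt_iff_lt, neg_lt_neg_iff]
  · rcases lt_trichotomy i j with h | h | h
    · simp [h, h.le, h.ne]
    · subst h
      rcases lt_or_gt_of_ne h3 with h | h <;> simp [h, h.le]
    · simp [h.not_gt, h.ne', h.not_ge]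
  · rcases lt_trichotomy i j with h | h | h
    · simp [h, h.le, h.ne]
    · subst h
      simp [h5 _ _ h2 h1]
    · simp [h.not_gt, h.ne', h.not_ge]
  · rcases lt_trichotomy i j with h | h | h
    · simp [h, h.le, h.ne]
    · subst h
      simp [h4 _ _ h2 h1]
    · simp [h.not_gt, h.ne', h.not_ge]
  · rcases lt_trichotomy i j with h | h | h
    · simp [h, h.le, h.ne]
    · subst h
      rcases lt_or_gt_of_ne h3 with h | h <;> simp [h, h.le]
    · simp [h.not_gt, h.ne', h.not_ge]

theorem card_mirrorVertex {I J : Finset P.V} :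
    Fintype.card (MirrorVertex P I J) = I.card + J.card := by
  have h := card_parts (Finset.univ : Finset (MirrorVertex P I J))
  have h1 : signedSet I J I J = Finset.univ := Finset.eq_univ_of_forall fun v =>
    mem_signedSet.2 ⟨v.mem_of_pos, v.mem_of_neg⟩
  rwa [← h1, posPart_signedSet Finset.Subset.rfl, negPart_signedSet Finset.Subset.rfl, h1,
    Finset.card_univ] at h

theorem mirror_covBy_iff {I J : Finset P.V} (h : (I, J) ∈ P.covers) {v w : MirrorVertex P I J} :
    v ⋖ w ↔ v.abs ⋖ w.abs :=
  ⟨mirror_covBy (by simpa [covers] using h), fun hc => ⟨hc.1, fun _ h1 h2 => hc.2 h1 h2⟩⟩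

/-- The enriched map combining the values of a set-valued map at `v` and `-v`. -/
noncomputable def combine {I J : Finset P.V} (τ : MirrorVertex P I J → Finset ℕ+) :
    P.V → Finset Marked :=
  pushforward MirrorVertex.abs MirrorVertex.letter τ

/-- The mark of a letter records the sign of the vertex it came from, so `τ` can be read off from
`combine τ`. -/
theorem letter_mem_combine {I J : Finset P.V} {τ : MirrorVertex P I J → Finset ℕ+}
    {v : MirrorVertex P I J} {i : ℕ+} : v.letter i ∈ combine τ v.abs ↔ i ∈ τ v := by
  rw [combine, mem_pushforward]
  constructor
  · rintro ⟨w, hw, j, hj, h⟩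
    obtain rfl := MirrorVertex.eq_of_letter_eq h hw
    exact MirrorVertex.letter_injective _ h ▸ hj
  · intro h
    exact ⟨v, rfl, i, h, rfl⟩

/-- Covers in the mirrored poset are the pairs lying over covers in `P`, so both conditions compare
the same pairs of letters and `letter_condition_iff` applies to each. -/
theorem combine_mem_enriched (hP : P.Positive) {I J : Finset P.V} (h : (I, J) ∈ P.covers)
    (τ : MirrorVertex P I J → Finset ℕ+) (hτ : ∀ v, (τ v).Nonempty) :
    combine τ ∈ (MarkedPoset.ofLabeledPoset P).enriched ↔ τ ∈ (P.mirror hP I J).setValued := by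
  have hne : ∀ s, (combine τ s).Nonempty := by
    intro s
    rcases mem_covers.1 h s with hs | hs
    · let v : MirrorVertex P I J := ⟨s, 1, fun _ => hs, by simp⟩
      obtain ⟨i, hi⟩ := hτ v
      exact ⟨_, (letter_mem_combine (v := v)).2 hi⟩
    · let v : MirrorVertex P I J := ⟨s, -1, by simp, fun _ => hs⟩
      obtain ⟨i, hi⟩ := hτ v
      exact ⟨_, (letter_mem_combine (v := v)).2 hi⟩
  have hL : combine τ ∈ (MarkedPoset.ofLabeledPoset P).enriched ↔ ∀ s t, s ⋖ t →
      SetLE (combine τ s) (combine τ t) ∧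
        (P.label s < P.label t → ∀ l ∈ combine τ s ∩ combine τ t, ¬ Marked.IsPrimed l) ∧
        (P.label s > P.label t → ∀ l ∈ combine τ s ∩ combine τ t, Marked.IsPrimed l) :=
    ⟨fun h => h.2.1, fun h => ⟨hne, h, fun _ h => h.elim⟩⟩
  have hR : τ ∈ (P.mirror hP I J).setValued ↔ ∀ v w : MirrorVertex P I J, v ⋖ w →
      SetLE (τ v) (τ w) ∧ ((v.sign : ℤ) * P.label v.abs > w.sign * P.label w.abs →
        SetLT (τ v) (τ w)) := ⟨fun h => h.2, fun h => ⟨hτ, h⟩⟩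
  rw [hL, hR]
  constructor
  · intro hσ v w hvw
    rw [setLE_setLT_iff]
    intro i hi j hj
    have hc := (mirror_covBy_iff h).1 hvw
    exact (letter_condition_iff hP v w hc.1.ne i j).1 (setLE_and_iff.1 (hσ _ _ hc) _
      (letter_mem_combine.2 hi) _ (letter_mem_combine.2 hj))
  · intro h1 s t hst
    rw [setLE_and_iff]
    intro a ha b hb
    rw [combine, mem_pushforward] at ha hb
    obtain ⟨v, rfl, i, hi, rfl⟩ := ha
    obtain ⟨w, rfl, j, hj, rfl⟩ := hb
    exact (letter_condition_iff hP v w hst.1.ne i j).2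
      (setLE_setLT_iff.1 (h1 v w ((mirror_covBy_iff h).2 hst)) i hi j hj)

open Classical in
/-- The vertices that `σ` maps to a set with an unprimed letter. -/
noncomputable def unprimedSupport (σ : P.V → Finset Marked) : Finset P.V :=
  Finset.univ.filter fun s => ∃ i, toLex (i, true) ∈ σ s

open Classical in
/-- The vertices that `σ` maps to a set with a primed letter. -/
noncomputable def primedSupport (σ : P.V → Finset Marked) : Finset P.V :=
  Finset.univ.filter fun s => ∃ i, toLex (i, false) ∈ σ s

theorem mem_unprimedSupport {σ : P.V → Finset Marked} {s : P.V} :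
    s ∈ unprimedSupport σ ↔ ∃ i, toLex (i, true) ∈ σ s := by
  simp [unprimedSupport]

theorem mem_primedSupport {σ : P.V → Finset Marked} {s : P.V} :
    s ∈ primedSupport σ ↔ ∃ i, toLex (i, false) ∈ σ s := by
  simp [primedSupport]

/-- Take for `I` and `J` the vertices carrying an unprimed and a primed letter. This is the choice
that makes all the values of `τ` nonempty. -/
theorem exists_combine_eq (σ : P.V → Finset Marked) (hσ : ∀ s, (σ s).Nonempty) :
    ∃ I J, (I, J) ∈ P.covers ∧ ∃ τ : MirrorVertex P I J → Finset ℕ+,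
      (∀ v, (τ v).Nonempty) ∧ combine τ = σ := by
  have hcov : ∀ s, ∀ l ∈ σ s, (l = toLex ((ofLex l).1, true) ∧ s ∈ unprimedSupport σ) ∨
      (l = toLex ((ofLex l).1, false) ∧ s ∈ primedSupport σ) := by
    intro s l hl
    rcases hb : (ofLex l).2 with _ | _
    · have h : l = toLex ((ofLex l).1, false) := by rw [← hb]; rfl
      exact Or.inr ⟨h, mem_primedSupport.2 ⟨_, h ▸ hl⟩⟩
    · have h : l = toLex ((ofLex l).1, true) := by rw [← hb]; rfl
      exact Or.inl ⟨h, mem_unprimedSupport.2 ⟨_, h ▸ hl⟩⟩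
  refine ⟨unprimedSupport σ, primedSupport σ, mem_covers.2 fun s => ?_,
    fun v => (σ v.abs).preimage v.letter v.letter_injective.injOn, fun v => ?_, ?_⟩
  · obtain ⟨l, hl⟩ := hσ s
    exact (hcov s l hl).imp (fun h => h.2) (fun h => h.2)
  · rcases Int.units_eq_one_or v.sign with h | h
    · obtain ⟨i, hi⟩ := mem_unprimedSupport.1 (v.mem_of_pos h)
      exact ⟨i, by simpa [MirrorVertex.letter, h] using hi⟩
    · obtain ⟨i, hi⟩ := mem_primedSupport.1 (v.mem_of_neg h)
      exact ⟨i, by simpa [MirrorVertex.letter, h] using hi⟩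
  · funext s
    ext l
    rw [combine, mem_pushforward]
    constructor
    · rintro ⟨v, rfl, i, hi, rfl⟩
      exact Finset.mem_preimage.1 hi
    · intro hl
      rcases hcov s l hl with ⟨h, hs⟩ | ⟨h, hs⟩
      · refine ⟨⟨s, 1, fun _ => hs, by simp⟩, rfl, (ofLex l).1, ?_, ?_⟩
        · rw [Finset.mem_preimage]
          simpa [MirrorVertex.letter, ← h] using hl
        · simpa [MirrorVertex.letter] using h.symm
      · refine ⟨⟨s, -1, by simp, fun _ => hs⟩, rfl, (ofLex l).1, ?_, ?_⟩
        · rw [Finset.mem_preimage]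
          simpa [MirrorVertex.letter, ← h] using hl
        · simpa [MirrorVertex.letter] using h.symm

/-- Since `τ` has nonempty values, `I` and `J` are recovered from `combine τ`; hence the families
for different `(I, J)` are disjoint. -/
theorem supports_combine {I J : Finset P.V} (τ : MirrorVertex P I J → Finset ℕ+)
    (hτ : ∀ v, (τ v).Nonempty) :
    unprimedSupport (combine τ) = I ∧ primedSupport (combine τ) = J := by
  constructor
  · ext s
    rw [mem_unprimedSupport]
    constructor
    · rintro ⟨i, hi⟩
      rw [combine, mem_pushforward] at hi
      obtain ⟨v, rfl, j, hj, h⟩ := hi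
      have h1 := (Prod.ext_iff.1 (toLex.injective h)).2
      exact v.mem_of_pos (by simpa using h1)
    · intro hs
      let v : MirrorVertex P I J := ⟨s, 1, fun _ => hs, by simp⟩
      obtain ⟨i, hi⟩ := hτ v
      exact ⟨i, by simpa [MirrorVertex.letter, v] using (letter_mem_combine (v := v)).2 hi⟩
  · ext s
    rw [mem_primedSupport]
    constructor
    · rintro ⟨i, hi⟩
      rw [combine, mem_pushforward] at hi
      obtain ⟨v, rfl, j, hj, h⟩ := hi
      have h1 := (Prod.ext_iff.1 (toLex.injective h)).2
      exact v.mem_of_neg ((Int.units_eq_one_or v.sign).resolve_left (by simpa using h1))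
    · intro hs
      let v : MirrorVertex P I J := ⟨s, -1, by simp, fun _ => hs⟩
      obtain ⟨i, hi⟩ := hτ v
      exact ⟨i, by simpa [MirrorVertex.letter, v] using (letter_mem_combine (v := v)).2 hi⟩

/-- The factor `β^|I ∩ J|` compensates for the larger vertex set: `|I| + |J| = |P| + |I ∩ J|`. -/
theorem mapLength_combine {I J : Finset P.V} (h : (I, J) ∈ P.covers)
    (τ : MirrorVertex P I J → Finset ℕ+) (hτ : ∀ v, (τ v).Nonempty) :
    mapLength (combine τ) - Fintype.card P.V =
      (I ∩ J).card + (mapLength τ - Fintype.card (MirrorVertex P I J)) := by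
  have h1 : mapLength (combine τ) = mapLength τ :=
    mapLength_pushforward MirrorVertex.letter_injective
      fun b b' hb habs i _ j _ h => hb (MirrorVertex.eq_of_letter_eq h habs)
  have h2 := card_le_mapLength hτ
  have h3 := card_inter_of_cover (mem_covers.1 h)
  have h4 : Fintype.card (MirrorVertex P I J) = I.card + J.card := card_mirrorVertex
  omega

/-- The expansion of the enriched weight enumerator. -/
theorem Omega_eq_sum (hP : P.Positive) :
    Omega P = ∑ p ∈ P.covers, beta ^ (p.1 ∩ p.2).card • Gam (P.mirror hP p.1 p.2) := by
  refine Subtype.ext (funext fun m => ?_)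
  have hne : ∀ {I J} {τ : MirrorVertex P I J → Finset ℕ+}, τ ∈ (P.mirror hP I J).setValued →
    ∀ v, (τ v).Nonempty := fun h => h.1
  have hdisj : ∀ {I J} {τ : MirrorVertex P I J → Finset ℕ+} (b b' : MirrorVertex P I J), b ≠ b' →
      b.abs = b'.abs → ∀ i ∈ τ b, ∀ j ∈ τ b', b.letter i ≠ b'.letter j :=
    fun b b' hb habs i _ j _ h => hb (MirrorVertex.eq_of_letter_eq h habs)
  have key := genFun_iUnion (ι := {p // p ∈ P.covers})
    (A' := fun p => MirrorVertex P p.1.1 p.1.2) Marked.abs id Marked.finite_abs_eq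
    (𝒜 := (MarkedPoset.ofLabeledPoset P).enriched)
    (ℬ := fun p => (P.mirror hP p.1.1 p.1.2).setValued) (fun p τ => combine τ)
    (fun p => (p.1.1 ∩ p.1.2).card) ?_ ?_ ?_ ?_ ?_ m
  · refine key.trans ?_
    rw [finsum_eq_sum_of_fintype]
    refine (Finset.sum_coe_sort P.covers (fun p => beta ^ (p.1 ∩ p.2).card *
      genFun id (P.mirror hP p.1 p.2).setValued m)).trans ?_
    rw [Submodule.coe_sum]
    exact (Finset.sum_apply (M := fun _ => Scal) m P.covers fun p => ((beta ^ (p.1 ∩ p.2).card •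
      Gam (P.mirror hP p.1 p.2) : MQSym) : MvPowerSeries ℕ+ Scal)).symm
  · intro σ
    constructor
    · intro hσ
      obtain ⟨I, J, hIJ, τ, hτ, rfl⟩ := exists_combine_eq σ hσ.1
      exact ⟨⟨(I, J), hIJ⟩, τ, (combine_mem_enriched hP hIJ τ hτ).1 hσ, rfl⟩
    · rintro ⟨⟨⟨I, J⟩, hIJ⟩, τ, hτ, rfl⟩
      exact (combine_mem_enriched hP hIJ τ (hne hτ)).2 hτ
  · intro p τ _ τ' _ h
    funext v
    ext i
    rw [← letter_mem_combine, ← letter_mem_combine]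
    exact iff_of_eq (congrArg (fun σ : P.V → Finset Marked => v.letter i ∈ σ v.abs) h)
  · rintro ⟨⟨I, J⟩, hp⟩ ⟨⟨I', J'⟩, hp'⟩ τ hτ τ' hτ' h
    have h1 := supports_combine τ (hne hτ)
    have h2 := supports_combine τ' (hne hτ')
    have h3 : combine τ = combine τ' := h
    rw [h3] at h1
    exact Subtype.ext (Prod.ext (h1.1.symm.trans h2.1) (h1.2.symm.trans h2.2))
  · intro p τ _
    exact mapWeight_pushforward (A := P.V) (B := MirrorVertex P p.1.1 p.1.2) _ _ (fun _ _ => rfl) MirrorVertex.letter_injective hdisj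
  · intro p τ hτ
    exact mapLength_combine p.2 τ (hne hτ)

theorem PhiLt_basis (P : LabeledPoset) : PhiLt (LC.basis ⟦P⟧) = Gam P :=
  MQSym.extend_basis _ _ _

theorem PhiEnriched_toPlus_basis (P : LabeledPoset) :
    PhiEnriched (MLPoset.toPlus (LC.basis ⟦P⟧)) = Omega P := by
  rw [MLPoset.toPlus, LC.extend_basis, PhiEnriched, MQSym.extend_basis]
  rfl

theorem PhiLt_comp_Psi : PhiLt ∘L Psi = PhiEnriched ∘L MLPoset.toPlus := by
  refine LC.ext_basis fun c => ?_
  induction c using Quotient.inductionOn with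
  | h P =>
  have hP : (⟦P⟧ : PosetClass) = ⟦P.shift⟧ := (Quotient.sound P.shift_equiv).symm
  rw [hP, ContinuousLinearMap.comp_apply, ContinuousLinearMap.comp_apply,
    PhiEnriched_toPlus_basis, Psi_basis _ P.shift_positive, Omega_eq_sum P.shift_positive,
    mirrorSum, map_sum]
  exact Finset.sum_congr rfl fun p _ => by rw [map_smul, PhiLt_basis]

end Expansion

end LabeledPoset

/-! ### Inversion of unitriangular continuous maps. -/

namespace LC

theorem apply_eq_finsum {S T : Type*} (F : LC S →L[Scal] LC T) (x : LC S) (t : T) :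
    F x t = ∑ᶠ s, x s * F (basis s) t := by
  have h : F = extend (fun s => F (basis s)) (finite_coord F) :=
    ext_basis fun s => (extend_basis (fun s => F (basis s)) _ s).symm
  conv_lhs => rw [h]
  rfl

/-- A continuous endomorphism of `LC S` that is unitriangular is invertible. -/
theorem exists_inverse_of_triangular {S : Type*} (rk : S → ℕ) (F : LC S →L[Scal] LC S)
    (h1 : ∀ t, F (basis t) t = 1) (h0 : ∀ s t, s ≠ t → F (basis s) t ≠ 0 → rk s < rk t) :
    ∃ G : LC S →L[Scal] LC S, (∀ x, F (G x) = x) ∧ ∀ x, G (F x) = x := by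
  -- `E` strictly raises the rank, so `∑ E^k` is a finite sum in each coordinate, and it inverts `1
  -- - E = F`.
  set E : LC S →L[Scal] LC S := 1 - F with hE
  have hF : F = 1 - E := by rw [hE, sub_sub_cancel]
  -- The coordinate of `E x` at `t` depends only on the coordinates of `x` of smaller rank.
  have hlocal : ∀ (x : LC S) (t : S), (∀ s, rk s < rk t → x s = 0) → E x t = 0 := by
    intro x t hx
    have h2 : F x t = x t := by
      rw [apply_eq_finsum, finsum_eq_single _ t, h1, mul_one]
      intro s hs
      by_cases h3 : F (basis s) t = 0
      · rw [h3, mul_zero]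
      · rw [hx s (h0 s t hs h3), zero_mul]
    rw [hE]
    change x t - F x t = 0
    rw [h2, sub_self]
  have hpow : ∀ (k : ℕ) (x : LC S) (t : S), rk t < k → (E ^ k) x t = 0 := by
    intro k
    induction k with
    | zero => exact fun _ _ h => (Nat.not_lt_zero _ h).elim
    | succ k ih =>
      intro x t ht
      rw [pow_succ']
      exact hlocal _ _ fun s hs => ih x s (by omega)
  have hext : ∀ (n : ℕ) (x : LC S) (t : S), rk t < n →
      (∑ k ∈ Finset.range (rk t + 1), E ^ k) x t = (∑ k ∈ Finset.range n, E ^ k) x t := by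
    intro n x t ht
    rw [sum_apply, sum_apply, Finset.sum_apply,
      Finset.sum_apply]
    refine Finset.sum_subset (Finset.range_subset_range.2 ht) fun k _ hk => hpow k x t ?_
    rw [Finset.mem_range] at hk
    omega
  -- Coordinate `t` of the Neumann series stops at `k = rk t`. A truncation fixed for each
  -- coordinate keeps the map continuous.
  let G : LC S →L[Scal] LC S := ContinuousLinearMap.pi fun t =>
    (ContinuousLinearMap.proj t).comp (∑ k ∈ Finset.range (rk t + 1), E ^ k)
  have hG : ∀ x t n, rk t < n → G x t = (∑ k ∈ Finset.range n, E ^ k) x t :=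
    fun x t n ht => hext n x t ht
  refine ⟨G, fun x => funext fun t => ?_, fun x => funext fun t => ?_⟩
  -- `F` mixes coordinates, so `G` is first replaced by one truncation `Gn` that agrees with it at
  -- all ranks up to `rk t`; the geometric sum then telescopes.
  · set Gn : LC S →L[Scal] LC S := ∑ k ∈ Finset.range (rk t + 1), E ^ k with hGn
    have h2 : F (G x - Gn x) t = 0 := by
      have h3 := hlocal (G x - Gn x) t fun s hs => sub_eq_zero.2 (hG x s _ (by omega))
      have h4 : (G x - Gn x) t = 0 := sub_eq_zero.2 (hG x t _ (by omega))
      rw [hF]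
      change (G x - Gn x) t - E (G x - Gn x) t = 0
      rw [h3, h4, sub_zero]
    have h3 : F (Gn x) t = x t := by
      have h4 : F * Gn = 1 - E ^ (rk t + 1) := by
        rw [hF, hGn, mul_neg_geom_sum]
      have h5 : F (Gn x) = (F * Gn) x := rfl
      rw [h5, h4]
      change x t - (E ^ (rk t + 1)) x t = x t
      rw [hpow _ _ _ (Nat.lt_succ_self _), sub_zero]
    rw [map_sub] at h2
    exact (sub_eq_zero.1 h2).trans h3
  · rw [hG _ _ (rk t + 1) (by omega)]
    have h4 : (∑ k ∈ Finset.range (rk t + 1), E ^ k) * F = 1 - E ^ (rk t + 1) := by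
      rw [hF, geom_sum_mul_neg]
    have h5 : (∑ k ∈ Finset.range (rk t + 1), E ^ k) (F x) =
      ((∑ k ∈ Finset.range (rk t + 1), E ^ k) * F) x := rfl
    rw [h5, h4]
    change x t - (E ^ (rk t + 1)) x t = x t
    rw [hpow _ _ _ (Nat.lt_succ_self _), sub_zero]

end LC

/-! Compositions and quasisymmetric coefficients -/

namespace Composition

variable {N : ℕ} (α β : Composition N)

theorem zero_mem_boundaries : (0 : Fin (N + 1)) ∈ α.boundaries :=
  α.toCompositionAsSet.zero_mem

theorem last_mem_boundaries : Fin.last N ∈ α.boundaries :=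
  α.toCompositionAsSet.getLast_mem

variable {α β}

theorem lt_of_mem_innerSums {i : ℕ} (h : i ∈ α.innerSums) : 0 < i ∧ i < N := by
  obtain ⟨b, -, -, h1⟩ := (α.mem_innerSums_iff i).1 h
  exact h1

theorem boundaries_subset (h : α.innerSums ⊆ β.innerSums) : α.boundaries ⊆ β.boundaries := by
  intro b hb
  by_cases h0 : b = 0
  · exact h0 ▸ β.zero_mem_boundaries
  by_cases h1 : b = Fin.last N
  · exact h1 ▸ β.last_mem_boundaries
  have h2 : (b : ℕ) ∈ α.innerSums := (α.mem_innerSums_iff _).2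
    ⟨b, hb, rfl, Nat.pos_of_ne_zero fun h => h0 (Fin.ext h),
      lt_of_le_of_ne (Nat.lt_succ_iff.1 b.2) fun h => h1 (Fin.ext h)⟩
  obtain ⟨c, hc, hcb, -⟩ := (β.mem_innerSums_iff _).1 (h h2)
  rwa [Fin.ext hcb] at hc

theorem eq_of_boundaries_eq (h : α.boundaries = β.boundaries) : α = β :=
  (compositionEquiv N).injective (CompositionAsSet.ext h)

/-- More inner sums mean more boundaries, hence more blocks. Length can therefore serve as a rank
among compositions of the same number. -/
theorem length_lt_of_innerSums_subset (h : α.innerSums ⊆ β.innerSums) (hne : α ≠ β) :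
    α.length < β.length := by
  have h1 : α.boundaries ⊂ β.boundaries :=
    (boundaries_subset h).ssubset_of_ne fun h => hne (eq_of_boundaries_eq h)
  have h2 := Finset.card_lt_card h1
  rw [α.card_boundaries_eq_succ_length, β.card_boundaries_eq_succ_length] at h2
  omega

variable (α)

theorem monotone_index : Monotone α.index := by
  intro p q hpq
  by_contra h
  have h1 := α.lt_sizeUpTo_index_succ q
  have h2 := α.sizeUpTo_index_le p
  have h3 := α.monotone_sizeUpTo (show (α.index q).succ.val ≤ α.index p from not_le.1 h)
  have h4 : (p : ℕ) ≤ q := hpq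
  omega

/-- The blocks of adjacent indices differ exactly at the inner partial sums. -/
theorem index_lt_index_iff {p q : Fin N} (hpq : (q : ℕ) = p + 1) :
    α.index p < α.index q ↔ (q : ℕ) ∈ α.innerSums := by
  constructor
  · intro h
    have h1 := α.lt_sizeUpTo_index_succ p
    have h2 := α.sizeUpTo_index_le q
    have h3 := α.monotone_sizeUpTo (show (α.index p).succ.val ≤ α.index q from h)
    refine ⟨α.index q, lt_of_le_of_lt (Nat.zero_le _) (show (α.index p : ℕ) < _ from h),
      (α.index q).2, ?_⟩
    omega
  · rintro ⟨j, -, -, h3⟩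
    by_contra h
    have h4 : (α.index q : ℕ) ≤ α.index p := not_lt.1 h
    have h5 := α.lt_sizeUpTo_index_succ q
    have h6 := α.sizeUpTo_index_le p
    rcases Nat.lt_or_ge (α.index q) j with h7 | h7
    · have := α.monotone_sizeUpTo (show (α.index q).succ.val ≤ j from h7)
      omega
    · have := α.monotone_sizeUpTo (h7.trans h4)
      omega

/-- The exponent vector of `x₁^{α₁} x₂^{α₂} ⋯`. -/
noncomputable def exponent : ℕ+ →₀ ℕ :=
  ∑ r : Fin α.length, Finsupp.single (Nat.succPNat r) (α.blocksFun r)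

theorem degree_exponent : α.exponent.degree = N := by
  simp [exponent, map_sum, α.sum_blocksFun]

theorem sum_single_index :
    ∑ p : Fin N, Finsupp.single (Nat.succPNat (α.index p)) 1 = α.exponent := by
  rw [← α.blocksFinEquiv.sum_comp, Fintype.sum_sigma, exponent]
  refine Finset.sum_congr rfl fun r _ => ?_
  have h : ∀ j, α.index (α.blocksFinEquiv ⟨r, j⟩) = r := fun j => α.index_embedding r j
  simp [h]

end Composition

/-- Every monomial is equivalent to the one of a composition. -/
theorem exists_composition_coeff_eq (m : ℕ+ →₀ ℕ) :
    ∃ (N : ℕ) (α : Composition N), ∀ f : MQSym,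
      MvPowerSeries.coeff m (f : MvPowerSeries ℕ+ Scal) = MvPowerSeries.coeff α.exponent f := by
  let i := m.support.orderEmbOfFin rfl
  have hi : ∀ r, m (i r) ≠ 0 := fun r =>
    Finsupp.mem_support_iff.1 (m.support.orderEmbOfFin_mem rfl r)
  let α : Composition (List.ofFn fun r => m (i r)).sum :=
    ⟨List.ofFn fun r => m (i r), fun hx => by
      obtain ⟨r, rfl⟩ := (List.mem_ofFn' _ _).1 hx
      exact Nat.pos_of_ne_zero (hi r), rfl⟩
  have hk : α.length = m.support.card := List.length_ofFn
  have hb : ∀ r, α.blocksFun r = m (i (Fin.cast hk r)) := fun r => List.get_ofFn _ r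
  refine ⟨_, α, fun f => ?_⟩
  -- Quasisymmetry moves the variables in the support of `m`, listed increasingly, to `x₁, x₂, …`.
  have h := f.2 α.length (fun r => ⟨α.blocksFun r, α.one_le_blocksFun r⟩)
    (fun r => i (Fin.cast hk r)) (fun r => Nat.succPNat r)
    (fun r s hrs => i.strictMono hrs) (fun r s hrs => Nat.succPNat_lt_succPNat.2 hrs)
  refine Eq.trans ?_ h
  congr 1
  have h1 : ∑ r : Fin α.length, Finsupp.single (i (Fin.cast hk r)) (m (i (Fin.cast hk r))) =
      ∑ r, Finsupp.single (i r) (m (i r)) :=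
    (finCongr hk).sum_comp fun r => Finsupp.single (i r) (m (i r))
  have h2 : ∑ r, Finsupp.single (i r) (m (i r)) = ∑ n : m.support, Finsupp.single n.1 (m n) :=
    (m.support.orderIsoOfFin rfl).toEquiv.sum_comp fun n => Finsupp.single n.1 (m n)
  have h3 : ∑ n : m.support, Finsupp.single n.1 (m n) = m :=
    (Finset.sum_coe_sort m.support fun n => Finsupp.single n (m n)).trans m.sum_single
  simp only [PNat.mk_coe, hb]
  rw [h1, h2, h3]

theorem rel_of_lt_of_rel_succ {N : ℕ} {r : Fin N → Fin N → Prop}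
    (htrans : ∀ a b c, r a b → r b c → r a c) (h : ∀ p q : Fin N, (q : ℕ) = p + 1 → r p q)
    {p q : Fin N} (hpq : p < q) : r p q := by
  obtain ⟨p, hp⟩ := p
  obtain ⟨q, hq⟩ := q
  replace hpq : p < q := hpq
  induction q, hpq using Nat.le_induction with
  | base => exact h _ _ rfl
  | succ k hk ih => exact htrans _ _ _ (ih (by omega)) (h ⟨k, by omega⟩ ⟨k + 1, hq⟩ rfl)

/-- The sum records the multiset of values, and a multiset has at most one weakly increasing
enumeration. -/
theorem eq_of_monotone_of_sum_single_eq {X : Type*} [PartialOrder X] {N : ℕ} {a b : Fin N → X}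
    (ha : Monotone a) (hb : Monotone b)
    (h : ∑ p, Finsupp.single (a p) 1 = ∑ p, Finsupp.single (b p) 1) : a = b := by
  have key : ∀ c : Fin N → X, Finsupp.toMultiset (∑ p, Finsupp.single (c p) 1) =
      (List.ofFn c : Multiset X) := by
    intro c
    rw [map_sum]
    simp only [Finsupp.toMultiset_single, one_smul]
    rw [← Fin.univ_val_map, ← Multiset.sum_map_singleton (Finset.univ.val.map c),
      Multiset.map_map]
    rfl
  have h1 := congrArg Finsupp.toMultiset h
  rw [key, key, Multiset.coe_eq_coe] at h1
  exact List.ofFn_injective (h1.eq_of_sortedLE (List.sortedLE_ofFn_iff.2 ha)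
    (List.sortedLE_ofFn_iff.2 hb))

/-- The tuples whose generating function is `L^(β)_α`. -/
def fundamentalTuples {N : ℕ} (α : Composition N) : Set (Fin N → Finset ℕ+) :=
  {S | (∀ p, (S p).Nonempty) ∧ ∀ p q : Fin N, (q : ℕ) = p + 1 →
    SetLE (S p) (S q) ∧ ((q : ℕ) ∈ α.innerSums → SetLT (S p) (S q))}

theorem coe_multiFundamental {N : ℕ} (α : Composition N) :
    (multiFundamental α : MvPowerSeries ℕ+ Scal) = genFun id (fundamentalTuples α) := rfl

/-- The tuple of singletons of weight `x₁^{α₁} x₂^{α₂} ⋯`. -/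
def indexTuple {N : ℕ} (α : Composition N) (p : Fin N) : Finset ℕ+ := {Nat.succPNat (α.index p)}

theorem mapWeight_singleton {N : ℕ} (a : Fin N → ℕ+) :
    mapWeight id (fun p => ({a p} : Finset ℕ+)) = ∑ p, Finsupp.single (a p) 1 := by
  simp [mapWeight, setWeight]

/-- A tuple of weight `x₁^{δ₁} x₂^{δ₂} ⋯` and the least possible length consists of singletons. -/
theorem eq_indexTuple {N : ℕ} {α δ : Composition N} {S : Fin N → Finset ℕ+}
    (hS : S ∈ fundamentalTuples α) (hw : mapWeight id S = δ.exponent) : S = indexTuple δ := by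
  have hlen : ∑ p, (S p).card = ∑ _p : Fin N, 1 := by
    have h2 : (mapWeight id S).degree = mapLength S := by
      simp [mapWeight, mapLength, setWeight, map_sum]
    rw [hw, δ.degree_exponent] at h2
    rw [← mapLength, ← h2]
    simp
  -- There are `N` nonempty sets of total size `N`.
  have hcard : ∀ p, 1 = (S p).card := fun p =>
    (Finset.sum_eq_sum_iff_of_le fun p _ => (hS.1 p).card_pos).1 hlen.symm p (Finset.mem_univ p)
  choose a ha using fun p => Finset.card_eq_one.1 (hcard p).symm
  obtain rfl : S = fun p => {a p} := funext ha
  have hmono : Monotone a := by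
    intro p q hpq
    rcases hpq.eq_or_lt with rfl | hpq
    · exact le_rfl
    · refine rel_of_lt_of_rel_succ (r := fun p q => a p ≤ a q) (fun _ _ _ => le_trans) ?_ hpq
      intro p q hpq
      simpa [SetLE] using (hS.2 p q hpq).1
  rw [mapWeight_singleton, ← δ.sum_single_index] at hw
  have := eq_of_monotone_of_sum_single_eq hmono
    (fun p q hpq => Nat.succPNat_le_succPNat.2 (δ.monotone_index hpq)) hw
  rw [this]
  rfl

/-- The tuple of singletons steps up exactly at the inner sums of `δ`, and it must do so at those of
`α`. -/
theorem indexTuple_mem {N : ℕ} {α δ : Composition N} :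
    indexTuple δ ∈ fundamentalTuples α ↔ α.innerSums ⊆ δ.innerSums := by
  constructor
  · intro h i hi
    obtain ⟨h0, h1⟩ := Composition.lt_of_mem_innerSums hi
    have hpq : ((⟨i, h1⟩ : Fin N) : ℕ) = (⟨i - 1, by omega⟩ : Fin N) + 1 := by
      dsimp only
      omega
    refine (δ.index_lt_index_iff hpq).1 ?_
    have := (h.2 _ _ hpq).2 hi
    simpa [SetLT, indexTuple] using this
  · intro h
    refine ⟨fun p => Finset.singleton_nonempty _, fun p q hpq => ⟨?_, fun hq => ?_⟩⟩
    · have : p ≤ q := by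
        rw [Fin.le_def]
        omega
      simpa [SetLE, indexTuple] using δ.monotone_index this
    · simpa [SetLT, indexTuple] using (δ.index_lt_index_iff hpq).2 (h hq)

theorem coeff_exponent_self {N : ℕ} (α : Composition N) :
    genFun id (fundamentalTuples α) α.exponent = 1 := by
  have h : {σ | σ ∈ fundamentalTuples α ∧ mapWeight id σ = α.exponent} = {indexTuple α} := by
    ext σ
    refine ⟨fun hσ => eq_indexTuple hσ.1 hσ.2, ?_⟩
    rintro rfl
    exact ⟨indexTuple_mem.2 subset_rfl, (mapWeight_singleton _).trans α.sum_single_index⟩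
  rw [genFun, h, finsum_mem_singleton]
  simp [mapLength, indexTuple]

/-- Among compositions of the same `N`, only the tuple of singletons can contribute. This is the
triangularity of the `L_α` within one degree. -/
theorem innerSums_subset_of_coeff_ne_zero {N : ℕ} {α δ : Composition N}
    (h : genFun id (fundamentalTuples α) δ.exponent ≠ 0) : α.innerSums ⊆ δ.innerSums := by
  obtain ⟨σ, ⟨h1, h2⟩, -⟩ := exists_ne_zero_of_finsum_mem_ne_zero h
  exact indexTuple_mem.1 (eq_indexTuple h1 h2 ▸ h1)

/-- Compositions of all natural numbers. -/
abbrev AnyComposition : Type := Σ N, Composition N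

theorem AnyComposition.finite_size_le (n : ℕ) : {α : AnyComposition | α.1 ≤ n}.Finite := by
  refine ((Set.finite_Iic n).biUnion fun N _ =>
    Set.finite_range fun α : Composition N => (⟨N, α⟩ : AnyComposition)).subset ?_
  rintro ⟨N, α⟩ h
  simp only [Set.mem_iUnion]
  exact ⟨N, h, α, rfl⟩

/-- The continuous linear map with `α ↦ L^(β)_α`. -/
noncomputable def fundamentalMap : LC AnyComposition →L[Scal] MQSym :=
  MQSym.extend (fun α => multiFundamental α.2) fun m =>
    (AnyComposition.finite_size_le m.degree).subset fun α hα => by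
      have := card_le_degree id (fundamentalTuples α.2) (fun σ hσ => hσ.1) hα
      rwa [Fintype.card_fin] at this

theorem fundamentalMap_basis (α : AnyComposition) :
    fundamentalMap (LC.basis α) = multiFundamental α.2 :=
  MQSym.extend_basis _ _ _

/-- The coefficients of the monomials `x₁^{α₁} x₂^{α₂} ⋯`. -/
noncomputable def compositionCoeff : MQSym →L[Scal] LC AnyComposition :=
  ContinuousLinearMap.pi fun α =>
    (ContinuousLinearMap.proj α.2.exponent : LC (ℕ+ →₀ ℕ) →L[Scal] Scal).comp MQSym.subtypeL

/-- By quasisymmetry, each coefficient equals one at a monomial of the form `x₁^{δ₁} x₂^{δ₂} ⋯`. -/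
theorem compositionCoeff_injective : Function.Injective compositionCoeff := by
  intro f g h
  refine Subtype.ext (MvPowerSeries.ext fun m => ?_)
  obtain ⟨N, α, hα⟩ := exists_composition_coeff_eq m
  rw [hα, hα]
  exact congrFun h ⟨N, α⟩

/-- The multifundamental quasisymmetric functions form a pseudobasis. -/
theorem exists_fundamentalMap_inverse : ∃ G : MQSym →L[Scal] LC AnyComposition,
    (∀ f, fundamentalMap (G f) = f) ∧ ∀ x, G (fundamentalMap x) = x := by
  have hT : ∀ α δ : AnyComposition, (compositionCoeff.comp fundamentalMap) (LC.basis α) δ =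
      genFun id (fundamentalTuples α.2) δ.2.exponent := by
    intro α δ
    rw [ContinuousLinearMap.comp_apply, fundamentalMap_basis]
    rfl
  obtain ⟨H, h1, h2⟩ := LC.exists_inverse_of_triangular
    -- A composition of `N` has at most `N` blocks, so this rank compares first `N` and then the
    -- length.
    (fun α : AnyComposition => α.1 * (α.1 + 1) + α.2.length)
    (compositionCoeff.comp fundamentalMap) (fun α => (hT α α).trans (coeff_exponent_self α.2))
    (by
      rintro ⟨N, α⟩ ⟨M, δ⟩ hne h
      rw [hT] at h
      dsimp only at h ⊢
      have hle := card_le_degree id (fundamentalTuples α) (fun σ hσ => hσ.1) h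
      rw [Fintype.card_fin, δ.degree_exponent] at hle
      have h3 := α.length_le
      rcases hle.eq_or_lt with rfl | hlt
      · have := Composition.length_lt_of_innerSums_subset (innerSums_subset_of_coeff_ne_zero h)
          fun h => hne (by rw [h])
        omega
      · have : (N + 1) * (N + 1) ≤ M * (M + 1) := Nat.mul_le_mul hlt (by omega)
        have : (N + 1) * (N + 1) = N * (N + 1) + (N + 1) := by ring
        omega)
  -- `H` inverts the composite of the two maps. Injectivity of `compositionCoeff` turns the
  -- resulting left inverse of `fundamentalMap` into a two-sided one.
  refine ⟨H.comp compositionCoeff, fun f => compositionCoeff_injective (h1 _), fun x => h2 x⟩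

/-! ### The peak functions depend only on the peaks. -/

namespace Marked

/-- Exchange `i` and `i'`. -/
def bar (l : Marked) : Marked := toLex ((ofLex l).1, !(ofLex l).2)

theorem abs_bar (l : Marked) : (bar l).abs = l.abs := rfl

theorem bar_bar (l : Marked) : bar (bar l) = l := by
  simp only [bar, ofLex_toLex, Bool.not_not]
  rfl

theorem isPrimed_bar (l : Marked) : (bar l).IsPrimed ↔ ¬ l.IsPrimed := by
  simp [bar, IsPrimed]

/-- The condition on letters in adjacent sets, at a descent (`d`) or an ascent. -/
def Rel (d : Prop) (a b : Marked) : Prop :=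
  a.abs < b.abs ∨ a.abs = b.abs ∧ (d → a.IsPrimed) ∧ (¬ d → ¬ b.IsPrimed)

/-- Among letters of equal absolute value, the admissible pairs at a descent are those with the left
letter primed, and at an ascent those with the right letter unprimed. So each condition constrains
one side only, which is what makes the flip below local. -/
theorem rel_iff (d : Prop) (a b : Marked) :
    (a ≤ b ∧ (a = b → (¬ d → ¬ a.IsPrimed) ∧ (d → a.IsPrimed))) ↔ Rel d a b := by
  obtain ⟨⟨i, x⟩, rfl⟩ := toLex.surjective a
  obtain ⟨⟨j, y⟩, rfl⟩ := toLex.surjective b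
  simp only [Rel, abs, IsPrimed, Prod.Lex.toLex_le_toLex, ofLex_toLex,
    EmbeddingLike.apply_eq_iff_eq, Prod.mk.injEq]
  rcases lt_trichotomy i j with h | h | h
  · simp [h, h.ne]
  · subst h
    by_cases hd : d <;> cases x <;> cases y <;> simp [hd]
  · simp [h.not_gt, h.ne']

end Marked

/-- The tuples whose generating function is `K^(β)_α`, for `D = I(α)`. -/
def peakTuples (N : ℕ) (D : Set ℕ) : Set (Fin N → Finset Marked) :=
  {S | (∀ p, (S p).Nonempty) ∧ ∀ p q : Fin N, (q : ℕ) = p + 1 → SetLE (S p) (S q) ∧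
    ((q : ℕ) ∈ D → ∀ l ∈ S p ∩ S q, Marked.IsPrimed l) ∧
    ((q : ℕ) ∉ D → ∀ l ∈ S p ∩ S q, ¬ Marked.IsPrimed l)}

theorem mem_peakTuples {N : ℕ} {D : Set ℕ} {S : Fin N → Finset Marked} :
    S ∈ peakTuples N D ↔ (∀ p, (S p).Nonempty) ∧ ∀ p q : Fin N, (q : ℕ) = p + 1 →
      ∀ a ∈ S p, ∀ b ∈ S q, Marked.Rel ((q : ℕ) ∈ D) a b := by
  refine and_congr_right fun _ => forall_congr' fun p => forall_congr' fun q =>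
    imp_congr_right fun _ => ?_
  simp only [← Marked.rel_iff]
  rw [← setLE_and_iff]
  tauto

section Flip

variable {N : ℕ} (u v : Fin N)

/-- The absolute values that occur in both of the sets with indices `u` and `v`. -/
def commonAbs (S : Fin N → Finset Marked) (i : ℕ+) : Prop :=
  (∃ a ∈ S u, a.abs = i) ∧ ∃ b ∈ S v, b.abs = i

open Classical in
/-- Exchange `i` and `i'` in the sets with indices `u` and `v`. -/
noncomputable def barAt (p : Fin N) : Marked → Marked := if p = u ∨ p = v then Marked.bar else id

theorem abs_barAt (p : Fin N) (l : Marked) : (barAt u v p l).abs = l.abs := by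
  unfold barAt
  split_ifs <;> rfl

theorem barAt_barAt (p : Fin N) (l : Marked) : barAt u v p (barAt u v p l) = l := by
  unfold barAt
  split_ifs
  · exact Marked.bar_bar l
  · rfl

theorem barAt_swap (p : Fin N) : barAt u v (Equiv.swap u v p) = barAt u v p := by
  unfold barAt
  congr 1
  rw [Equiv.swap_apply_eq_iff, Equiv.swap_apply_eq_iff]
  simp [or_comm]

theorem barAt_of_ne {p : Fin N} (hu : p ≠ u) (hv : p ≠ v) (l : Marked) : barAt u v p l = l := by
  simp [barAt, hu, hv]

open Classical in
/-- Exchange the letters with common absolute values in the sets with indices `u` and `v`,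
and exchange `i` and `i'` in them. -/
noncomputable def flipTuple (S : Fin N → Finset Marked) (p : Fin N) : Finset Marked :=
  (S p).filter (fun l => ¬ commonAbs u v S l.abs) ∪
    ((S (Equiv.swap u v p)).filter fun l => commonAbs u v S l.abs).image (barAt u v p)

variable {u v} {S : Fin N → Finset Marked}

theorem mem_flipTuple {p : Fin N} {l : Marked} : l ∈ flipTuple u v S p ↔
    (¬ commonAbs u v S l.abs ∧ l ∈ S p) ∨
      (commonAbs u v S l.abs ∧ barAt u v p l ∈ S (Equiv.swap u v p)) := by
  simp only [flipTuple, Finset.mem_union, Finset.mem_filter, Finset.mem_image]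
  refine or_congr and_comm ⟨?_, fun h => ⟨barAt u v p l, ⟨h.2, ?_⟩, barAt_barAt u v p l⟩⟩
  · rintro ⟨a, ⟨h1, h2⟩, rfl⟩
    rw [abs_barAt, barAt_barAt]
    exact ⟨h2, h1⟩
  · rw [abs_barAt]
    exact h.1

theorem mem_flipTuple_of_ne {p : Fin N} (hu : p ≠ u) (hv : p ≠ v) {l : Marked} :
    l ∈ flipTuple u v S p ↔ l ∈ S p := by
  rw [mem_flipTuple, barAt_of_ne u v hu hv, Equiv.swap_apply_of_ne_of_ne hu hv]
  tauto

theorem exists_mem_abs_swap {i : ℕ+} (hi : commonAbs u v S i) {p : Fin N}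
    (h : ∃ l ∈ S (Equiv.swap u v p), l.abs = i) : ∃ l ∈ S p, l.abs = i := by
  by_cases hu : p = u
  · exact hu ▸ hi.1
  by_cases hv : p = v
  · exact hv ▸ hi.2
  rwa [Equiv.swap_apply_of_ne_of_ne hu hv] at h

/-- Only marks change: a common absolute value is present at both indices before and after.
Consequently `commonAbs` is invariant and the flip is an involution. -/
theorem exists_mem_flipTuple_abs_iff {p : Fin N} {i : ℕ+} :
    (∃ l ∈ flipTuple u v S p, l.abs = i) ↔ ∃ l ∈ S p, l.abs = i := by
  constructor
  · rintro ⟨l, hl, rfl⟩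
    rcases mem_flipTuple.1 hl with ⟨h1, h2⟩ | ⟨h1, h2⟩
    · exact ⟨l, h2, rfl⟩
    · exact exists_mem_abs_swap h1 ⟨_, h2, abs_barAt u v p l⟩
  · rintro ⟨l, hl, rfl⟩
    by_cases h : commonAbs u v S l.abs
    · obtain ⟨a, ha, hal⟩ := exists_mem_abs_swap (p := Equiv.swap u v p) h
        ⟨l, by rwa [Equiv.swap_apply_self], rfl⟩
      refine ⟨barAt u v p a, mem_flipTuple.2 (Or.inr ?_), ?_⟩
      · rw [abs_barAt, barAt_barAt, hal]
        exact ⟨h, ha⟩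
      · rw [abs_barAt, hal]
    · exact ⟨l, mem_flipTuple.2 (Or.inl ⟨h, hl⟩), rfl⟩

theorem commonAbs_flipTuple {i : ℕ+} : commonAbs u v (flipTuple u v S) i ↔ commonAbs u v S i :=
  and_congr exists_mem_flipTuple_abs_iff exists_mem_flipTuple_abs_iff

theorem flipTuple_flipTuple (S : Fin N → Finset Marked) : flipTuple u v (flipTuple u v S) = S := by
  funext p
  ext l
  rw [mem_flipTuple, commonAbs_flipTuple, mem_flipTuple, mem_flipTuple, abs_barAt, barAt_swap, barAt_barAt,
    Equiv.swap_apply_self]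
  tauto

/-- Common letters are permuted among the indices and barred, so a bar-invariant statistic has the
same total. Used for weight and for length. -/
theorem sum_flipTuple {M : Type*} [AddCommMonoid M] (g : Marked → M) (hg : ∀ l, g l.bar = g l) :
    ∑ p, ∑ l ∈ flipTuple u v S p, g l = ∑ p, ∑ l ∈ S p, g l := by
  classical
  have h1 : ∀ p, ∑ l ∈ flipTuple u v S p, g l =
      ∑ l ∈ S p with ¬ commonAbs u v S l.abs, g l +
        ∑ l ∈ S (Equiv.swap u v p) with commonAbs u v S l.abs, g l := by
    intro p
    rw [flipTuple, Finset.sum_union, Finset.sum_image]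
    · refine congrArg₂ _ (Finset.sum_congr (by congr) fun _ _ => rfl)
        (Finset.sum_congr (by congr) fun l _ => ?_)
      unfold barAt
      split_ifs
      · exact hg l
      · rfl
    · exact (Function.LeftInverse.injective (barAt_barAt u v p)).injOn
    · rw [Finset.disjoint_left]
      intro l hl hl'
      obtain ⟨a, ha, rfl⟩ := Finset.mem_image.1 hl'
      rw [Finset.mem_filter] at ha hl
      rw [abs_barAt] at hl
      exact hl.2 ha.2
  simp only [h1]
  rw [Finset.sum_add_distrib,
    Equiv.sum_comp (Equiv.swap u v) fun p => ∑ l ∈ S p with commonAbs u v S l.abs, g l,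
    ← Finset.sum_add_distrib]
  refine Finset.sum_congr rfl fun p _ => ?_
  rw [add_comm, Finset.sum_filter_add_sum_filter_not]

/-- The flip changes the type of the step from `u` to `v`. The steps on either side survive since a
descent into `u` restricts only the letter before `u`, and an ascent out of `v` only the letter
after `v`. -/
theorem flipTuple_mem {D D' : Set ℕ} (huv : (v : ℕ) = u + 1) (hv : (v : ℕ) ∈ D ↔ (v : ℕ) ∉ D')
    (hD : ∀ q : Fin N, q ≠ v → ((q : ℕ) ∈ D ↔ (q : ℕ) ∈ D')) (hu : (u : ℕ) ≠ 0 → (u : ℕ) ∈ D)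
    (hv' : (v : ℕ) + 1 ∉ D) (hS : S ∈ peakTuples N D) : flipTuple u v S ∈ peakTuples N D' := by
  rw [mem_peakTuples] at hS ⊢
  refine ⟨fun p => ?_, fun p q hpq a ha b hb => ?_⟩
  · obtain ⟨a, ha⟩ := hS.1 p
    obtain ⟨b, hb, -⟩ := exists_mem_flipTuple_abs_iff.2 ⟨a, ha, rfl⟩
    exact ⟨b, hb⟩
  · obtain ⟨a₀, ha₀, haa⟩ := exists_mem_flipTuple_abs_iff.1 ⟨a, ha, rfl⟩
    obtain ⟨b₀, hb₀, hbb⟩ := exists_mem_flipTuple_abs_iff.1 ⟨b, hb, rfl⟩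
    have h0 := hS.2 p q hpq a₀ ha₀ b₀ hb₀
    rcases h0 with h0 | ⟨h0, -⟩
    · left
      rwa [haa, hbb] at h0
    · rw [haa, hbb] at h0
      refine Or.inr ⟨h0, ?_⟩
      by_cases hqv : q = v
      -- The step from `u` to `v`: barred and exchanged, the letters `a` and `b` come from an
      -- admissible pair `(b.bar, a.bar)`. Primed on the left at a descent becomes unprimed on the
      -- right at an ascent, and vice versa.
      · subst hqv
        obtain rfl : p = u := Fin.ext (by omega)
        have hC : commonAbs p q S a.abs := ⟨⟨a₀, ha₀, haa⟩, ⟨b₀, hb₀, hbb.trans h0.symm⟩⟩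
        have ha' := ((mem_flipTuple.1 ha).resolve_left fun h => h.1 hC).2
        have hb' := ((mem_flipTuple.1 hb).resolve_left fun h => h.1 (h0 ▸ hC)).2
        rw [Equiv.swap_apply_left] at ha'
        rw [Equiv.swap_apply_right] at hb'
        have h1 := hS.2 p q hpq _ hb' _ ha'
        have h2 : barAt p q q b = b.bar := by simp [barAt]
        have h3 : barAt p q p a = a.bar := by simp [barAt]
        rw [h2, h3, Marked.Rel, Marked.abs_bar, Marked.abs_bar, Marked.isPrimed_bar,
          Marked.isPrimed_bar, hv] at h1
        have h4 := h1.resolve_left (by rw [h0]; exact lt_irrefl _)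
        tauto
      · rw [← hD q hqv]
        by_cases hqu : q = u
        -- The step into `u`, a descent: only the unflipped letter on the left is restricted.
        · subst hqu
          have hp : p ≠ q ∧ p ≠ v := ⟨fun h => by subst h; omega, fun h => by subst h; omega⟩
          rw [mem_flipTuple_of_ne hp.1 hp.2] at ha
          have hq := hu (by omega)
          have h1 := hS.2 p q hpq a ha b₀ hb₀
          rw [Marked.Rel, hbb] at h1
          exact ⟨(h1.resolve_left (by rw [h0]; exact lt_irrefl _)).2.1, fun h => (h hq).elim⟩
        · rw [mem_flipTuple_of_ne hqu hqv] at hb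
          by_cases hpv : p = v
          -- The step out of `v`, an ascent: only the unflipped letter on the right is restricted.
          · subst hpv
            have hq : (q : ℕ) ∉ D := hpq ▸ hv'
            have h1 := hS.2 p q hpq a₀ ha₀ b hb
            rw [Marked.Rel, haa] at h1
            exact ⟨fun h => (hq h).elim, (h1.resolve_left (by rw [h0]; exact lt_irrefl _)).2.2⟩
          · have hpu : p ≠ u := fun h => hqv (Fin.ext (by subst h; omega))
            rw [mem_flipTuple_of_ne hpu hpv] at ha
            exact ((hS.2 p q hpq a ha b hb).resolve_left (by rw [h0]; exact lt_irrefl _)).2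

theorem genFun_peakTuples_flip {D D' : Set ℕ} (huv : (v : ℕ) = u + 1)
    (hv : (v : ℕ) ∈ D ↔ (v : ℕ) ∉ D') (hD : ∀ q : Fin N, q ≠ v → ((q : ℕ) ∈ D ↔ (q : ℕ) ∈ D'))
    (hu : (u : ℕ) ≠ 0 → (u : ℕ) ∈ D) (hv' : (v : ℕ) + 1 ∉ D) (hv'' : (v : ℕ) + 1 ∉ D') :
    genFun Marked.abs (peakTuples N D) = genFun Marked.abs (peakTuples N D') := by
  have hw : ∀ S : Fin N → Finset Marked,
      mapWeight Marked.abs (flipTuple u v S) = mapWeight Marked.abs S :=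
    fun S => sum_flipTuple (fun l => Finsupp.single l.abs 1) fun _ => rfl
  have hl : ∀ S : Fin N → Finset Marked, mapLength (flipTuple u v S) = mapLength S := by
    intro S
    simp only [mapLength, Finset.card_eq_sum_ones]
    exact sum_flipTuple (fun _ => 1) fun _ => rfl
  funext m
  refine finsum_mem_eq_of_bijOn (flipTuple u v) (Set.InvOn.bijOn (f' := flipTuple u v)
    ⟨fun S _ => flipTuple_flipTuple S, fun S _ => flipTuple_flipTuple S⟩ ?_ ?_) fun S _ => by rw [hl]
  · exact fun S hS => ⟨flipTuple_mem huv hv hD hu hv' hS.1, (hw S).trans hS.2⟩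
  · refine fun S hS => ⟨flipTuple_mem huv (by tauto) (fun q hq => (hD q hq).symm) (fun h => ?_) hv''
      hS.1, (hw S).trans hS.2⟩
    exact (hD u fun h => by rw [h] at huv; omega).1 (hu h)

end Flip

/-- The peaks of a descent set. -/
def peakSet (D : Set ℕ) : Set ℕ := {i | i ∈ D ∧ 1 < i ∧ i - 1 ∉ D}

/-- The generating function of the tuples depends only on the peaks. -/
theorem genFun_peakTuples_peakSet {N : ℕ} (n : ℕ) (D : Set ℕ) (hD : ∀ i ∈ D, 0 < i ∧ i < N)
    (hn : (D \ peakSet D).ncard = n) :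
    genFun Marked.abs (peakTuples N D) = genFun Marked.abs (peakTuples N (peakSet D)) := by
  have hfin : (D \ peakSet D).Finite := (Set.finite_Iio N).subset fun i hi => (hD i hi.1).2
  induction n generalizing D with
  | zero =>
    have h : D ⊆ peakSet D := Set.sdiff_eq_empty.1 ((Set.ncard_eq_zero hfin).1 hn)
    rw [← h.antisymm fun i hi => hi.1]
  | succ n ih =>
    have hne : (D \ peakSet D).Nonempty := Set.nonempty_of_ncard_ne_zero (by omega)
    -- The largest descent that is not a peak can be flipped away: either `k = 1` or `k - 1` is a
    -- descent, and `k + 1` is not, as it would be a larger non-peak.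
    obtain ⟨k, ⟨hk1, hk2⟩, hmax⟩ := Set.exists_max_image _ id hfin hne
    have hk3 : k ≤ 1 ∨ k - 1 ∈ D := by
      by_contra h
      push Not at h
      exact hk2 ⟨hk1, h⟩
    obtain ⟨hk0, hkN⟩ := hD k hk1
    have hk4 : k + 1 ∉ D := by
      intro h
      have := hmax (k + 1) ⟨h, fun h' => h'.2.2 (by simpa using hk1)⟩
      simp at this
    -- Removing `k` could create a peak only at `k + 1`, which is not a descent.
    have hpeak : peakSet (D \ {k}) = peakSet D := by
      ext i
      simp only [peakSet, Set.mem_sdiff, Set.mem_singleton_iff, Set.mem_ofPred_eq]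
      constructor
      · rintro ⟨⟨h1, h2⟩, h3, h4⟩
        refine ⟨h1, h3, fun h => ?_⟩
        have h5 : i - 1 = k := by tauto
        exact hk4 (by rwa [← h5, Nat.sub_add_cancel (by omega)])
      · rintro ⟨h1, h3, h4⟩
        refine ⟨⟨h1, ?_⟩, h3, fun h => h4 h.1⟩
        rintro rfl
        exact hk2 ⟨h1, h3, h4⟩
    have hdiff : (D \ {k}) \ peakSet (D \ {k}) = (D \ peakSet D) \ {k} := by
      rw [hpeak]
      ext i
      simp only [Set.mem_sdiff]
      tauto
    have h2 := ih (D \ {k}) (fun i hi => hD i hi.1) (by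
      rw [hdiff, Set.ncard_sdiff_singleton_of_mem (show k ∈ D \ peakSet D from ⟨hk1, hk2⟩)]
      omega) (by rw [hdiff]; exact hfin.sdiff)
    rw [hpeak] at h2
    rw [← h2]
    refine genFun_peakTuples_flip (u := ⟨k - 1, by omega⟩) (v := ⟨k, hkN⟩) ?_ ?_ ?_ ?_ hk4
      fun h => hk4 h.1
    · dsimp only
      omega
    · simp [hk1]
    · intro q hq
      have : (q : ℕ) ≠ k := fun h => hq (Fin.ext h)
      simp [this]
    · dsimp only
      intro h
      exact hk3.resolve_left (by omega)

theorem coe_multiPeak {N : ℕ} (α : Composition N) :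
    (multiPeak α : MvPowerSeries ℕ+ Scal) = genFun Marked.abs (peakTuples N α.innerSums) := rfl

/-- `K^(β)_α = K^(β)_{Λ(α)}` -/
theorem multiPeak_peak {N : ℕ} (α : Composition N) : multiPeak α.peak = multiPeak α := by
  refine Subtype.ext ?_
  rw [coe_multiPeak, coe_multiPeak, Composition.innerSums_peak]
  exact (genFun_peakTuples_peakSet _ α.innerSums (fun i => Composition.lt_of_mem_innerSums)
    rfl).symm

/-! Decomposition of a finite colored chain into monochromatic blocks -/

section Blocks

variable {K V : Type} [LinearOrder K] (col : K → V)

/-- `B` is a sequence of consecutive blocks, colored by `w`, with different adjacent colors. -/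
structure IsBlocks {N : ℕ} (w : Fin N → V) (B : Fin N → Finset K) : Prop where
  nonempty : ∀ p, (B p).Nonempty
  color : ∀ p, ∀ k ∈ B p, col k = w p
  ne : ∀ p q : Fin N, (q : ℕ) = p + 1 → w p ≠ w q
  lt : ∀ p q : Fin N, (q : ℕ) = p + 1 → ∀ a ∈ B p, ∀ b ∈ B q, a < b

variable {col}

theorem IsBlocks.lt_of_lt {N : ℕ} {w : Fin N → V} {B : Fin N → Finset K} (h : IsBlocks col w B)
    {p q : Fin N} (hpq : p < q) : ∀ a ∈ B p, ∀ b ∈ B q, a < b := by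
  refine rel_of_lt_of_rel_succ (r := fun p q => ∀ a ∈ B p, ∀ b ∈ B q, a < b) ?_ h.lt hpq
  intro p q r h1 h2 a ha c hc
  obtain ⟨b, hb⟩ := h.nonempty q
  exact (h1 a ha b hb).trans (h2 b hb c hc)

variable (col)

/-- Sort `A` and cut the list into its maximal runs of constant color. -/
theorem exists_isBlocks (A : Finset K) : ∃ (N : ℕ) (w : Fin N → V) (B : Fin N → Finset K),
    IsBlocks col w B ∧ ∀ k, k ∈ A ↔ ∃ p, k ∈ B p := by
  classical
  obtain ⟨l, hl⟩ : ∃ l, (A.sort (· ≤ ·)).splitBy (fun x y => decide (col x = col y)) = l :=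
    ⟨_, rfl⟩
  obtain ⟨hflat, hnil, hchain, hadj⟩ := List.splitBy_eq_iff.1 hl
  have hne : ∀ p, l.get p ≠ [] := fun p h => hnil (h ▸ List.get_mem l p)
  have hcol : ∀ (p : Fin l.length), ∀ x ∈ l.get p, ∀ y ∈ l.get p, col x = col y := by
    intro p
    have h1 : (l.get p).IsChain fun x y => col x = col y := by
      simpa using hchain _ (List.get_mem l p)
    have : Trans (fun x y => col x = col y) (fun x y => col x = col y)
      (fun x y => col x = col y) := ⟨fun h h' => h.trans h'⟩
    have : Std.Symm fun x y => col x = col y := ⟨fun _ _ h => h.symm⟩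
    exact (List.isChain_iff_pairwise.1 h1).forall_of_forall fun _ _ => rfl
  have hsort : l.flatten.Pairwise (· < ·) := by
    rw [← hflat]
    exact A.sortedLT_sort.pairwise
  rw [List.pairwise_flatten] at hsort
  refine ⟨l.length, fun p => col ((l.get p).head (hne p)), fun p => (l.get p).toFinset,
    ⟨fun p => ?_, fun p k hk => ?_, fun p q hpq => ?_, fun p q hpq a ha b hb => ?_⟩, fun k => ?_⟩
  · exact ⟨_, List.mem_toFinset.2 (List.head_mem (hne p))⟩
  · exact hcol p _ (List.mem_toFinset.1 hk) _ (List.head_mem (hne p))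
  -- The last element of one run and the first of the next differ in color, and each run has a
  -- single color.
  · obtain ⟨ha, hb, h2⟩ := List.isChain_iff_getElem.1 hadj p (by have := q.2; omega)
    simp only [decide_eq_false_iff_not] at h2
    obtain ⟨q, hq⟩ := q
    obtain rfl : q = p + 1 := hpq
    exact fun h => h2 ((hcol p _ (List.getLast_mem ha) _ (List.head_mem (hne p))).trans h)
  · exact List.pairwise_iff_get.1 hsort.2 p q (by rw [Fin.lt_def]; omega) a
      (List.mem_toFinset.1 ha) b (List.mem_toFinset.1 hb)
  · rw [← Finset.mem_sort (· ≤ ·), hflat, List.mem_flatten]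
    simp only [List.mem_toFinset]
    constructor
    · rintro ⟨x, hx, hk⟩
      obtain ⟨p, rfl⟩ := List.mem_iff_get.1 hx
      exact ⟨p, hk⟩
    · rintro ⟨p, hk⟩
      exact ⟨_, List.get_mem l p, hk⟩

variable {col}

/-- Any block decomposition, with its blocks sorted, satisfies the properties characterizing the
list of maximal runs. This gives uniqueness. -/
theorem IsBlocks.splitBy_sort [DecidableEq V] {N : ℕ} {w : Fin N → V} {B : Fin N → Finset K}
    (h : IsBlocks col w B) {A : Finset K} (hA : ∀ k, k ∈ A ↔ ∃ p, k ∈ B p) :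
    (A.sort (· ≤ ·)).splitBy (fun x y => decide (col x = col y)) =
      List.ofFn fun p => (B p).sort (· ≤ ·) := by
  have hcol : ∀ p, ∀ x ∈ (B p).sort (· ≤ ·), col x = w p := fun p x hx =>
    h.color p x ((Finset.mem_sort _).1 hx)
  rw [List.splitBy_eq_iff]
  refine ⟨?_, ?_, ?_, ?_⟩
  · have hlt : (List.ofFn fun p => (B p).sort (· ≤ ·)).flatten.Pairwise (· < ·) := by
      rw [List.pairwise_flatten]
      constructor
      · intro l hl
        obtain ⟨p, rfl⟩ := (List.mem_ofFn' _ _).1 hl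
        exact (B p).sortedLT_sort.pairwise
      · rw [List.pairwise_ofFn]
        intro p q hpq x hx y hy
        exact h.lt_of_lt hpq x ((Finset.mem_sort _).1 hx) y ((Finset.mem_sort _).1 hy)
    refine List.Perm.eq_of_pairwise (le := (· < ·)) (fun a b _ _ h1 h2 => (lt_asymm h1 h2).elim)
      A.sortedLT_sort.pairwise hlt ?_
    rw [List.perm_ext_iff_of_nodup A.sortedLT_sort.nodup (hlt.imp fun h => h.ne)]
    intro k
    rw [Finset.mem_sort, hA, List.mem_flatten]
    constructor
    · rintro ⟨p, hp⟩
      exact ⟨_, (List.mem_ofFn' _ _).2 ⟨p, rfl⟩, (Finset.mem_sort _).2 hp⟩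
    · rintro ⟨l, hl, hk⟩
      obtain ⟨p, rfl⟩ := (List.mem_ofFn' _ _).1 hl
      exact ⟨p, (Finset.mem_sort _).1 hk⟩
  · intro hl
    obtain ⟨p, hp⟩ := (List.mem_ofFn' _ _).1 hl
    obtain ⟨k, hk⟩ := h.nonempty p
    have := (Finset.mem_sort (· ≤ ·)).2 hk
    simp only at hp
    rw [hp] at this
    simp at this
  · intro l hl
    obtain ⟨p, rfl⟩ := (List.mem_ofFn' _ _).1 hl
    refine List.Pairwise.isChain (List.pairwise_of_forall_mem_list fun x hx y hy => ?_)
    simp [hcol p x hx, hcol p y hy]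
  · rw [List.isChain_iff_getElem]
    intro i hi
    simp only [List.length_ofFn] at hi
    simp only [List.getElem_ofFn]
    have hn : ∀ p, (B p).sort (· ≤ ·) ≠ [] := by
      intro p hp
      obtain ⟨k, hk⟩ := h.nonempty p
      have := (Finset.mem_sort (· ≤ ·)).2 hk
      rw [hp] at this
      simp at this
    refine ⟨hn _, hn _, ?_⟩
    rw [decide_eq_false_iff_not, hcol _ _ (List.getLast_mem _), hcol _ _ (List.head_mem _)]
    exact h.ne _ _ rfl

theorem IsBlocks.unique {N N' : ℕ} {w : Fin N → V} {B : Fin N → Finset K} {w' : Fin N' → V}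
    {B' : Fin N' → Finset K} (h : IsBlocks col w B) (h' : IsBlocks col w' B')
    (hB : ∀ k, (∃ p, k ∈ B p) ↔ ∃ p, k ∈ B' p) :
    (⟨N, w, B⟩ : Σ N, (Fin N → V) × (Fin N → Finset K)) = ⟨N', w', B'⟩ := by
  classical
  let A : Finset K := Finset.univ.biUnion B
  have hA : ∀ k, k ∈ A ↔ ∃ p, k ∈ B p := by simp [A]
  have h1 := (h.splitBy_sort hA).symm.trans (h'.splitBy_sort fun k => (hA k).trans (hB k))
  obtain ⟨rfl, h2⟩ := Sigma.mk.inj (List.ofFn_inj'.1 h1)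
  have h3 : B = B' := by
    funext p
    have h4 := congrFun (eq_of_heq h2) p
    rw [← Finset.sort_toFinset (B p) (· ≤ ·), h4, Finset.sort_toFinset]
  subst h3
  have h5 : w = w' := by
    funext p
    obtain ⟨k, hk⟩ := h.nonempty p
    exact (h.color p k hk).symm.trans (h'.color p k hk)
  rw [h5]

end Blocks

/-! The expansion of weight enumerators of labeled posets into those of chains -/

namespace LabeledPoset

variable (P : LabeledPoset) {L : Type} [LinearOrder L] (primed : L → Prop)

/-- The enriched set-valued partitions over an alphabet some of whose letters are primed. -/
def enrichedMaps : Set (P.V → Finset L) :=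
  {σ | (∀ s, (σ s).Nonempty) ∧ ∀ s t, s ⋖ t → SetLE (σ s) (σ t) ∧
    (P.label s < P.label t → ∀ l ∈ σ s ∩ σ t, ¬ primed l) ∧
    (P.label s > P.label t → ∀ l ∈ σ s ∩ σ t, primed l)}

/-- A letter at a vertex of a labeled poset. -/
@[ext] structure PlacedLetter {L : Type} (_primed : L → Prop) where
  /-- the letter -/
  letter : L
  /-- the vertex -/
  vertex : P.V

namespace PlacedLetter

variable {P primed}

open Classical in
/-- Placed letters are compared by their letters first, then by the labels of their vertices,
reversing the order for primed letters. -/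
noncomputable def key (x : P.PlacedLetter primed) : L ×ₗ ℤ :=
  toLex (x.letter, if primed x.letter then -P.label x.vertex else P.label x.vertex)

omit [LinearOrder L] in
theorem key_injective : Function.Injective (key : P.PlacedLetter primed → L ×ₗ ℤ) := by
  rintro ⟨a, s⟩ ⟨b, t⟩ h
  obtain ⟨h1, h2⟩ := Prod.mk.inj (toLex.injective h)
  dsimp only at h1 h2
  subst h1
  have : P.label s = P.label t := by
    split_ifs at h2 <;> omega
  rw [P.label_inj this]

noncomputable instance : LinearOrder (P.PlacedLetter primed) :=
  LinearOrder.lift' key key_injective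

/-- The enriched condition on two letters at different vertices is a strict inequality in a linear
order. Equal unprimed letters are ordered by increasing labels, equal primed ones by decreasing
labels. -/
theorem lt_iff {a b : L} {s t : P.V} (hst : s ≠ t) :
    (⟨a, s⟩ : P.PlacedLetter primed) < ⟨b, t⟩ ↔ a ≤ b ∧ (a = b →
      (P.label s < P.label t → ¬ primed a) ∧ (P.label s > P.label t → primed a)) := by
  have h : (⟨a, s⟩ : P.PlacedLetter primed) < ⟨b, t⟩ ↔
    key (⟨a, s⟩ : P.PlacedLetter primed) < key (⟨b, t⟩ : P.PlacedLetter primed) := Iff.rfl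
  rw [h, key, key, Prod.Lex.toLex_lt_toLex]
  dsimp only
  have hl : P.label s ≠ P.label t := P.label_inj.ne hst
  rcases lt_trichotomy a b with hab | rfl | hab
  · simp [hab, hab.le, hab.ne]
  · by_cases hp : primed a
    · simp only [hp, lt_irrefl, if_true, le_refl, true_and, false_or, not_true, imp_false]
      simp only [forall_const, imp_true_iff, and_true, neg_lt_neg_iff]
      omega
    · simp only [hp, lt_irrefl, if_false, le_refl, true_and, false_or, not_false_eq_true,
        imp_false, forall_const, imp_true_iff, true_and]
      omega
  · simp [hab.not_ge, hab.not_gt, hab.ne']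

end PlacedLetter

variable {P primed}

/-- As the condition on covers is an inequality in a linear order, it extends along saturated chains
to all `s < t`. -/
theorem mem_enrichedMaps {σ : P.V → Finset L} :
    σ ∈ P.enrichedMaps primed ↔ (∀ s, (σ s).Nonempty) ∧ ∀ s t, s < t →
      ∀ a ∈ σ s, ∀ b ∈ σ t, (⟨a, s⟩ : P.PlacedLetter primed) < ⟨b, t⟩ := by
  refine and_congr_right fun hne => ?_
  have h1 : ∀ s t, s ⋖ t → ((SetLE (σ s) (σ t) ∧
      (P.label s < P.label t → ∀ l ∈ σ s ∩ σ t, ¬ primed l) ∧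
      (P.label s > P.label t → ∀ l ∈ σ s ∩ σ t, primed l)) ↔
      ∀ a ∈ σ s, ∀ b ∈ σ t, (⟨a, s⟩ : P.PlacedLetter primed) < ⟨b, t⟩) := by
    intro s t hst
    simp only [PlacedLetter.lt_iff hst.lt.ne]
    exact setLE_and_iff
  constructor
  · intro h s t hst
    classical
    let : LocallyFiniteOrder P.V := Fintype.toLocallyFiniteOrder
    induction lt_iff_transGen_covBy.1 hst with
    | single hc => exact (h1 _ _ hc).1 (h _ _ hc)
    | tail hu hc ih =>
      intro a ha c hc'
      -- Transitivity passes through a letter at the intermediate vertex; this is where nonempty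
      -- values are needed.
      obtain ⟨b, hb⟩ := hne _
      exact (ih (lt_iff_transGen_covBy.2 hu) a ha b hb).trans ((h1 _ _ hc).1 (h _ _ hc) b hb c hc')
  · exact fun h s t hst => (h1 s t hst).2 (h s t hst.lt)

end LabeledPoset

/-- The tuples of sets that are weakly increasing, where the sets with indices `p` and `q = p + 1`
share only primed letters if `q ∈ D` and only unprimed letters otherwise. -/
def chainMaps {L : Type} [LinearOrder L] (primed : L → Prop) (N : ℕ) (D : Set ℕ) :
    Set (Fin N → Finset L) :=
  {S | (∀ p, (S p).Nonempty) ∧ ∀ p q : Fin N, (q : ℕ) = p + 1 → SetLE (S p) (S q) ∧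
    ((q : ℕ) ∉ D → ∀ l ∈ S p ∩ S q, ¬ primed l) ∧ ((q : ℕ) ∈ D → ∀ l ∈ S p ∩ S q, primed l)}

namespace LabeledPoset

variable (P : LabeledPoset)

/-- The words in which every vertex occurs, no vertex occurs twice in a row, and all occurrences
of a vertex precede those of all larger vertices. -/
@[ext] structure Word where
  /-- the number of letters -/
  length : ℕ
  /-- the letters -/
  vertex : Fin length → P.V
  surjective : Function.Surjective vertex
  lt_of_lt : ∀ p q, vertex p < vertex q → p < q
  ne : ∀ p q : Fin length, (q : ℕ) = p + 1 → vertex p ≠ vertex q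

namespace Word

variable {P} (w : P.Word)

/-- The positions after which the label decreases. -/
def descents : Set ℕ :=
  {i | ∃ p q : Fin w.length, (q : ℕ) = p + 1 ∧ (q : ℕ) = i ∧
    P.label (w.vertex p) > P.label (w.vertex q)}

theorem mem_descents {p q : Fin w.length} (hpq : (q : ℕ) = p + 1) :
    (q : ℕ) ∈ w.descents ↔ P.label (w.vertex p) > P.label (w.vertex q) := by
  constructor
  · rintro ⟨p', q', h1, h2, h3⟩
    obtain rfl : q' = q := Fin.ext h2
    obtain rfl : p' = p := Fin.ext (by omega)
    exact h3
  · exact fun h => ⟨p, q, hpq, rfl, h⟩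

open Classical in
/-- The composition whose inner partial sums are the descents. -/
noncomputable def composition : Composition w.length :=
  CompositionAsSet.toComposition
    { boundaries := Finset.univ.filter fun b => b = 0 ∨ b = Fin.last _ ∨ (b : ℕ) ∈ w.descents
      zero_mem := by simp
      getLast_mem := by simp }

theorem innerSums_composition : w.composition.innerSums = w.descents := by
  ext i
  rw [Composition.mem_innerSums_iff, composition, CompositionAsSet.toComposition_boundaries]
  constructor
  · rintro ⟨b, hb, rfl, h1, h2⟩
    simp only [Finset.mem_filter, Finset.mem_univ, true_and] at hb
    rcases hb with h | h | h
    · subst h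
      simp at h1
    · subst h
      simp at h2
    · exact h
  · rintro ⟨p, q, hpq, rfl, h⟩
    refine ⟨q.castSucc, ?_, rfl, by omega, q.2⟩
    simp only [Finset.mem_filter, Finset.mem_univ, true_and]
    exact Or.inr (Or.inr ⟨p, q, hpq, rfl, h⟩)

theorem card_le_length : Fintype.card P.V ≤ w.length := by
  simpa using Fintype.card_le_of_surjective _ w.surjective

theorem finite_length_eq (N : ℕ) : {w : P.Word | w.length = N}.Finite := by
  refine Set.Finite.of_finite_image (f := fun w : P.Word => (⟨w.length, w.vertex⟩ :
    Σ N, Fin N → P.V)) ((Set.finite_range (Sigma.mk N)).subset ?_) ?_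
  · rintro _ ⟨w, rfl, rfl⟩
    exact ⟨_, rfl⟩
  · intro w _ w' _ h
    obtain ⟨h1, h2⟩ := Sigma.mk.inj h
    exact Word.ext h1 h2

variable {L : Type} [LinearOrder L] {primed : L → Prop}

/-- Adjacent vertices of a word differ, so the chain condition compares placed letters just as in
`P`. -/
theorem mem_chainMaps {S : Fin w.length → Finset L} :
    S ∈ chainMaps primed w.length w.descents ↔ (∀ p, (S p).Nonempty) ∧
      ∀ p q : Fin w.length, (q : ℕ) = p + 1 → ∀ a ∈ S p, ∀ b ∈ S q,
        (⟨a, w.vertex p⟩ : P.PlacedLetter primed) < ⟨b, w.vertex q⟩ := by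
  refine and_congr_right fun _ => forall_congr' fun p => forall_congr' fun q =>
    forall_congr' fun hpq => ?_
  have hl := P.label_inj.ne (w.ne p q hpq)
  have h2 : (q : ℕ) ∉ w.descents ↔ P.label (w.vertex p) < P.label (w.vertex q) := by
    rw [w.mem_descents hpq]
    omega
  simp only [PlacedLetter.lt_iff (w.ne p q hpq), ← h2, ← w.mem_descents hpq]
  exact setLE_and_iff

/-- The union of the sets at the occurrences of each vertex. -/
noncomputable def merge (S : Fin w.length → Finset L) : P.V → Finset L :=
  pushforward w.vertex (fun _ => id) S

omit [LinearOrder L] in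
theorem mem_merge {S : Fin w.length → Finset L} {s : P.V} {l : L} :
    l ∈ w.merge S s ↔ ∃ p, w.vertex p = s ∧ l ∈ S p := by
  simp [merge, mem_pushforward]

variable (primed)

/-- The sets of a tuple, placed at the vertices of the word. -/
noncomputable def blocks (S : Fin w.length → Finset L) (p : Fin w.length) :
    Finset (P.PlacedLetter primed) :=
  (S p).image fun l => ⟨l, w.vertex p⟩

variable {primed}

theorem mem_blocks {S : Fin w.length → Finset L} {p : Fin w.length} {x : P.PlacedLetter primed} :
    x ∈ w.blocks primed S p ↔ x.letter ∈ S p ∧ w.vertex p = x.vertex := by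
  rw [blocks, Finset.mem_image]
  constructor
  · rintro ⟨l, hl, rfl⟩
    exact ⟨hl, rfl⟩
  · rintro ⟨h1, h2⟩
    exact ⟨x.letter, h1, PlacedLetter.ext rfl h2⟩

theorem exists_mem_blocks {S : Fin w.length → Finset L} {x : P.PlacedLetter primed} :
    (∃ p, x ∈ w.blocks primed S p) ↔ x.letter ∈ w.merge S x.vertex := by
  simp only [mem_blocks, mem_merge, and_comm]

theorem isBlocks {S : Fin w.length → Finset L}
    (hS : S ∈ chainMaps primed w.length w.descents) :
    IsBlocks PlacedLetter.vertex w.vertex (w.blocks primed S) := by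
  obtain ⟨h1, h2⟩ := w.mem_chainMaps.1 hS
  refine ⟨fun p => (h1 p).image _, fun p x hx => (w.mem_blocks.1 hx).2.symm, w.ne, ?_⟩
  rintro p q hpq ⟨a, s⟩ ha ⟨b, t⟩ hb
  obtain ⟨ha, rfl⟩ := w.mem_blocks.1 ha
  obtain ⟨hb, rfl⟩ := w.mem_blocks.1 hb
  exact h2 p q hpq a ha b hb

theorem placed_lt {S : Fin w.length → Finset L} (hS : S ∈ chainMaps primed w.length w.descents)
    {p q : Fin w.length} (hpq : p < q) {a b : L} (ha : a ∈ S p) (hb : b ∈ S q) :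
    (⟨a, w.vertex p⟩ : P.PlacedLetter primed) < ⟨b, w.vertex q⟩ :=
  (w.isBlocks hS).lt_of_lt hpq _ (w.mem_blocks.2 ⟨ha, rfl⟩) _ (w.mem_blocks.2 ⟨hb, rfl⟩)

/-- If `s < t`, every occurrence of `s` precedes every occurrence of `t` in the word, and placed
letters increase along it. -/
theorem merge_mem {S : Fin w.length → Finset L}
    (hS : S ∈ chainMaps primed w.length w.descents) : w.merge S ∈ P.enrichedMaps primed := by
  refine mem_enrichedMaps.2 ⟨fun s => ?_, fun s t hst a ha b hb => ?_⟩
  · obtain ⟨p, rfl⟩ := w.surjective s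
    obtain ⟨l, hl⟩ := hS.1 p
    exact ⟨l, w.mem_merge.2 ⟨p, rfl, hl⟩⟩
  · obtain ⟨p, rfl, hp⟩ := w.mem_merge.1 ha
    obtain ⟨q, rfl, hq⟩ := w.mem_merge.1 hb
    exact w.placed_lt hS (w.lt_of_lt p q hst) hp hq

/-- List the placed letters of `σ` in increasing order and color each by its vertex. The colors of
the maximal runs spell the word, and the letters of the runs form the tuple. -/
theorem exists_merge_eq {σ : P.V → Finset L} (hσ : σ ∈ P.enrichedMaps primed) :
    ∃ w : P.Word, ∃ S ∈ chainMaps primed w.length w.descents, w.merge S = σ := by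
  classical
  obtain ⟨hne, hlt⟩ := mem_enrichedMaps.1 hσ
  obtain ⟨N, v, B, hB, hA⟩ := exists_isBlocks (PlacedLetter.vertex (P := P) (_primed := primed))
    (Finset.univ.biUnion fun s => (σ s).image fun l => ⟨l, s⟩)
  have hmem : ∀ l s, l ∈ σ s ↔ ∃ p, (⟨l, s⟩ : P.PlacedLetter primed) ∈ B p := by
    intro l s
    rw [← hA]
    simp
  have hcol : ∀ {p a s}, (⟨a, s⟩ : P.PlacedLetter primed) ∈ B p → s = v p :=
    fun h => hB.color _ _ h
  let w : P.Word :=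
    { length := N
      vertex := v
      surjective := fun s => by
        obtain ⟨l, hl⟩ := hne s
        obtain ⟨p, hp⟩ := (hmem l s).1 hl
        exact ⟨p, (hcol hp).symm⟩
      lt_of_lt := fun p q hpq => by
        obtain ⟨⟨a, s⟩, ha⟩ := hB.nonempty p
        obtain ⟨⟨b, t⟩, hb⟩ := hB.nonempty q
        rw [← hcol ha, ← hcol hb] at hpq
        by_contra hle
        rcases (not_lt.1 hle).eq_or_lt with rfl | hqp
        · exact hpq.ne ((hcol ha).trans (hcol hb).symm)
        · exact lt_asymm (hB.lt_of_lt hqp _ hb _ ha)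
            (hlt s t hpq a ((hmem _ _).2 ⟨p, ha⟩) b ((hmem _ _).2 ⟨q, hb⟩))
      ne := hB.ne }
  have hS : ∀ p l, l ∈ (B p).image PlacedLetter.letter ↔
      (⟨l, v p⟩ : P.PlacedLetter primed) ∈ B p := by
    intro p l
    rw [Finset.mem_image]
    constructor
    · rintro ⟨⟨a, s⟩, h, rfl⟩
      rwa [← hcol h]
    · exact fun h => ⟨_, h, rfl⟩
  refine ⟨w, fun p => (B p).image PlacedLetter.letter, w.mem_chainMaps.2
    ⟨fun p => (hB.nonempty p).image _, fun p q hpq a ha b hb => ?_⟩, ?_⟩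
  · exact hB.lt p q hpq _ ((hS p a).1 ha) _ ((hS q b).1 hb)
  · funext s
    ext l
    rw [mem_merge, hmem]
    constructor
    · rintro ⟨p, rfl, h⟩
      exact ⟨p, (hS p l).1 h⟩
    · rintro ⟨p, h⟩
      obtain rfl := hcol h
      exact ⟨p, rfl, (hS p l).2 h⟩

/-- Both tuples give block decompositions of the same set of placed letters, which are unique. -/
theorem eq_of_merge_eq {w w' : P.Word} {S : Fin w.length → Finset L}
    {S' : Fin w'.length → Finset L} (hS : S ∈ chainMaps primed w.length w.descents)
    (hS' : S' ∈ chainMaps primed w'.length w'.descents) (h : w.merge S = w'.merge S') :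
    (⟨w.length, w.vertex, w.blocks primed S⟩ :
      Σ N, (Fin N → P.V) × (Fin N → Finset (P.PlacedLetter primed))) =
      ⟨w'.length, w'.vertex, w'.blocks primed S'⟩ :=
  (w.isBlocks hS).unique (w'.isBlocks hS') fun x => by
    rw [exists_mem_blocks, exists_mem_blocks, h]

theorem merge_injOn : Set.InjOn w.merge (chainMaps primed w.length w.descents) := by
  intro S hS S' hS' h
  have h1 := (Prod.mk.inj (eq_of_heq (Sigma.mk.inj (eq_of_merge_eq hS hS' h)).2)).2
  funext p
  refine Finset.image_injective (f := fun l => (⟨l, w.vertex p⟩ : P.PlacedLetter primed)) ?_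
    (congrFun h1 p)
  exact fun a b hab => congrArg PlacedLetter.letter hab

theorem merge_disjoint {w w' : P.Word} {S : Fin w.length → Finset L}
    {S' : Fin w'.length → Finset L} (hS : S ∈ chainMaps primed w.length w.descents)
    (hS' : S' ∈ chainMaps primed w'.length w'.descents) (h : w.merge S = w'.merge S') :
    w = w' := by
  have h1 := eq_of_merge_eq hS hS' h
  have h2 := congrArg (fun x => (⟨x.1, x.2.1⟩ : Σ N, Fin N → P.V)) h1
  obtain ⟨h3, h4⟩ := Sigma.mk.inj h2
  exact Word.ext h3 h4

/-- A shared letter at two occurrences of one vertex would be a placed letter smaller than itself.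
So merging loses no letters. -/
theorem ne_of_vertex_eq {S : Fin w.length → Finset L}
    (hS : S ∈ chainMaps primed w.length w.descents) (p q : Fin w.length) (hpq : p ≠ q)
    (h : w.vertex p = w.vertex q) : ∀ a ∈ S p, ∀ b ∈ S q, a ≠ b := by
  rintro a ha _ hb rfl
  rcases hpq.lt_or_gt with hlt | hlt
  · have := w.placed_lt hS hlt ha hb
    rw [h] at this
    exact lt_irrefl _ this
  · have := w.placed_lt hS hlt hb ha
    rw [h] at this
    exact lt_irrefl _ this

end Word

variable {P}

/-- The weight enumerator of a labeled poset is a combination of those of chains. -/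
theorem genFun_enrichedMaps {L : Type} [LinearOrder L] (primed : L → Prop) (abs : L → ℕ+)
    (habs : ∀ n, {l | abs l = n}.Finite) (m : ℕ+ →₀ ℕ) :
    genFun abs (P.enrichedMaps primed) m = ∑ᶠ w : P.Word, beta ^ (w.length - Fintype.card P.V) *
      genFun abs (chainMaps primed w.length w.descents) m := by
  refine genFun_iUnion (A' := fun w : P.Word => Fin w.length) abs abs habs (fun w => w.merge)
    (fun w => w.length - Fintype.card P.V)
    (fun σ => ⟨Word.exists_merge_eq, ?_⟩) (fun w => w.merge_injOn)
    (fun w w' S hS S' hS' => Word.merge_disjoint hS hS') (fun w S hS => ?_) (fun w S hS => ?_) m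
  · rintro ⟨w, S, hS, rfl⟩
    exact w.merge_mem hS
  · exact mapWeight_pushforward abs abs (fun _ _ => rfl) (fun _ => Function.injective_id)
      (w.ne_of_vertex_eq hS)
  · have h1 : mapLength (w.merge S) = mapLength S :=
      mapLength_pushforward (fun _ => Function.injective_id) (w.ne_of_vertex_eq hS)
    have h2 := card_le_mapLength hS.1
    have h3 := w.card_le_length
    rw [Fintype.card_fin] at h2
    rw [h1, Fintype.card_fin]
    omega

end LabeledPoset

/-! ### Construction of theta and the main theorem. -/

namespace LabeledPoset

variable (P : LabeledPoset)

/-- The continuous linear map sending a word to the multiple of its descent composition that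
occurs in the expansion of the weight enumerator of `P`. -/
noncomputable def Word.toCompositions : LC P.Word →L[Scal] LC AnyComposition :=
  LC.extend (fun w => beta ^ (w.length - Fintype.card P.V) •
    LC.basis (⟨w.length, w.composition⟩ : AnyComposition)) fun α =>
      (Word.finite_length_eq α.1).subset fun w hw => by
        rw [Set.mem_ofPred_eq, Pi.smul_apply] at hw
        exact (congrArg Sigma.fst (LC.eq_of_basis_ne_zero (right_ne_zero_of_smul hw))).symm

/-- The argument `1` is the constant function, that is, the formal sum of all words. -/
theorem apply_toCompositions (H : LC AnyComposition →L[Scal] MQSym) (m : ℕ+ →₀ ℕ) :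
    (H (Word.toCompositions P 1) : MvPowerSeries ℕ+ Scal) m =
      ∑ᶠ w : P.Word, beta ^ (w.length - Fintype.card P.V) *
        (H (LC.basis ⟨w.length, w.composition⟩) : MvPowerSeries ℕ+ Scal) m := by
  let F : LC P.Word →L[Scal] LC (ℕ+ →₀ ℕ) := MQSym.subtypeL.comp (H.comp (Word.toCompositions P))
  have h : F 1 m = _ := LC.apply_eq_finsum F 1 m
  refine h.trans (finsum_congr fun w => ?_)
  have h1 : F (LC.basis w) m = (H (Word.toCompositions P (LC.basis w)) :
    MvPowerSeries ℕ+ Scal) m := rfl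
  rw [h1, Word.toCompositions, LC.extend_basis, map_smul, Pi.one_apply, one_mul]
  rfl

/-- With no primed letters, the condition at a descent says that the two sets are disjoint; together
with `SetLE` this is `SetLT`. -/
theorem setValued_eq : P.setValued = P.enrichedMaps fun _ : ℕ+ => False := by
  ext σ
  refine and_congr_right fun _ => forall_congr' fun s => forall_congr' fun t =>
    forall_congr' fun hst => ?_
  have hl := P.label_inj.ne hst.lt.ne
  simp only [not_false_eq_true, imp_true_iff, true_and, SetLE, SetLT, Finset.mem_inter, imp_false,
    not_and]
  refine and_congr_right fun h => imp_congr_right fun _ => ⟨fun h' l h1 h2 =>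
    lt_irrefl _ (h' l h1 l h2), fun h' a ha b hb => (h a ha b hb).lt_of_ne ?_⟩
  rintro rfl
  exact h' a ha hb

theorem enriched_ofLabeledPoset :
    (MarkedPoset.ofLabeledPoset P).enriched = P.enrichedMaps Marked.IsPrimed := by
  ext σ
  simp only [MarkedPoset.enriched, enrichedMaps, Finset.mem_inter]
  exact and_congr_right fun _ => and_iff_left fun _ hv => hv.elim

end LabeledPoset

theorem fundamentalTuples_eq {N : ℕ} (α : Composition N) :
    fundamentalTuples α = chainMaps (fun _ : ℕ+ => False) N α.innerSums := by
  ext S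
  refine and_congr_right fun _ => forall_congr' fun p => forall_congr' fun q =>
    forall_congr' fun hpq => ?_
  simp only [not_false_eq_true, imp_true_iff, true_and, SetLE, SetLT, Finset.mem_inter, imp_false,
    not_and]
  refine and_congr_right fun h => imp_congr_right fun _ => ⟨fun h' l h1 h2 =>
    lt_irrefl _ (h' l h1 l h2), fun h' a ha b hb => (h a ha b hb).lt_of_ne ?_⟩
  rintro rfl
  exact h' a ha hb

theorem peakTuples_eq (N : ℕ) (D : Set ℕ) : peakTuples N D = chainMaps Marked.IsPrimed N D := by
  ext S
  simp only [peakTuples, chainMaps, Set.mem_ofPred_eq, Finset.mem_inter]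
  exact and_congr_right fun _ => forall_congr' fun p => forall_congr' fun q =>
    imp_congr_right fun _ => and_congr_right fun _ => and_comm

/-- The continuous linear map with `α ↦ K^(β)_{Λ(α)}`. -/
noncomputable def peakMap : LC AnyComposition →L[Scal] MQSym :=
  MQSym.extend (fun α => multiPeak α.2.peak) fun m =>
    (AnyComposition.finite_size_le m.degree).subset fun α hα => by
      have := card_le_degree Marked.abs (peakTuples α.1 α.2.peak.innerSums)
        (fun σ hσ => hσ.1) hα
      rwa [Fintype.card_fin] at this

theorem peakMap_basis (α : AnyComposition) : peakMap (LC.basis α) = multiPeak α.2.peak :=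
  MQSym.extend_basis _ _ _

namespace LabeledPoset

variable (P : LabeledPoset)

/-- The word expansion over the alphabet without primed letters. The same element of `LC
AnyComposition` gives `Omega P` under `peakMap`. -/
theorem fundamentalMap_toCompositions : fundamentalMap (Word.toCompositions P 1) = Gam P := by
  refine Subtype.ext (funext fun m => ?_)
  have h : (Gam P : MvPowerSeries ℕ+ Scal) m = genFun id (P.enrichedMaps fun _ => False) m := by
    rw [← setValued_eq]
    rfl
  rw [h, genFun_enrichedMaps _ id fun n => Set.finite_singleton n, apply_toCompositions]
  refine finsum_congr fun w => ?_
  rw [fundamentalMap_basis, coe_multiFundamental, fundamentalTuples_eq, w.innerSums_composition]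

theorem peakMap_toCompositions : peakMap (Word.toCompositions P 1) = Omega P := by
  refine Subtype.ext (funext fun m => ?_)
  have h : (Omega P : MvPowerSeries ℕ+ Scal) m =
      genFun Marked.abs (P.enrichedMaps Marked.IsPrimed) m := by
    rw [← enriched_ofLabeledPoset]
    rfl
  rw [h, genFun_enrichedMaps _ _ Marked.finite_abs_eq, apply_toCompositions]
  refine finsum_congr fun w => ?_
  rw [peakMap_basis, multiPeak_peak, coe_multiPeak, peakTuples_eq, w.innerSums_composition]

end LabeledPoset

/-- `Θ` is `peakMap` after the coordinates in the pseudobasis `L_α`. The triangle commutes because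
`Gam P` and `Omega P` are images of one formal combination of compositions. -/
theorem exists_unique_theta : ∃ Θ : MQSym →L[Scal] MQSym, IsTheta Θ ∧
    (∀ Θ' : MQSym →L[Scal] MQSym, IsTheta Θ' → Θ' = Θ) ∧
    Θ ∘L PhiLt = PhiEnriched ∘L MLPoset.toPlus := by
  obtain ⟨G, hG, hG'⟩ := exists_fundamentalMap_inverse
  refine ⟨peakMap ∘L G, fun N α => ?_, fun Θ' h => ?_, LC.ext_basis fun c => ?_⟩
  · rw [← fundamentalMap_basis ⟨N, α⟩, ContinuousLinearMap.comp_apply, hG', peakMap_basis]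
  -- The defining values fix `Θ'` after `fundamentalMap`, which is surjective.
  · have h1 : Θ' ∘L fundamentalMap = peakMap := LC.ext_basis fun α => by
      rw [ContinuousLinearMap.comp_apply, fundamentalMap_basis, h, peakMap_basis]
    ext1 f
    rw [← h1, ContinuousLinearMap.comp_apply, ContinuousLinearMap.comp_apply, hG]
  · induction c using Quotient.inductionOn with
    | h P =>
      rw [ContinuousLinearMap.comp_apply, ContinuousLinearMap.comp_apply,
        ContinuousLinearMap.comp_apply, LabeledPoset.PhiLt_basis,
        LabeledPoset.PhiEnriched_toPlus_basis, ← P.fundamentalMap_toCompositions, hG',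
        P.peakMap_toCompositions]

theorem mainTheorem8 :
    -- the mirroring map is an endomorphism of the LC-Hopf algebra of labeled posets
    IsLCHopfMorphism MLPoset.hopf MLPoset.hopf Psi ∧
    -- the upper right triangle
    PhiLt ∘L Psi = PhiEnriched ∘L MLPoset.toPlus ∧
    -- there is exactly one continuous linear map with the defining values of Theta, and the lower
    -- left triangle commutes
    (∃ Θ : MQSym →L[Scal] MQSym, IsTheta Θ ∧ (∀ Θ' : MQSym →L[Scal] MQSym, IsTheta Θ' → Θ' = Θ) ∧
      Θ ∘L PhiLt = PhiEnriched ∘L MLPoset.toPlus) ∧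
    -- the expansion of the enriched weight enumerator
    ∀ (P : LabeledPoset) (hP : P.Positive),
      Omega P = ∑ p ∈ P.covers, beta ^ (p.1 ∩ p.2).card • Gam (P.mirror hP p.1 p.2) :=
  ⟨Psi_isLCHopfMorphism, LabeledPoset.PhiLt_comp_Psi, exists_unique_theta,
    fun _ hP => LabeledPoset.Omega_eq_sum hP⟩
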